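/- Let $d\ge 2$, let $\langle\cdot,\cdot\rangle$ be the standard scalar product of $\mathbb R^{d+1}$, let $\sigma$ be spherical Lebesgue measure on the unit sphere $\mathbb S^d\subset\mathbb R^{d+1}$, and write $\omega_k=2\pi^{k/2}/\Gamma(k/2)$, so that $\sigma(\mathbb S^d)=\omega_{d+1}$. For a unit vector $e$ let $\mathbb S_e^+=\{u\in\mathbb S^d:\langle u,e\rangle\ge 0\}$, and let $\mu=\frac{2}{\omega_{d+1}}\,\sigma|_{\mathbb S_e^+}$ be the uniform probability measure on $\mathbb S_e^+$. For $A\subset\mathbb S^d$ let $\mathrm{conv}_s A=\mathbb S^d\cap\mathrm{pos}\,A$, where $\mathrm{pos}\,A$ is the set of finite nonnegative linear combinations of elements of $A$. For $n\ge d+1$ let $P_n=\mathrm{conv}_s\{X_1,\dots,X_n\}$, where $X_1,\dots,X_n$ are independent random points in $\mathbb S_e^+$ with distribution $\mu$, and let $f_0(P_n)$ be the number of vertices of $P_n$, that is, of one-dimensional faces of the cone $\mathrm{pos}\,P_n$. For orthogonal unit vectors $e,\bar e$ consider $$C(d)=\int_{(e^\perp\cap\mathbb S_{\bar e}^+)^d}\nabla_d(u_1,\dots,u_d)\int_{\mathrm{conv}_s\{u_1,\dots,u_d\}}\langle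 x,\bar e\rangle\,\sigma_{d-1}(\mathrm dx)\,\sigma_{d-1}^d(\mathrm d(u_1,\dots,u_d)),$$ where $\sigma_{d-1}$ is spherical Lebesgue measure on the unit sphere of $e^\perp$ and $\nabla_d(u_1,\dots,u_d)$ is the $d$-dimensional volume of the parallelepiped spanned by $u_1,\dots,u_d$. This integral converges and depends only on $d$, not on the choice of $e,\bar e$. Moreover, $\sigma(\mathbb S_e^+\setminus P_n)$ and $f_0(P_n)$ are integrable, and $$\mathbb E\,\sigma(\mathbb S_e^+\setminus P_n)=C(d)\,\pi^{d+1}\left(\frac{2}{\omega_{d+1}}\right)^{d}\omega_d\,n^{-1}+O(n^{-2}),$$ where the constant in $O(n^{-2})$ depends only on $d$; and $$\lim_{n\to\infty}\mathbb E\,f_0(P_n)=C(d)\,\pi^{d+1}\left(\frac{2}{\omega_{d+1}}\right)^{d+1}\omega_d.$$ -/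

import Mathlib

open MeasureTheory ProbabilityTheory Filter Topology

namespace SphPoly

/-- The total measure `ω_k = 2 π^{k/2} / Γ(k/2)` of the unit sphere of `ℝ^k`. -/
noncomputable def omega (k : ℕ) : ℝ :=
  2 * Real.pi ^ ((k : ℝ) / 2) / Real.Gamma ((k : ℝ) / 2)

section General

variable {V : Type*} [NormedAddCommGroup V] [InnerProductSpace ℝ V]

/-- The positive hull: all finite linear combinations of points of `A` with nonnegative
coefficients. -/
noncomputable def pos (A : Set V) : Set V :=
  (PointedCone.hull ℝ A : Set V)

/-- The spherical convex hull `conv_s A`: the unit sphere intersected with `pos A`. -/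
noncomputable def convS (A : Set V) : Set V :=
  Metric.sphere (0 : V) 1 ∩ pos A

/-- The closed halfsphere `{u : ‖u‖ = 1, ⟨u, e⟩ ≥ 0}` with centre `e`. -/
noncomputable def halfSphere (e : V) : Set V :=
  {u | u ∈ Metric.sphere (0 : V) 1 ∧ 0 ≤ inner ℝ u e}

/-- The `k`-dimensional faces of a spherical polytope `P`: the intersections of the sphere with
the `(k+1)`-dimensional faces of the cone `pos P`. (A face of a convex set is a convex subset that
contains every segment of the set having a relatively interior point in it; the affine hull of a
nonempty face of a cone passes through `0`, so its dimension is that of its linear span.) -/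
noncomputable def faces (k : ℕ) (P : Set V) : Set (Set V) :=
  {F | ∃ G : Set V, IsExtreme ℝ (pos P) G ∧ Convex ℝ G ∧
    Module.finrank ℝ (Submodule.span ℝ G) = k + 1 ∧ F = G ∩ Metric.sphere (0 : V) 1}

/-- The number `f_k(P)` of `k`-dimensional faces. -/
noncomputable def faceCount (k : ℕ) (P : Set V) : ℕ :=
  (faces k P).ncard

variable [FiniteDimensional ℝ V] [MeasurableSpace V] [BorelSpace V]

/-- Spherical Lebesgue measure on the unit sphere of a Euclidean space `V`, regarded as a measure
on `V` that is carried by the sphere. -/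
noncomputable def sphMeasure (V : Type*) [NormedAddCommGroup V] [InnerProductSpace ℝ V]
    [FiniteDimensional ℝ V] [MeasurableSpace V] [BorelSpace V] : Measure V :=
  ((volume : Measure V).toSphere).map (Subtype.val : Metric.sphere (0 : V) 1 → V)

/-- The uniform probability measure on the halfsphere with centre `e`: spherical Lebesgue measure
restricted to the halfsphere, times `2 / ω_{dim V}`. -/
noncomputable def uniformHalf (e : V) : Measure V :=
  ENNReal.ofReal (2 / omega (Module.finrank ℝ V)) • (sphMeasure V).restrict (halfSphere e)

/-- `u ↦ ∇(u₁,…,u_d) ∫_{conv_s {u₁,…,u_d}} ⟨x, ē⟩ σ(dx)`, where `∇` is the volume of the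
parallelepiped spanned by `u₁,…,u_d`. -/
noncomputable def weight (d : ℕ) (ebar : V) (u : Fin d → V) : ℝ :=
  (volume : Measure V).real (parallelepiped u) *
    ∫ x in convS (Set.range u), inner ℝ x ebar ∂(sphMeasure V)

/-- The `d`-fold product of spherical Lebesgue measure restricted to the halfsphere with
centre `ē`. -/
noncomputable def halfPow (d : ℕ) (ebar : V) : Measure (Fin d → V) :=
  Measure.pi fun _ : Fin d => (sphMeasure V).restrict (halfSphere ebar)

end General

/-- `ℝ^{d+1}`; its unit sphere is `𝕊^d`. -/
abbrev E (d : ℕ) : Type := EuclideanSpace ℝ (Fin (d + 1))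

/-- The hyperplane `e^⊥`, a `d`-dimensional Euclidean space if `e ≠ 0`. -/
noncomputable abbrev perp {d : ℕ} (e : E d) : Submodule ℝ (E d) := (Submodule.span ℝ {e})ᗮ

/-- The integral
`∫_{(e^⊥ ∩ 𝕊_ē^+)^d} ∇_d(u₁,…,u_d) ∫_{conv_s {u₁,…,u_d}} ⟨x, ē⟩ σ_{d-1}(dx) σ_{d-1}^d(d(u₁,…,u_d))`,
carried out inside the Euclidean space `e^⊥`. -/
noncomputable def constInt {d : ℕ} (e : E d) (ebar : perp e) : ℝ :=
  ∫ u, weight d ebar u ∂(halfPow d ebar)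

/-- The spherical polytope `P_n = conv_s {X₁,…,X_n}` at the outcome `w`. -/
noncomputable def randPoly {d n : ℕ} {Ω : Type*} (X : Fin n → Ω → E d) (w : Ω) : Set (E d) :=
  convS (Set.range fun i => X i w)

end SphPoly

/-! Central projection sends the open half-sphere with pole `e` to the half-cylinder of points `(u,
t)` with `u` in the unit sphere of `ℝ^d` and `t > 0`. There the uniform measure has the density
`kern` in `t`, membership in positive hulls is unchanged, and a hyperplane through the origin that
avoids the pole is a graph `t = ⟪h, u⟫`. The part of the half-sphere below this graph is a lune of
probability `arctan ‖h‖ / π` (`cylProb_le_inner`).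

Over a direction `u`, the hull of the points consists of the heights that are at least the value of
a linear program. In general position this program has exactly one optimal basis of `d` points
(`exists_isOptimal`, `IsOptimal.unique`), so the missed region splits, up to null sets, into the
pieces below the lower facets (`measure_notMem_hull_eq`). This requires the directions of the points
to span `ℝ^d` positively, which fails only with exponentially small probability
(`exists_missesOrthant_le`). Up to that error the expected missed measure is therefore `n.choose d *
facetInt d (n - d)`, where the exponent counts the remaining points, each lying above the hyperplane
of the facet with probability `1 - arctan ‖h‖ / π`.

In `facetInt` the heights of the `d` points are exchanged for the normal `h` of their hyperplane,
with Jacobian `∇_d`, and `h = r w` is put in polar coordinates (`facetInt_eq`). Near `r = 0` the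
density `kern` is `1 + O(r²)`, and what remains is `C(d) ω_d r^d (1 + O(r²))`. With `x = arctan r`
the main term becomes the Beta integral of `x^d (1 - x/π)^(n-d)` over `[0, π]`; its product with the
binomial coefficient is exactly `π^(d+1) / (n+1)`. The corrections carry `x^(d+2)` and are `O(n⁻²)`.

The vertices are handled by Efron's argument: almost surely a point is a vertex exactly if it is not
in the positive hull of the others, so the expected number of vertices of `P_n` is `n · 2/ω_{d+1}`
times the expected measure missed by `P_{n-1}` (`measure_extremeAt`). -/

open scoped ENNReal

namespace SphPoly

/-! ### Spherical Lebesgue measure and polar coordinates. -/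

section SphereMeasure

variable {V : Type*} [NormedAddCommGroup V] [InnerProductSpace ℝ V] [FiniteDimensional ℝ V]
  [MeasurableSpace V] [BorelSpace V]

instance : IsFiniteMeasure (sphMeasure V) := by
  unfold sphMeasure; infer_instance

theorem lintegral_sphMeasure {f : V → ℝ≥0∞} (hf : Measurable f) :
    ∫⁻ x, f x ∂sphMeasure V
      = ∫⁻ x : Metric.sphere (0 : V) 1, f x ∂(volume : Measure V).toSphere :=
  lintegral_map hf measurable_subtype_coe

theorem ae_sphMeasure_norm : ∀ᵐ x ∂sphMeasure V, ‖x‖ = 1 := by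
  unfold sphMeasure
  rw [ae_map_iff measurable_subtype_coe.aemeasurable
    (measurableSet_eq_fun measurable_norm measurable_const)]
  exact .of_forall fun x => by simp

theorem lintegral_polar [Nontrivial V] {f : V → ℝ≥0∞} (hf : Measurable f) :
    (∫⁻ x, f x) = ∫⁻ u, (∫⁻ r in Set.Ioi (0 : ℝ),
      ENNReal.ofReal (r ^ (Module.finrank ℝ V - 1)) * f (r • u)) ∂sphMeasure V := by
  have hm : Measurable fun u : V => ∫⁻ r in Set.Ioi (0 : ℝ),
      ENNReal.ofReal (r ^ (Module.finrank ℝ V - 1)) * f (r • u) := by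
    apply Measurable.lintegral_prod_right'
      (f := fun p : V × ℝ => ENNReal.ofReal (p.2 ^ (Module.finrank ℝ V - 1)) * f (p.2 • p.1))
    fun_prop
  rw [lintegral_sphMeasure hm]
  have h0 : (∫⁻ x, f x) = ∫⁻ x : ({(0 : V)}ᶜ : Set V), f x ∂((volume : Measure V).comap (↑)) := by
    rw [lintegral_subtype_comap (measurableSet_singleton _).compl f,
      restrict_compl_singleton]
  have h1 := (Measure.measurePreserving_homeomorphUnitSphereProd
    (volume : Measure V)).lintegral_comp_emb (Homeomorph.measurableEmbedding _)
    (fun p => f ((p.2 : ℝ) • (p.1 : V)))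
  rw [h0]
  have h2 : ∀ x : ({(0 : V)}ᶜ : Set V),
      (((homeomorphUnitSphereProd V x).2 : ℝ) • ((homeomorphUnitSphereProd V x).1 : V)) = x := by
    intro x
    have hx : (x : V) ≠ 0 := x.2
    simp [smul_smul, norm_ne_zero_iff.2 hx]
  simp only [h2] at h1
  rw [h1, lintegral_prod]
  · refine lintegral_congr fun u => ?_
    rw [Measure.volumeIoiPow, lintegral_withDensity_eq_lintegral_mul, ← lintegral_subtype_comap
      measurableSet_Ioi fun r : ℝ => ENNReal.ofReal (r ^ (Module.finrank ℝ V - 1)) * f (r • u)]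
    · rfl
    · fun_prop
    · fun_prop
  · fun_prop

/-- `Measure.toSphere` has total mass `k` times the volume of the unit ball of `ℝ^k`, and `Γ(k/2 +
1) = (k/2) Γ(k/2)` turns this into `ω_k`. -/
theorem sphMeasure_univ [Nontrivial V] :
    sphMeasure V Set.univ = ENNReal.ofReal (omega (Module.finrank ℝ V)) := by
  have hk : 0 < Module.finrank ℝ V := Module.finrank_pos
  unfold sphMeasure
  rw [Measure.map_apply measurable_subtype_coe MeasurableSet.univ, Set.preimage_univ,
    Measure.toSphere_apply_univ, InnerProductSpace.volume_ball, ENNReal.ofReal_one, one_pow, one_mul,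
    ← ENNReal.ofReal_natCast, ← ENNReal.ofReal_mul (by positivity)]
  congr 1
  have hk' : (0 : ℝ) < (Module.finrank ℝ V : ℝ) := by exact_mod_cast hk
  rw [omega, Real.Gamma_add_one (by positivity), Real.sqrt_eq_rpow, ← Real.rpow_natCast,
    ← Real.rpow_mul Real.pi_pos.le]
  have := (Real.Gamma_pos_of_pos (show 0 < (Module.finrank ℝ V : ℝ) / 2 by positivity)).ne'
  field_simp

theorem omega_pos {k : ℕ} (hk : 0 < k) : 0 < omega k := by
  unfold omega
  have : (0 : ℝ) < k := by exact_mod_cast hk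
  have := Real.Gamma_pos_of_pos (show 0 < (k : ℝ) / 2 by positivity)
  positivity

theorem omega_add_two {k : ℕ} (hk : 0 < k) : omega (k + 2) = 2 * Real.pi / k * omega k := by
  unfold omega
  have h : (0 : ℝ) < k := by exact_mod_cast hk
  have := Real.Gamma_pos_of_pos (show 0 < (k : ℝ) / 2 by positivity)
  rw [show ((k + 2 : ℕ) : ℝ) / 2 = (k : ℝ) / 2 + 1 by push_cast; ring,
    Real.Gamma_add_one (by positivity), Real.rpow_add_one Real.pi_pos.ne']
  field_simp

variable {W : Type*} [NormedAddCommGroup W] [InnerProductSpace ℝ W] [FiniteDimensional ℝ W]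
  [MeasurableSpace W] [BorelSpace W]

/-- The measure of a subset of the sphere is the dimension times the volume of the truncated cone
over it; linear isometries preserve both. -/
theorem map_sphMeasure (φ : V ≃ₗᵢ[ℝ] W) : (sphMeasure V).map φ = sphMeasure W := by
  ext s hs
  have hφ : Measurable φ := φ.continuous.measurable
  rw [Measure.map_apply hφ hs]
  unfold sphMeasure
  rw [Measure.map_apply measurable_subtype_coe hs,
    Measure.map_apply measurable_subtype_coe (hφ hs),
    Measure.toSphere_apply' _ (measurable_subtype_coe hs),
    Measure.toSphere_apply' _ (measurable_subtype_coe (hφ hs)), φ.toLinearEquiv.finrank_eq,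
    ← φ.measurePreserving.measure_preimage_equiv (f := φ.toMeasurableEquiv)]
  congr 2
  ext x
  simp only [Set.mem_smul, Set.mem_image, Set.mem_preimage, Subtype.exists, mem_sphere_iff_norm,
    sub_zero, exists_and_right, exists_eq_right, LinearIsometryEquiv.coe_toMeasurableEquiv]
  constructor
  · rintro ⟨r, hr, y, ⟨h1, h2⟩, rfl⟩
    exact ⟨r, hr, φ y, ⟨by simpa using h1, h2⟩, by simp⟩
  · rintro ⟨r, hr, y, ⟨h1, h2⟩, h3⟩
    refine ⟨r, hr, φ.symm y, ⟨by simpa using h1, by simpa using h2⟩, ?_⟩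
    apply φ.injective
    simp [h3]

/-- Integration of a function that is constant on open rays. -/
theorem lintegral_homogeneous [Nontrivial V] {f : V → ℝ≥0∞} (hf : Measurable f)
    (hom : ∀ r : ℝ, 0 < r → ∀ x, f (r • x) = f x) {g : ℝ → ℝ≥0∞} (hg : Measurable g) :
    (∫⁻ x : V, f x * g ‖x‖) = (∫⁻ u, f u ∂sphMeasure V) *
      ∫⁻ r in Set.Ioi (0 : ℝ), ENNReal.ofReal (r ^ (Module.finrank ℝ V - 1)) * g r := by
  rw [lintegral_polar (by fun_prop), ← lintegral_mul_const _ hf]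
  apply lintegral_congr_ae
  filter_upwards [ae_sphMeasure_norm (V := V)] with u hu
  rw [← lintegral_const_mul _ (by fun_prop)]
  refine setLIntegral_congr_fun measurableSet_Ioi fun r hr => ?_
  simp only [Set.mem_Ioi] at hr
  simp only [hom r hr, norm_smul, hu, mul_one, Real.norm_eq_abs, abs_of_pos hr]
  ring

theorem sphMeasure_cone_eq_zero [Nontrivial V] {s : Set V} (hs : MeasurableSet s)
    (hom : ∀ r : ℝ, 0 < r → ∀ x ∈ s, r • x ∈ s) (h0 : (volume : Measure V) s = 0) :
    sphMeasure V s = 0 := by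
  unfold sphMeasure
  rw [Measure.map_apply measurable_subtype_coe hs,
    Measure.toSphere_apply' _ (measurable_subtype_coe hs)]
  refine mul_eq_zero_of_right _ (measure_mono_null ?_ h0)
  rintro _ ⟨r, hr, _, ⟨y, hy, rfl⟩, rfl⟩
  exact hom r hr.1 _ hy

theorem sphMeasure_submodule [Nontrivial V] (S : Submodule ℝ V) (hS : S ≠ ⊤) :
    sphMeasure V S = 0 :=
  sphMeasure_cone_eq_zero S.closed_of_finiteDimensional.measurableSet
    (fun r _ _ hx => S.smul_mem r hx) (Measure.addHaar_submodule _ S hS)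

end SphereMeasure

end SphPoly

namespace SphPoly

/-! ### Isometries between unit vectors, and cylindrical coordinates on the sphere. -/

theorem orthonormal_domRestrict_singleton {V ι : Type*} [NormedAddCommGroup V]
    [InnerProductSpace ℝ V] (i : ι) {v : V} (hv : ‖v‖ = 1) :
    Orthonormal ℝ (({i} : Set ι).domRestrict fun _ => v) :=
  ⟨fun _ => hv, fun a b hab => (hab (Subsingleton.elim a b)).elim⟩

/-- Both vectors are completed to orthonormal bases that carry them at the same index, and the bases
are matched. This puts `e` at the pole of the cylinder and makes `C(d)` independent of `e` and `ē`.
-/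
theorem exists_linearIsometryEquiv_map_eq {V W : Type*} [NormedAddCommGroup V]
    [InnerProductSpace ℝ V] [FiniteDimensional ℝ V] [NormedAddCommGroup W]
    [InnerProductSpace ℝ W] [FiniteDimensional ℝ W]
    (h : Module.finrank ℝ V = Module.finrank ℝ W) {v : V} {w : W} (hv : ‖v‖ = 1) (hw : ‖w‖ = 1) :
    ∃ φ : V ≃ₗᵢ[ℝ] W, φ v = w := by
  have hk : 0 < Module.finrank ℝ V := by
    have : Nontrivial V := ⟨v, 0, by rintro rfl; simp at hv⟩
    exact Module.finrank_pos
  let i : Fin (Module.finrank ℝ V) := ⟨0, hk⟩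
  obtain ⟨b, hb⟩ := (orthonormal_domRestrict_singleton i hv).exists_orthonormalBasis_extension_of_card_eq (𝕜 := ℝ) (by simp)
  obtain ⟨b', hb'⟩ := (orthonormal_domRestrict_singleton i hw).exists_orthonormalBasis_extension_of_card_eq (𝕜 := ℝ)
    (by simp [h])
  refine ⟨b.equiv b' (Equiv.refl _), ?_⟩
  have h1 : b i = v := hb i rfl
  have h2 : b' i = w := hb' i rfl
  rw [← h1, ← h2]
  simp

theorem lintegral_comp_const_mul {s : ℝ} (hs : 0 < s) {φ : ℝ → ℝ≥0∞} (hφ : Measurable φ) :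
    (∫⁻ t, φ (s * t)) = ENNReal.ofReal s⁻¹ * ∫⁻ t, φ t := by
  have h := Real.map_volume_mul_left hs.ne'
  have h2 : ∫⁻ t, φ t ∂(Measure.map (s * ·) volume) = ∫⁻ t, φ (s * t) :=
    lintegral_map hφ (measurable_const_mul s)
  rw [← h2, h, lintegral_smul_measure, abs_of_pos (by positivity), smul_eq_mul]

theorem setLIntegral_Ioi_comp_const_mul {s : ℝ} (hs : 0 < s) {φ : ℝ → ℝ≥0∞} (hφ : Measurable φ) :
    (∫⁻ t in Set.Ioi 0, φ (s * t)) = ENNReal.ofReal s⁻¹ * ∫⁻ t in Set.Ioi 0, φ t := by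
  rw [← lintegral_indicator measurableSet_Ioi, ← lintegral_indicator measurableSet_Ioi,
    ← lintegral_comp_const_mul hs (hφ.indicator measurableSet_Ioi)]
  refine lintegral_congr fun t => ?_
  by_cases h : 0 < t
  · simp [h, hs]
  · simp [h, hs]

/-- The density of the height `t` of a point `(u, t)` of the cylinder over the unit sphere of a
`d`-dimensional space, under central projection from the sphere of the next dimension. -/
noncomputable def kern (d : ℕ) (t : ℝ) : ℝ := (√(1 + t ^ 2) ^ (d + 1))⁻¹

theorem kern_pos (d : ℕ) (t : ℝ) : 0 < kern d t := by
  unfold kern; positivity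

theorem continuous_kern (d : ℕ) : Continuous (kern d) := by
  unfold kern
  refine Continuous.inv₀ (by fun_prop) fun t => ?_
  positivity

@[fun_prop]
theorem measurable_kern (d : ℕ) : Measurable (kern d) := (continuous_kern d).measurable

section Cylinder

variable {F E' : Type*} [NormedAddCommGroup F] [InnerProductSpace ℝ F] [FiniteDimensional ℝ F]
  [MeasurableSpace F] [BorelSpace F] [NormedAddCommGroup E'] [InnerProductSpace ℝ E']
  [FiniteDimensional ℝ E'] [MeasurableSpace E'] [BorelSpace E']

theorem lintegral_exp_radial (d : ℕ) :
    (∫⁻ r in Set.Ioi (0 : ℝ), ENNReal.ofReal (r ^ d) * ENNReal.ofReal (Real.exp (-r)))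
      = ENNReal.ofReal (d.factorial) := by
  rw [← Real.Gamma_nat_eq_factorial, Real.Gamma_eq_integral (by positivity),
    ofReal_integral_eq_lintegral_ofReal]
  · refine setLIntegral_congr_fun measurableSet_Ioi fun r hr => ?_
    simp only [Set.mem_Ioi] at hr
    rw [← ENNReal.ofReal_mul (by positivity)]
    congr 1
    simp [mul_comm]
  · exact Real.GammaIntegral_convergent (by positivity)
  · refine (ae_restrict_iff' measurableSet_Ioi).2 (.of_forall fun r hr => ?_)
    simp only [Set.mem_Ioi] at hr
    simp only [Pi.zero_apply]
    positivity

/-- Spherical Lebesgue measure in cylindrical coordinates. -/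
theorem lintegral_cylinder [Nontrivial F] (J : WithLp 2 (F × ℝ) ≃ₗᵢ[ℝ] E') {f : E' → ℝ≥0∞}
    (hf : Measurable f) (hom : ∀ r : ℝ, 0 < r → ∀ x, f (r • x) = f x) :
    ∫⁻ x, f x ∂sphMeasure E' = ∫⁻ u, (∫⁻ t : ℝ,
      ENNReal.ofReal (kern (Module.finrank ℝ F) t) * f (J (WithLp.toLp 2 (u, t))))
        ∂sphMeasure F := by
  set d := Module.finrank ℝ F with hd
  have hd0 : 0 < d := Module.finrank_pos
  have hdE : Module.finrank ℝ E' = d + 1 := by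
    rw [← J.toLinearEquiv.finrank_eq, (WithLp.linearEquiv 2 ℝ (F × ℝ)).finrank_eq]
    simp [hd]
  have : Nontrivial E' := by
    apply Module.nontrivial_of_finrank_pos (R := ℝ); omega
  -- The sphere is reached through Lebesgue measure: the function, constant on rays, is integrated
  -- against a radial weight, once in polar coordinates of `E'` and once over `F × ℝ`. With the
  -- weight `exp (-r)` both sides acquire the factor `d!`, which cancels at the end.
  set g : ℝ → ℝ≥0∞ := fun r => ENNReal.ofReal (Real.exp (-r)) with hg
  have hgm : Measurable g := by fun_prop
  have key := lintegral_homogeneous hf hom hgm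
  rw [hdE, Nat.add_sub_cancel, lintegral_exp_radial] at key
  have hJm : Measurable fun p : F × ℝ => J (WithLp.toLp 2 p) :=
    J.continuous.measurable.comp (WithLp.measurable_toLp 2 (F × ℝ))
  have hL : (∫⁻ x : E', f x * g ‖x‖) = (∫⁻ u, (∫⁻ t : ℝ,
      ENNReal.ofReal (kern d t) * f (J (WithLp.toLp 2 (u, t)))) ∂sphMeasure F)
        * ENNReal.ofReal (d.factorial) := by
    have e1 : (∫⁻ x : E', f x * g ‖x‖) = ∫⁻ p : F × ℝ, f (J (WithLp.toLp 2 p)) *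
        g (√(‖p.1‖ ^ 2 + p.2 ^ 2)) := by
      have := (J.measurePreserving.comp (WithLp.volume_preserving_toLp F ℝ)).lintegral_comp (f := fun x => f x * g ‖x‖) (by fun_prop)
      rw [← this]
      refine lintegral_congr fun p => ?_
      simp [WithLp.prod_norm_eq_of_L2]
    rw [e1, Measure.volume_eq_prod, lintegral_prod _ (by fun_prop), lintegral_polar (by
      apply Measurable.lintegral_prod_right' (f := fun p : F × ℝ =>
        f (J (WithLp.toLp 2 p)) * g (√(‖p.1‖ ^ 2 + p.2 ^ 2)))
      fun_prop), ← lintegral_mul_const]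
    swap
    · apply Measurable.lintegral_prod_right' (f := fun p : F × ℝ =>
        ENNReal.ofReal (kern d p.2) * f (J (WithLp.toLp 2 p)))
      fun_prop
    apply lintegral_congr_ae
    filter_upwards [ae_sphMeasure_norm (V := F)] with u hu
    have hJu : Measurable fun t : ℝ => J (WithLp.toLp 2 (u, t)) :=
      hJm.comp (by fun_prop)
    -- Substitution `z = r t` on the ray over `u`; the Jacobian raises `r ^ (d - 1)` to `r ^ d`.
    have e2 : ∀ r ∈ Set.Ioi (0 : ℝ), ENNReal.ofReal (r ^ (d - 1)) * (∫⁻ z : ℝ,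
        f (J (WithLp.toLp 2 (r • u, z))) * g (√(‖r • u‖ ^ 2 + z ^ 2))) =
        ∫⁻ t : ℝ, f (J (WithLp.toLp 2 (u, t))) *
          (ENNReal.ofReal (r ^ d) * g (√(1 + t ^ 2) * r)) := by
      intro r hr
      simp only [Set.mem_Ioi] at hr
      have hm : Measurable fun z : ℝ =>
          f (J (WithLp.toLp 2 (r • u, z))) * g (√(‖r • u‖ ^ 2 + z ^ 2)) := by
        have : Measurable fun z : ℝ => J (WithLp.toLp 2 (r • u, z)) :=
          hJm.comp (by fun_prop)
        fun_prop
      have h3 := lintegral_comp_const_mul hr hm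
      have h4 : (∫⁻ z : ℝ, f (J (WithLp.toLp 2 (r • u, z))) * g (√(‖r • u‖ ^ 2 + z ^ 2)))
          = ENNReal.ofReal r * ∫⁻ t : ℝ, f (J (WithLp.toLp 2 (r • u, r * t))) *
            g (√(‖r • u‖ ^ 2 + (r * t) ^ 2)) := by
        rw [h3, ← mul_assoc, ← ENNReal.ofReal_mul hr.le, mul_inv_cancel₀ hr.ne']
        simp
      rw [h4, ← mul_assoc, ← ENNReal.ofReal_mul (by positivity), ← pow_succ,
        Nat.sub_add_cancel hd0, ← lintegral_const_mul']
      swap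
      · exact ENNReal.ofReal_ne_top
      refine lintegral_congr fun t => ?_
      have h5 : J (WithLp.toLp 2 (r • u, r * t)) = r • J (WithLp.toLp 2 (u, t)) := by
        rw [← map_smul]; rfl
      have h6 : √(‖r • u‖ ^ 2 + (r * t) ^ 2) = √(1 + t ^ 2) * r := by
        rw [norm_smul, hu, mul_one, Real.norm_eq_abs, sq_abs,
          show r ^ 2 + (r * t) ^ 2 = (1 + t ^ 2) * r ^ 2 by ring,
          Real.sqrt_mul (by positivity), Real.sqrt_sq hr.le]
      rw [h5, hom r hr, h6]
      ring
    rw [setLIntegral_congr_fun measurableSet_Ioi e2, lintegral_lintegral_swap]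
    swap
    · fun_prop
    rw [← lintegral_mul_const _ (by fun_prop)]
    refine lintegral_congr fun t => ?_
    rw [lintegral_const_mul _ (by fun_prop)]
    have hs : 0 < √(1 + t ^ 2) := by positivity
    -- Rescaling `r` by `√(1 + t²)` releases `d` factors from `r ^ d` and one from `dr`: these form
    -- `kern d t`.
    have h7 : (∫⁻ r in Set.Ioi (0 : ℝ), ENNReal.ofReal (r ^ d) * g (√(1 + t ^ 2) * r))
        = ENNReal.ofReal (kern d t) * ENNReal.ofReal (d.factorial) := by
      rw [← lintegral_exp_radial]
      have h8 := setLIntegral_Ioi_comp_const_mul hs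
        (φ := fun r => ENNReal.ofReal (r ^ d) * g r) (by fun_prop)
      have h9 : ENNReal.ofReal (kern d t) =
          ENNReal.ofReal ((√(1 + t ^ 2) ^ d)⁻¹) * ENNReal.ofReal (√(1 + t ^ 2))⁻¹ := by
        rw [← ENNReal.ofReal_mul (by positivity), kern, pow_succ, mul_inv]
      rw [h9, mul_assoc, ← h8, ← lintegral_const_mul _ (by fun_prop)]
      refine setLIntegral_congr_fun measurableSet_Ioi fun r hr => ?_
      simp only [Set.mem_Ioi] at hr
      have h10 : ENNReal.ofReal (r ^ d) = ENNReal.ofReal ((√(1 + t ^ 2) ^ d)⁻¹) *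
          ENNReal.ofReal ((√(1 + t ^ 2) * r) ^ d) := by
        rw [← ENNReal.ofReal_mul (by positivity)]
        congr 1
        rw [mul_pow]
        field_simp
      rw [h10, mul_assoc]
    rw [h7]
    ring
  rw [hL] at key
  exact ((ENNReal.mul_left_inj (by simp [Nat.factorial_ne_zero]) ENNReal.ofReal_ne_top).1 key).symm

end Cylinder

end SphPoly

namespace SphPoly

/-! ### Positive hulls and the linear program of the lower boundary. -/

theorem mem_hull_range {ι V : Type*} [Fintype ι] [AddCommGroup V] [Module ℝ V] {x : ι → V} {v : V} :
    v ∈ PointedCone.hull ℝ (Set.range x) ↔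
      ∃ c : ι → ℝ, (∀ i, 0 ≤ c i) ∧ ∑ i, c i • x i = v := by
  rw [PointedCone.hull, Submodule.mem_span_range_iff_exists_fun]
  constructor
  · rintro ⟨c, rfl⟩
    exact ⟨fun i => c i, fun i => (c i).2, rfl⟩
  · rintro ⟨c, h, rfl⟩
    exact ⟨fun i => ⟨c i, h i⟩, rfl⟩

section LinearProgram

open scoped Classical in
/-- General position of the points `(y i, t i)` of `F × ℝ` and of `v` in `F`, for `d`-element bases
of the linear program `min ∑ c i * t i` subject to `c ≥ 0` and `∑ c i • y i = v`. -/
structure GeneralPosition {ι F : Type*} [Fintype ι] [AddCommGroup F] [Module ℝ F] (d : ℕ)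
    (y : ι → F) (t : ι → ℝ) (v : F) : Prop where
  pos : ∀ i, 0 < t i
  indep : ∀ c : ι → ℝ, (Finset.univ.filter fun i => c i ≠ 0).card ≤ d →
    ∑ i, c i • y i = 0 → c = 0
  indep_lift : ∀ c : ι → ℝ, (Finset.univ.filter fun i => c i ≠ 0).card ≤ d + 1 →
    ∑ i, c i • y i = 0 → ∑ i, c i * t i = 0 → c = 0
  card_le : ∀ c : ι → ℝ, ∑ i, c i • y i = v → d ≤ (Finset.univ.filter fun i => c i ≠ 0).card

variable {ι F : Type*} [Fintype ι] [AddCommGroup F] [Module ℝ F] {d : ℕ}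
  {y : ι → F} {t : ι → ℝ} {v : F}

/-- `I` is the optimal basis: `v` is a nonnegative combination of the `y i` with `i ∈ I`, and all
other points lie above the hyperplane `h` through the `(y i, t i)` with `i ∈ I`. -/
structure IsOptimal (y : ι → F) (t : ι → ℝ) (v : F) (I : Finset ι) (h : F →ₗ[ℝ] ℝ) : Prop where
  feasible : ∃ c : ι → ℝ, (∀ i, 0 ≤ c i) ∧ (∀ i ∉ I, c i = 0) ∧ ∑ i, c i • y i = v
  dual : ∀ j ∉ I, h (y j) < t j

/-- Weak duality: the hyperplane lies weakly below all lifted points, hence below all their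
nonnegative combinations. -/
theorem IsOptimal.le_of_mem_hull {I : Finset ι} {h : F →ₗ[ℝ] ℝ} (hI : ∀ i ∈ I, h (y i) = t i)
    (ho : IsOptimal y t v I h) {s : ℝ}
    (hs : (v, s) ∈ PointedCone.hull ℝ (Set.range fun i => (y i, t i))) : h v ≤ s := by
  obtain ⟨c, hc, hv⟩ := mem_hull_range.1 hs
  simp only [Prod.smul_mk, smul_eq_mul, Prod.ext_iff, Prod.fst_sum, Prod.snd_sum] at hv
  rw [← hv.1, ← hv.2, map_sum]
  refine Finset.sum_le_sum fun i _ => ?_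
  rw [map_smul, smul_eq_mul]
  by_cases hi : i ∈ I
  · rw [hI i hi]
  · exact mul_le_mul_of_nonneg_left (ho.dual i hi).le (hc i)

/-- The combination supported on `I` reaches the height `h v` itself. Since the `y i` span
positively, a multiple of the vertical direction is also in the hull, and adding it reaches every
greater height. -/
theorem mem_hull_of_le (ht : ∀ i, 0 < t i) (hsp : PointedCone.hull ℝ (Set.range y) = ⊤)
    [Nonempty ι] {I : Finset ι} {h : F →ₗ[ℝ] ℝ} (hI : ∀ i ∈ I, h (y i) = t i)
    (ho : IsOptimal y t v I h) {s : ℝ} (hs : h v ≤ s) :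
    (v, s) ∈ PointedCone.hull ℝ (Set.range fun i => (y i, t i)) := by
  obtain ⟨c, hc, hcI, hv⟩ := ho.feasible
  obtain ⟨i₀⟩ := ‹Nonempty ι›
  -- Writing `-y i₀` as a nonnegative combination yields a nonnegative relation among the `y i` with
  -- a positive coefficient at `i₀`. Its lift is vertical, and of positive height because all `t i`
  -- are positive.
  obtain ⟨b, hb, hby⟩ := mem_hull_range.1
    (show -y i₀ ∈ PointedCone.hull ℝ (Set.range y) by rw [hsp]; trivial)
  classical
  set a : ι → ℝ := fun i => b i + if i = i₀ then 1 else 0 with ha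
  have ha0 : ∀ i, 0 ≤ a i := fun i => by
    have := hb i
    simp only [ha]; split_ifs <;> linarith
  have hay : ∑ i, a i • y i = 0 := by
    simp [ha, add_smul, Finset.sum_add_distrib, hby]
  have hat : 0 < ∑ i, a i * t i := by
    refine Finset.sum_pos' (fun i _ => mul_nonneg (ha0 i) (ht i).le) ⟨i₀, Finset.mem_univ _, ?_⟩
    refine mul_pos ?_ (ht i₀)
    have := hb i₀
    simp only [ha, if_true]; linarith
  have hct : ∑ i, c i * t i = h v := by
    rw [← hv, map_sum]
    refine Finset.sum_congr rfl fun i _ => ?_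
    by_cases hi : i ∈ I
    · rw [map_smul, smul_eq_mul, hI i hi]
    · simp [hcI i hi]
  set q := (s - h v) / ∑ i, a i * t i with hq
  have hq0 : 0 ≤ q := div_nonneg (by linarith) hat.le
  refine mem_hull_range.2 ⟨fun i => c i + q * a i,
    fun i => add_nonneg (hc i) (mul_nonneg hq0 (ha0 i)), ?_⟩
  simp only [Prod.smul_mk, smul_eq_mul, Prod.ext_iff, Prod.fst_sum, Prod.snd_sum]
  constructor
  · simp only [add_smul, mul_smul, Finset.sum_add_distrib, ← Finset.smul_sum, hay, hv]
    simp
  · simp only [add_mul, mul_assoc, Finset.sum_add_distrib, ← Finset.mul_sum, hct]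
    rw [hq, div_mul_cancel₀ _ hat.ne']
    ring

open scoped Classical in
-- Complementary slackness. By `card_le` the combination belonging to `J` has positive coefficients
-- on all of `J`; an index of `J` outside `I` would, by the strict dual inequality for `I`, push its
-- value `k v` strictly above `h v`.
theorem IsOptimal.subset (hg : GeneralPosition d y t v) {I J : Finset ι} (hJd : J.card = d)
    {h k : F →ₗ[ℝ] ℝ} (hI : ∀ i ∈ I, h (y i) = t i) (hJ : ∀ i ∈ J, k (y i) = t i)
    (hIo : IsOptimal y t v I h) (hJo : IsOptimal y t v J k) (hle : k v ≤ h v) : J ⊆ I := by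
  obtain ⟨b, hb, hbJ, hbv⟩ := hJo.feasible
  have hsub : (Finset.univ.filter fun i => b i ≠ 0) ⊆ J := by
    intro i hi
    by_contra hiJ
    exact (Finset.mem_filter.1 hi).2 (hbJ i hiJ)
  have hsupp : (Finset.univ.filter fun i => b i ≠ 0) = J :=
    Finset.eq_of_subset_of_card_le hsub (hJd ▸ hg.card_le b hbv)
  by_contra hnot
  obtain ⟨j, hjJ, hjI⟩ := Finset.not_subset.1 hnot
  have hbj : 0 < b j := lt_of_le_of_ne (hb j) (by
    rw [← hsupp] at hjJ; exact (Finset.mem_filter.1 hjJ).2.symm)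
  have h1 : k v = ∑ i, b i * t i := by
    rw [← hbv, map_sum]
    refine Finset.sum_congr rfl fun i _ => ?_
    by_cases hi : i ∈ J
    · rw [map_smul, smul_eq_mul, hJ i hi]
    · simp [hbJ i hi]
  have h2 : h v < ∑ i, b i * t i := by
    rw [← hbv, map_sum]
    refine Finset.sum_lt_sum (fun i _ => ?_) ⟨j, Finset.mem_univ _, ?_⟩
    · rw [map_smul, smul_eq_mul]
      by_cases hi : i ∈ I
      · rw [hI i hi]
      · exact mul_le_mul_of_nonneg_left (hIo.dual i hi).le (hb i)
    · rw [map_smul, smul_eq_mul]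
      exact mul_lt_mul_of_pos_left (hIo.dual j hjI) hbj
  linarith

theorem IsOptimal.unique (hg : GeneralPosition d y t v) {I J : Finset ι} (hId : I.card = d)
    (hJd : J.card = d) {h k : F →ₗ[ℝ] ℝ} (hI : ∀ i ∈ I, h (y i) = t i)
    (hJ : ∀ i ∈ J, k (y i) = t i) (hIo : IsOptimal y t v I h) (hJo : IsOptimal y t v J k) :
    I = J := by
  rcases le_total (k v) (h v) with hle | hle
  · exact (Finset.eq_of_subset_of_card_le (hIo.subset hg hJd hI hJ hJo hle) (by omega)).symm
  · exact Finset.eq_of_subset_of_card_le (hJo.subset hg hId hJ hI hIo hle) (by omega)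

/-- Positivity of the heights bounds each coefficient in terms of the cost, so the feasible points
with cost at most that of a given one form a compact set. -/
theorem exists_minimizer (ht : ∀ i, 0 < t i) [TopologicalSpace F] [IsTopologicalAddGroup F]
    [ContinuousSMul ℝ F] [T2Space F] (hv : v ∈ PointedCone.hull ℝ (Set.range y)) :
    ∃ c : ι → ℝ, (∀ i, 0 ≤ c i) ∧ ∑ i, c i • y i = v ∧
      ∀ c' : ι → ℝ, (∀ i, 0 ≤ c' i) → ∑ i, c' i • y i = v →
        ∑ i, c i * t i ≤ ∑ i, c' i * t i := by
  obtain ⟨c₀, hc₀, hv₀⟩ := mem_hull_range.1 hv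
  set m := ∑ i, c₀ i * t i with hm
  let S : Set (ι → ℝ) := {c | (∀ i, 0 ≤ c i) ∧ ∑ i, c i • y i = v ∧ ∑ i, c i * t i ≤ m}
  have hcl : IsClosed S := by
    have h1 : IsClosed {c : ι → ℝ | ∀ i, 0 ≤ c i} := by
      simp only [Set.ofPred_forall]
      exact isClosed_iInter fun i => isClosed_le continuous_const (continuous_apply i)
    have h2 : IsClosed {c : ι → ℝ | ∑ i, c i • y i = v} :=
      isClosed_eq (by fun_prop) continuous_const
    have h3 : IsClosed {c : ι → ℝ | ∑ i, c i * t i ≤ m} :=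
      isClosed_le (by fun_prop) continuous_const
    exact h1.inter (h2.inter h3)
  have hS : S ⊆ Set.Icc 0 fun i => m / t i := by
    rintro c ⟨h1, -, h3⟩
    refine ⟨h1, fun i => ?_⟩
    rw [le_div_iff₀ (ht i)]
    exact (Finset.single_le_sum (f := fun i => c i * t i)
      (fun i _ => mul_nonneg (h1 i) (ht i).le) (Finset.mem_univ i)).trans h3
  have hcomp : IsCompact S := isCompact_Icc.of_isClosed_subset hcl hS
  obtain ⟨c, hc, hmin⟩ := hcomp.exists_isMinOn ⟨c₀, hc₀, hv₀, le_rfl⟩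
    (f := fun c => ∑ i, c i * t i) (by fun_prop)
  refine ⟨c, hc.1, hc.2.1, fun c' h1 h2 => ?_⟩
  by_cases h3 : ∑ i, c' i * t i ≤ m
  · exact hmin ⟨h1, h2, h3⟩
  · exact hc.2.2.trans (not_le.1 h3).le

/-- First-order optimality: a small step from `c` along `a` is still feasible, so it cannot lower
the cost. -/
theorem nonneg_of_minimizer {c : ι → ℝ} (hc : ∀ i, 0 ≤ c i) (hv : ∑ i, c i • y i = v)
    (hmin : ∀ c' : ι → ℝ, (∀ i, 0 ≤ c' i) → ∑ i, c' i • y i = v →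
      ∑ i, c i * t i ≤ ∑ i, c' i * t i)
    {a : ι → ℝ} (ha : ∑ i, a i • y i = 0) (hpos : ∀ i, c i = 0 → 0 ≤ a i) :
    0 ≤ ∑ i, a i * t i := by
  have : ∃ ε : ℝ, 0 < ε ∧ ∀ i, 0 ≤ c i + ε * a i := by
    have h1 : ∀ i, ∀ᶠ ε in 𝓝[>] (0 : ℝ), 0 ≤ c i + ε * a i := by
      intro i
      rcases (hc i).eq_or_lt with h | h
      · filter_upwards [self_mem_nhdsWithin] with ε hε
        rw [← h, zero_add]
        exact mul_nonneg (le_of_lt hε) (hpos i h.symm)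
      · have : Tendsto (fun ε : ℝ => c i + ε * a i) (𝓝[>] 0) (𝓝 (c i + 0 * a i)) :=
          Tendsto.mono_left (Continuous.tendsto (by fun_prop) _) nhdsWithin_le_nhds
        rw [zero_mul, add_zero] at this
        filter_upwards [this.eventually_const_lt h] with ε hε using hε.le
    obtain ⟨ε, h2, h3⟩ := ((eventually_all.2 h1).and self_mem_nhdsWithin).exists
    exact ⟨ε, h3, h2⟩
  obtain ⟨ε, hε, h2⟩ := this
  have h3 := hmin (fun i => c i + ε * a i) h2 (by
    simp only [add_smul, mul_smul, Finset.sum_add_distrib, ← Finset.smul_sum, ha, hv]; simp)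
  simp only [add_mul, mul_assoc, Finset.sum_add_distrib, ← Finset.mul_sum] at h3
  by_contra hneg
  have := mul_neg_of_pos_of_neg hε (not_le.1 hneg)
  linarith

theorem exists_relation [FiniteDimensional ℝ F] (hd : Module.finrank ℝ F = d) (y : ι → F)
    {T : Finset ι} (hT : d < T.card) :
    ∃ a : ι → ℝ, a ≠ 0 ∧ (∀ i ∉ T, a i = 0) ∧ ∑ i, a i • y i = 0 := by
  have hdep : ¬ LinearIndependent ℝ fun i : T => y i := by
    intro h
    have := h.fintype_card_le_finrank
    simp at this
    omega
  obtain ⟨g, hg, i, hi⟩ := Fintype.not_linearIndependent_iff.1 hdep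
  classical
  refine ⟨fun i => if h : i ∈ T then g ⟨i, h⟩ else 0, fun h => hi ?_, fun i hi => by simp [hi], ?_⟩
  · have := congr_fun h i
    simpa using this
  · rw [← hg, ← Finset.sum_subset (Finset.subset_univ T) (fun i _ hi => by simp [hi]),
      ← Finset.sum_coe_sort T]
    simp

open scoped Classical in
theorem card_support_le {a : ι → ℝ} {T : Finset ι} (h : ∀ i ∉ T, a i = 0) :
    (Finset.univ.filter fun i => a i ≠ 0).card ≤ T.card :=
  Finset.card_le_card fun i hi => by
    by_contra hiT
    exact (Finset.mem_filter.1 hi).2 (h i hiT)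

/-- The basis is the support of a minimiser. If it had more than `d` indices, a relation among `d +
1` of them could be followed in both directions, so its cost would vanish, against `indep_lift`;
fewer than `d` is excluded by `card_le`. For `j` outside the support, the relation between `y j` and
the basis, scaled to coefficient `1` at `j`, is an admissible direction whose cost is `t j - h (y
j)`. This is nonnegative by optimality and nonzero by `indep_lift`. -/
theorem exists_isOptimal [TopologicalSpace F] [IsTopologicalAddGroup F] [ContinuousSMul ℝ F]
    [T2Space F] [FiniteDimensional ℝ F] (hd : Module.finrank ℝ F = d)
    (hg : GeneralPosition d y t v) (hv : v ∈ PointedCone.hull ℝ (Set.range y))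
    (h : Finset ι → F →ₗ[ℝ] ℝ) (hI : ∀ I : Finset ι, I.card = d → ∀ i ∈ I, h I (y i) = t i) :
    ∃ I : Finset ι, I.card = d ∧ IsOptimal y t v I (h I) := by
  classical
  obtain ⟨c, hc, hcv, hmin⟩ := exists_minimizer hg.pos hv
  set S := Finset.univ.filter fun i => c i ≠ 0 with hS
  have hS0 : ∀ i, c i = 0 → i ∉ S := fun i hi => by simp [hS, hi]
  have hSd : S.card = d := by
    refine le_antisymm ?_ (hg.card_le c hcv)
    by_contra hlt
    obtain ⟨T, hTS, hT⟩ := Finset.exists_subset_card_eq (show d + 1 ≤ S.card by omega)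
    obtain ⟨a, ha0, haT, hay⟩ := exists_relation hd y (T := T) (by omega)
    have h0 : ∀ i, c i = 0 → a i = 0 := fun i hi => haT i fun hiT => hS0 i hi (hTS hiT)
    have h1 := nonneg_of_minimizer hc hcv hmin hay fun i hi => (h0 i hi).ge
    have h2 := nonneg_of_minimizer hc hcv hmin (a := fun i => -a i) (by simp [hay])
      fun i hi => by simp [h0 i hi]
    simp only [neg_mul, Finset.sum_neg_distrib] at h2
    exact ha0 (hg.indep_lift a ((card_support_le haT).trans hT.le) hay (by linarith))
  refine ⟨S, hSd, ⟨c, hc, fun i hi => by simpa [hS] using hi, hcv⟩, fun j hj => ?_⟩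
  obtain ⟨a, ha0, haT, hay⟩ := exists_relation hd y (T := insert j S)
    (by rw [Finset.card_insert_of_notMem hj]; omega)
  have haj : a j ≠ 0 := by
    intro haj
    refine ha0 (hg.indep a ((card_support_le (T := S) fun i hi => ?_).trans hSd.le) hay)
    by_cases hij : i = j
    · rw [hij, haj]
    · exact haT i (by simp [hij, hi])
  set b : ι → ℝ := fun i => (a j)⁻¹ * a i with hb
  have hbj : b j = 1 := by simp [hb, haj]
  have hby : ∑ i, b i • y i = 0 := by
    simp only [hb, mul_smul, ← Finset.smul_sum, hay, smul_zero]
  have hbT : ∀ i ∉ insert j S, b i = 0 := fun i hi => by simp [hb, haT i hi]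
  have h1 := nonneg_of_minimizer hc hcv hmin hby fun i hi => by
    by_cases hij : i = j
    · rw [hij, hbj]; norm_num
    · exact (hbT i (by simp [hij, hS0 i hi])).ge
  have h2 : ∑ i, b i * t i ≠ 0 := fun h0 => by
    have := hg.indep_lift b ((card_support_le hbT).trans
      (by rw [Finset.card_insert_of_notMem hj]; omega)) hby h0
    rw [this] at hbj
    simp at hbj
  have h3 : ∑ i, b i * t i = t j - h S (y j) := by
    have e1 : h S (∑ i, b i • y i) = 0 := by rw [hby, map_zero]
    rw [map_sum] at e1
    have e2 : ∑ i, b i * t i = ∑ i, (b i * t i - h S (b i • y i)) := by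
      rw [Finset.sum_sub_distrib, e1, sub_zero]
    rw [e2, Finset.sum_eq_single j]
    · simp [hbj]
    · intro i _ hij
      by_cases hi : i ∈ S
      · simp [hI S hSd i hi]
      · simp [hbT i (by simp [hij, hi])]
    · simp
  have := lt_of_le_of_ne h1 h2.symm
  linarith

end LinearProgram

end SphPoly

namespace SphPoly

/-! ### Vertices of a spherical polytope. -/

theorem mem_hull_image {ι V : Type*} [Fintype ι] [AddCommGroup V] [Module ℝ V] {x : ι → V}
    {I : Set ι} {v : V} :
    v ∈ PointedCone.hull ℝ (x '' I) ↔
      ∃ c : ι → ℝ, (∀ i, 0 ≤ c i) ∧ (∀ i ∉ I, c i = 0) ∧ ∑ i, c i • x i = v := by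
  classical
  constructor
  · intro h
    rw [Set.image_eq_range] at h
    obtain ⟨c, hc, hv⟩ := mem_hull_range.1 h
    refine ⟨fun i => if h : i ∈ I then c ⟨i, h⟩ else 0, fun i => ?_, fun i hi => by simp [hi], ?_⟩
    · by_cases h : i ∈ I
      · simp [h, hc]
      · simp [h]
    · rw [← hv, ← Finset.sum_subset (Finset.subset_univ (Finset.univ.filter fun i => i ∈ I))
        (fun i _ hi => by
          have : i ∉ I := fun h => hi (Finset.mem_filter.2 ⟨Finset.mem_univ _, h⟩)
          simp [this]), Finset.sum_subtype (p := fun i => i ∈ I) _ (by simp)]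
      refine Finset.sum_congr rfl fun i _ => ?_
      simp
  · rintro ⟨c, hc, hI, rfl⟩
    refine Submodule.sum_mem _ fun i _ => ?_
    by_cases h : i ∈ I
    · exact Submodule.smul_mem _ (⟨c i, hc i⟩ : {r : ℝ // 0 ≤ r})
        (Submodule.subset_span ⟨i, h, rfl⟩)
    · simp [hI i h]

section Faces

variable {V : Type*} [NormedAddCommGroup V] [InnerProductSpace ℝ V]

theorem smul_mem_pos {A : Set V} {x : V} (hx : x ∈ pos A) {r : ℝ} (hr : 0 ≤ r) :
    r • x ∈ pos A :=
  (PointedCone.hull ℝ A).smul_mem hr hx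

theorem pos_convS {A : Set V} (hA : A ⊆ Metric.sphere 0 1) : pos (convS A) = pos A := by
  have h1 : PointedCone.hull ℝ (convS A) = PointedCone.hull ℝ A := by
    refine le_antisymm (Submodule.span_le.2 fun x hx => hx.2) (Submodule.span_mono fun x hx => ?_)
    exact ⟨hA hx, Submodule.subset_span hx⟩
  unfold pos
  rw [h1]

variable {ι : Type*} [Fintype ι] {X : ι → V} {e : V}

/-- This is the extremality of the ray through `X i`. Collecting all multiples of `X i` on one side
leaves a nonnegative combination of the other points equal to a multiple of `X i`. A positive
multiple would put `X i` in their hull; for a nonpositive one, pairing with `e` forces all the other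
coefficients to vanish. -/
theorem eq_smul_of_add_eq_smul (he : ∀ i, 0 < inner ℝ (X i) e) {i : ι}
    (hi : X i ∉ PointedCone.hull ℝ (X '' {i}ᶜ)) {p q : V} (hp : p ∈ pos (Set.range X))
    (hq : q ∈ pos (Set.range X)) {r : ℝ} (h : p + q = r • X i) : ∃ s : ℝ, 0 ≤ s ∧ p = s • X i := by
  classical
  obtain ⟨c, hc, rfl⟩ := mem_hull_range.1 hp
  obtain ⟨b, hb, rfl⟩ := mem_hull_range.1 hq
  have hsplit : ∀ a : ι → ℝ, ∑ j, a j • X j = a i • X i + ∑ j ∈ Finset.univ.erase i, a j • X j :=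
    fun a => (Finset.add_sum_erase _ _ (Finset.mem_univ i)).symm
  have h1 : ∑ j ∈ Finset.univ.erase i, (c j + b j) • X j = (r - c i - b i) • X i := by
    rw [hsplit c, hsplit b] at h
    simp only [add_smul, Finset.sum_add_distrib, sub_smul, ← h]
    abel
  refine ⟨c i, hc i, ?_⟩
  rw [hsplit c, add_eq_left]
  rcases le_or_gt (r - c i - b i) 0 with hle | hgt
  · have h2 : ∑ j ∈ Finset.univ.erase i, (c j + b j) * inner ℝ (X j) e
        = (r - c i - b i) * inner ℝ (X i) e := by
      rw [← real_inner_smul_left, ← h1, sum_inner]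
      simp only [real_inner_smul_left]
    have h3 : ∀ j ∈ Finset.univ.erase i, 0 ≤ (c j + b j) * inner ℝ (X j) e :=
      fun j _ => mul_nonneg (add_nonneg (hc j) (hb j)) (he j).le
    have h4 : ∑ j ∈ Finset.univ.erase i, (c j + b j) * inner ℝ (X j) e = 0 :=
      le_antisymm (h2 ▸ mul_nonpos_of_nonpos_of_nonneg hle (he i).le) (Finset.sum_nonneg h3)
    refine Finset.sum_eq_zero fun j hj => ?_
    have h5 := (Finset.sum_eq_zero_iff_of_nonneg h3).1 h4 j hj
    have h6 : c j + b j = 0 := (mul_eq_zero.1 h5).resolve_right (he j).ne'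
    have := hc j
    have := hb j
    rw [show c j = 0 by linarith, zero_smul]
  · refine (hi (mem_hull_image.2 ⟨fun j => if j = i then 0 else
      (r - c i - b i)⁻¹ * (c j + b j), fun j => ?_, fun j hj => ?_, ?_⟩)).elim
    · beta_reduce
      split_ifs
      · exact le_rfl
      · exact mul_nonneg (inv_nonneg.2 hgt.le) (add_nonneg (hc j) (hb j))
    · have : j = i := by simpa using hj
      simp [this]
    · have h7 := congrArg ((r - c i - b i)⁻¹ • ·) h1
      simp only [smul_smul, inv_mul_cancel₀ hgt.ne', one_smul, Finset.smul_sum] at h7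
      conv_rhs => rw [← h7]
      beta_reduce
      rw [← Finset.add_sum_erase _ _ (Finset.mem_univ i), if_pos rfl, zero_smul, zero_add]
      refine Finset.sum_congr rfl fun j hj => ?_
      rw [if_neg (Finset.ne_of_mem_erase hj)]

theorem isExtreme_mem_of_smul_add {A : Set V} {G : Set V} (hG : IsExtreme ℝ (pos A) G) {p q : V}
    (hp : p ∈ pos A) (hq : q ∈ pos A) {c : ℝ} (hc : 0 < c) (h : c • p + q ∈ G) : p ∈ G := by
  -- The weight of `p` must be at most `c`, to leave `(c - δ) • p` in the cone, and less than `1`,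
  -- to be a proper convex weight.
  set δ := min c (1 / 2) with hδ
  have h0 : 0 < δ := lt_min hc (by norm_num)
  have h1 : δ < 1 := (min_le_right _ _).trans_lt (by norm_num)
  have h2 : δ ≤ c := min_le_left _ _
  refine hG.left_mem_of_mem_openSegment hp (y := (1 - δ)⁻¹ • ((c - δ) • p + q)) ?_ h
    ⟨δ, 1 - δ, h0, by linarith, by ring, ?_⟩
  · exact smul_mem_pos ((PointedCone.hull ℝ A).add_mem (smul_mem_pos hp (by linarith)) hq)
      (inv_nonneg.2 (by linarith))
  · rw [smul_smul, mul_inv_cancel₀ (by linarith), one_smul, ← add_assoc, ← add_smul]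
    congr 2
    ring

/-- An extreme set contains every generator that occurs with positive coefficient in one of its
points. A one-dimensional one therefore contains some `X i`, and no other generator because the
points are distinct unit vectors on one side of `e`; hence `X i` is not in the hull of the others.
The converse is `eq_smul_of_add_eq_smul`. -/
theorem faces_zero_convS_range (hX : ∀ i, ‖X i‖ = 1) (hinj : Function.Injective X)
    (he : ∀ i, 0 < inner ℝ (X i) e) :
    faces 0 (convS (Set.range X)) =
      (fun i => ({X i} : Set V)) '' {i | X i ∉ PointedCone.hull ℝ (X '' {i}ᶜ)} := by
  classical
  have hX0 : ∀ i, X i ≠ 0 := fun i h => by simpa [h] using hX i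
  have hsph : Set.range X ⊆ Metric.sphere 0 1 := by
    rintro _ ⟨i, rfl⟩; simpa using hX i
  have hXpos : ∀ i, X i ∈ pos (Set.range X) := fun i => Submodule.subset_span ⟨i, rfl⟩
  have hpart : ∀ (c : ι → ℝ), (∀ j, 0 ≤ c j) → ∀ i, ∑ j ∈ Finset.univ.erase i, c j • X j ∈
      pos (Set.range X) := fun c hc i =>
    (PointedCone.hull ℝ (Set.range X)).sum_mem fun j _ => smul_mem_pos (hXpos j) (hc j)
  ext F
  simp only [faces, pos_convS hsph, zero_add, Set.mem_ofPred_eq, Set.mem_image]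
  constructor
  · rintro ⟨G, hG, -, hrank, rfl⟩
    obtain ⟨x, hxG, hx0⟩ : ∃ x ∈ G, x ≠ 0 := by
      by_contra! h
      have : Submodule.span ℝ G = ⊥ := Submodule.span_eq_bot.2 h
      rw [this, finrank_bot] at hrank
      exact zero_ne_one hrank
    have hget : ∀ c : ι → ℝ, (∀ j, 0 ≤ c j) → ∑ j, c j • X j ∈ G → ∀ i, 0 < c i → X i ∈ G := by
      intro c hc h i hi
      rw [← Finset.add_sum_erase _ _ (Finset.mem_univ i)] at h
      exact isExtreme_mem_of_smul_add hG (hXpos i) (hpart c hc i) hi h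
    obtain ⟨c, hc, hcx⟩ := mem_hull_range.1 (hG.subset hxG)
    obtain ⟨i, hi⟩ : ∃ i, 0 < c i := by
      by_contra! h
      apply hx0
      rw [← hcx]
      exact Finset.sum_eq_zero fun j _ => by rw [le_antisymm (h j) (hc j), zero_smul]
    have hiG : X i ∈ G := hget c hc (by rwa [hcx]) i hi
    -- `G` spans the line of `X i`, and pairing with `e` excludes the antipode.
    have hGi : G ∩ Metric.sphere 0 1 = {X i} := by
      ext z
      simp only [Set.mem_inter_iff, mem_sphere_iff_norm, sub_zero, Set.mem_singleton_iff]
      constructor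
      · rintro ⟨hz, hz1⟩
        have h1 := (finrank_eq_one_iff_of_nonzero'
          (⟨X i, Submodule.subset_span hiG⟩ : Submodule.span ℝ G)
          (by simpa [Subtype.ext_iff] using hX0 i)).1 hrank ⟨z, Submodule.subset_span hz⟩
        obtain ⟨a, ha⟩ := h1
        have ha' : a • X i = z := congrArg Subtype.val ha
        obtain ⟨b, hb, hbz⟩ := mem_hull_range.1 (hG.subset hz)
        have h2 : 0 ≤ inner ℝ z e := by
          rw [← hbz, sum_inner]
          exact Finset.sum_nonneg fun j _ => by
            rw [real_inner_smul_left]; exact mul_nonneg (hb j) (he j).le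
        rw [← ha', real_inner_smul_left] at h2
        have h3 : 0 ≤ a := nonneg_of_mul_nonneg_left h2 (he i)
        rw [← ha', norm_smul, hX i, mul_one, Real.norm_eq_abs, abs_of_nonneg h3] at hz1
        rw [← ha', hz1, one_smul]
      · rintro rfl
        exact ⟨hiG, hX i⟩
    refine ⟨i, fun hmem => ?_, hGi.symm⟩
    obtain ⟨b, hb, hbi, hbs⟩ := mem_hull_image.1 hmem
    obtain ⟨j, hj⟩ : ∃ j, 0 < b j := by
      by_contra! h
      apply hX0 i
      rw [← hbs]
      exact Finset.sum_eq_zero fun j _ => by rw [le_antisymm (h j) (hb j), zero_smul]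
    have hjG : X j ∈ G := hget b hb (by rwa [hbs]) j hj
    have : X j ∈ G ∩ Metric.sphere 0 1 := ⟨hjG, by simpa using hX j⟩
    rw [hGi] at this
    have hji := hinj this
    rw [hji, hbi i (by simp)] at hj
    exact lt_irrefl _ hj
  · rintro ⟨i, hi, rfl⟩
    refine ⟨{x | ∃ s : ℝ, 0 ≤ s ∧ x = s • X i}, ⟨?_, ?_⟩, ?_, ?_, ?_⟩
    · rintro _ ⟨s, hs, rfl⟩
      exact smul_mem_pos (hXpos i) hs
    · rintro x hx y hy _ ⟨r, -, rfl⟩ ⟨a, b, ha, hb, -, hab⟩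
      obtain ⟨s, hs, h⟩ := eq_smul_of_add_eq_smul he hi (smul_mem_pos hx ha.le)
        (smul_mem_pos hy hb.le) hab
      refine ⟨a⁻¹ * s, by positivity, ?_⟩
      rw [mul_smul, ← h, smul_smul, inv_mul_cancel₀ ha.ne', one_smul]
    · rintro _ ⟨s, hs, rfl⟩ _ ⟨r, hr, rfl⟩ a b ha hb -
      exact ⟨a * s + b * r, by positivity, by simp only [add_smul, mul_smul]⟩
    · have : Submodule.span ℝ {x | ∃ s : ℝ, 0 ≤ s ∧ x = s • X i} = Submodule.span ℝ {X i} := by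
        refine le_antisymm (Submodule.span_le.2 ?_) (Submodule.span_mono ?_)
        · rintro _ ⟨s, hs, rfl⟩
          exact Submodule.smul_mem _ _ (Submodule.mem_span_singleton_self _)
        · rintro _ rfl
          exact ⟨1, zero_le_one, (one_smul _ _).symm⟩
      rw [this, finrank_span_singleton (hX0 i)]
    · ext z
      simp only [Set.mem_inter_iff, mem_sphere_iff_norm, sub_zero, Set.mem_singleton_iff,
        Set.mem_ofPred_eq]
      constructor
      · rintro rfl
        exact ⟨⟨1, zero_le_one, (one_smul _ _).symm⟩, hX i⟩
      · rintro ⟨⟨s, hs, rfl⟩, h⟩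
        rw [norm_smul, hX i, mul_one, Real.norm_eq_abs, abs_of_nonneg hs] at h
        rw [h, one_smul]

theorem faceCount_zero_convS_range (hX : ∀ i, ‖X i‖ = 1) (hinj : Function.Injective X)
    (he : ∀ i, 0 < inner ℝ (X i) e) :
    faceCount 0 (convS (Set.range X)) =
      {i | X i ∉ PointedCone.hull ℝ (X '' {i}ᶜ)}.ncard := by
  rw [faceCount, faces_zero_convS_range hX hinj he, Set.ncard_image_of_injective]
  intro i j h
  exact hinj (Set.singleton_injective h)

end Faces

end SphPoly

namespace SphPoly

/-! ### Measurability of hulls and spans; general position almost surely. -/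

/-- The coefficient space is exhausted by countably many compact boxes, and projection along a
compact factor is a closed map. -/
theorem measurableSet_exists_of_isClosed {ι α : Type*} [Fintype ι] [TopologicalSpace α]
    [MeasurableSpace α] [OpensMeasurableSpace α] {T : Set ((ι → ℝ) × α)} (hT : IsClosed T) :
    MeasurableSet {a | ∃ c, (c, a) ∈ T} := by
  have h : {a | ∃ c, (c, a) ∈ T} = ⋃ m : ℕ, Prod.snd ''
      ((Prod.map (Subtype.val : Set.Icc (fun _ : ι => -(m : ℝ)) (fun _ => (m : ℝ)) → (ι → ℝ))
        (id : α → α)) ⁻¹' T) := by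
    ext a
    simp only [Set.mem_ofPred_eq, Set.mem_iUnion, Set.mem_image, Set.mem_preimage, Prod.exists,
      Prod.map_apply, id, exists_eq_right, Subtype.exists, exists_prop]
    constructor
    · rintro ⟨c, hc⟩
      obtain ⟨m, hm⟩ := exists_nat_ge (∑ i, |c i|)
      refine ⟨m, c, ?_, hc⟩
      have : ∀ i, |c i| ≤ m := fun i =>
        (Finset.single_le_sum (f := fun i => |c i|) (fun _ _ => abs_nonneg _)
          (Finset.mem_univ i)).trans hm
      exact ⟨fun i => (abs_le.1 (this i)).1, fun i => (abs_le.1 (this i)).2⟩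
    · rintro ⟨m, c, -, hc⟩
      exact ⟨c, hc⟩
  rw [h]
  refine MeasurableSet.iUnion fun m => IsClosed.measurableSet ?_
  have : CompactSpace (Set.Icc (fun _ : ι => -(m : ℝ)) (fun _ => (m : ℝ))) :=
    isCompact_iff_compactSpace.1 isCompact_Icc
  exact isClosedMap_snd_of_compactSpace _
    (hT.preimage (continuous_subtype_val.prodMap continuous_id))

section Measurability

variable {ι V : Type*} [Fintype ι] [NormedAddCommGroup V] [NormedSpace ℝ V]
  [FiniteDimensional ℝ V] [MeasurableSpace V] [BorelSpace V]

theorem measurableSet_mem_hull :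
    MeasurableSet {p : (ι → V) × V | p.2 ∈ PointedCone.hull ℝ (Set.range p.1)} := by
  have : ProperSpace V := FiniteDimensional.proper_real V
  have h := measurableSet_exists_of_isClosed (ι := ι) (α := (ι → V) × V)
    (T := {q | (∀ i, 0 ≤ q.1 i) ∧ ∑ i, q.1 i • q.2.1 i = q.2.2}) (by
      have h1 : IsClosed {q : (ι → ℝ) × (ι → V) × V | ∀ i, 0 ≤ q.1 i} := by
        simp only [Set.ofPred_forall]
        exact isClosed_iInter fun i => isClosed_le continuous_const (by fun_prop)
      exact h1.inter (isClosed_eq (by fun_prop) (by fun_prop)))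
  convert! h using 1
  ext p
  exact mem_hull_range

theorem measurableSet_mem_span (S : Finset ι) :
    MeasurableSet {p : (ι → V) × V | p.2 ∈ Submodule.span ℝ (p.1 '' S)} := by
  have : ProperSpace V := FiniteDimensional.proper_real V
  have h := measurableSet_exists_of_isClosed (ι := S) (α := (ι → V) × V)
    (T := {q | ∑ i, q.1 i • q.2.1 i = q.2.2}) (isClosed_eq (by fun_prop) (by fun_prop))
  convert! h using 1
  ext p
  rw [Set.mem_ofPred_eq, Set.image_eq_range, Submodule.mem_span_range_iff_exists_fun]
  rfl

end Measurability

section Generic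

theorem eq_zero_of_notMem_span {ι V : Type*} [Fintype ι] [AddCommGroup V] [Module ℝ V]
    {x : ι → V} {k : ℕ}
    (h : ∀ (i : ι) (S : Finset ι), i ∉ S → S.card < k → x i ∉ Submodule.span ℝ (x '' S))
    (c : ι → ℝ) (S : Finset ι) (hcS : ∀ i ∉ S, c i = 0) (hS : S.card ≤ k)
    (h0 : ∑ i, c i • x i = 0) : c = 0 := by
  classical
  by_contra hne
  obtain ⟨i, hi⟩ := Function.ne_iff.1 hne
  have hiS : i ∈ S := by
    by_contra h; exact hi (hcS i h)
  refine h i (S.erase i) (Finset.notMem_erase i S)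
    ((Finset.card_erase_lt_of_mem hiS).trans_le hS) ?_
  have h1 : c i • x i = -∑ j ∈ S.erase i, c j • x j := by
    rw [← Finset.sum_subset (Finset.subset_univ S) (fun j _ hj => by rw [hcS j hj, zero_smul]),
      ← Finset.add_sum_erase _ _ hiS] at h0
    exact eq_neg_of_add_eq_zero_left h0
  have h2 : x i = (c i)⁻¹ • (c i • x i) := by
    rw [smul_smul, inv_mul_cancel₀ hi, one_smul]
  rw [h2, h1]
  refine Submodule.smul_mem _ _ (Submodule.neg_mem _ (Submodule.sum_mem _ fun j hj => ?_))
  exact Submodule.smul_mem _ _ (Submodule.subset_span ⟨j, hj, rfl⟩)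

theorem finrank_span_image_lt {ι V : Type*} [AddCommGroup V] [Module ℝ V]
    {x : ι → V} {S : Finset ι} (hS : S.card < Module.finrank ℝ V) :
    Submodule.span ℝ (x '' S) ≠ ⊤ := by
  classical
  intro h
  have h1 := finrank_span_finset_le_card (R := ℝ) (S.image x)
  rw [Finset.coe_image, Set.finrank, h, finrank_top] at h1
  have := Finset.card_image_le (s := S) (f := x)
  omega

variable {Z V : Type*} [MeasurableSpace Z] [NormedAddCommGroup V] [NormedSpace ℝ V]
  [FiniteDimensional ℝ V] [MeasurableSpace V] [BorelSpace V]

theorem piFinSuccAbove_symm_succAbove {m : ℕ} (i : Fin (m + 1)) (z : Z) (y : Fin m → Z)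
    (k : Fin m) :
    (MeasurableEquiv.piFinSuccAbove (fun _ => Z) i).symm (z, y) (i.succAbove k) = y k :=
  Fin.insertNth_apply_succAbove (α := fun _ => Z) i z y k

theorem piFinSuccAbove_symm_self {m : ℕ} (i : Fin (m + 1)) (z : Z) (y : Fin m → Z) :
    (MeasurableEquiv.piFinSuccAbove (fun _ => Z) i).symm (z, y) i = z :=
  Fin.insertNth_apply_same (α := fun _ => Z) i z y

/-- Fubini: once all points except the `i`-th are fixed, the span is a fixed proper subspace, which
is null for the law of the remaining point. -/
theorem ae_pi_notMem_span {n : ℕ} {ν : Measure Z} [SigmaFinite ν] {g : Z → V} (hg : Measurable g)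
    (hν : ∀ S : Submodule ℝ V, S ≠ ⊤ → ν (g ⁻¹' S) = 0) :
    ∀ᵐ x ∂(Measure.pi fun _ : Fin n => ν), ∀ (i : Fin n) (S : Finset (Fin n)), i ∉ S →
      S.card < Module.finrank ℝ V → g (x i) ∉ Submodule.span ℝ ((fun j => g (x j)) '' S) := by
  rw [ae_all_iff]; intro i
  rw [ae_all_iff]; intro S
  rw [ae_all_iff]; intro hi
  rw [ae_all_iff]; intro hS
  obtain _ | m := n
  · exact i.elim0
  have hmeas : MeasurableSet {x : Fin (m + 1) → Z |
      g (x i) ∈ Submodule.span ℝ ((fun j => g (x j)) '' S)} := by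
    have := measurableSet_mem_span (V := V) S
    have hf : Measurable fun x : Fin (m + 1) → Z => ((fun j => g (x j)), g (x i)) := by fun_prop
    exact hf this
  have hmp := (measurePreserving_piFinSuccAbove (fun _ : Fin (m + 1) => ν) i).symm
  rw [ae_iff]
  simp only [not_not]
  rw [← hmp.measure_preimage hmeas.nullMeasurableSet, Measure.prod_apply_symm (hmp.measurable hmeas)]
  refine (lintegral_congr fun y => ?_).trans lintegral_zero
  set S' : Finset (Fin m) := Finset.univ.filter fun k => i.succAbove k ∈ S with hS'
  have himg : ∀ z : Z, (fun j => g ((MeasurableEquiv.piFinSuccAbove (fun _ => Z) i).symm (z, y) j))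
      '' S = (fun k => g (y k)) '' S' := by
    intro z
    ext v
    constructor
    · rintro ⟨j, hj, rfl⟩
      obtain ⟨k, rfl⟩ := Fin.exists_succAbove_eq (x := j) (y := i) fun h => hi (h ▸ hj)
      exact ⟨k, by simpa [hS'] using hj, by simp only [piFinSuccAbove_symm_succAbove]⟩
    · rintro ⟨k, hk, rfl⟩
      exact ⟨i.succAbove k, by simpa [hS'] using hk, by simp only [piFinSuccAbove_symm_succAbove]⟩
  have hcard : S'.card < Module.finrank ℝ V := by
    refine lt_of_le_of_lt ?_ hS
    refine Finset.card_le_card_of_injOn i.succAbove (fun k hk => ?_)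
      i.succAbove_right_injective.injOn
    simpa [hS'] using hk
  refine measure_mono_null ?_ (hν (Submodule.span ℝ ((fun k => g (y k)) '' S'))
    (finrank_span_image_lt hcard))
  intro z hz
  simp only [Set.mem_preimage, Set.mem_ofPred_eq, himg z, piFinSuccAbove_symm_self] at hz
  exact hz

end Generic

end SphPoly

namespace SphPoly

/-! ### Central projection of the half-sphere to the half-cylinder. -/

section Cyl

variable (F : Type*) [NormedAddCommGroup F] [InnerProductSpace ℝ F] [FiniteDimensional ℝ F]
  [MeasurableSpace F] [BorelSpace F]

/-- The distribution of the heights. -/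
noncomputable def heights (d : ℕ) : Measure ℝ :=
  (volume.restrict (Set.Ioi 0)).withDensity fun t => ENNReal.ofReal (kern d t)

/-- The upper half of the sphere of `F × ℝ`, projected centrally to the cylinder over the unit
sphere of `F`. -/
noncomputable def cyl : Measure (F × ℝ) :=
  (sphMeasure F).prod (heights (Module.finrank ℝ F))

instance (d : ℕ) : SFinite (heights d) := by
  unfold heights; infer_instance

instance : SFinite (cyl F) := by
  unfold cyl; infer_instance

theorem lintegral_heights {d : ℕ} {f : ℝ → ℝ≥0∞} (hf : Measurable f) :
    ∫⁻ t, f t ∂heights d = ∫⁻ t in Set.Ioi 0, ENNReal.ofReal (kern d t) * f t := by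
  rw [heights, lintegral_withDensity_eq_lintegral_mul _ (by fun_prop) hf]
  rfl

theorem lintegral_cyl {f : F × ℝ → ℝ≥0∞} (hf : Measurable f) :
    ∫⁻ p, f p ∂cyl F = ∫⁻ u, (∫⁻ t in Set.Ioi 0,
      ENNReal.ofReal (kern (Module.finrank ℝ F) t) * f (u, t)) ∂sphMeasure F := by
  rw [cyl, lintegral_prod _ hf.aemeasurable]
  exact lintegral_congr fun u => lintegral_heights (by fun_prop)

variable {F}
variable {E' : Type*} [NormedAddCommGroup E'] [InnerProductSpace ℝ E']
  [FiniteDimensional ℝ E'] [MeasurableSpace E'] [BorelSpace E']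

/-- Central projection from the cylinder to the unit sphere. -/
noncomputable def lift (J : WithLp 2 (F × ℝ) ≃ₗᵢ[ℝ] E') (p : F × ℝ) : E' :=
  ‖J (WithLp.toLp 2 p)‖⁻¹ • J (WithLp.toLp 2 p)

theorem measurable_lift (J : WithLp 2 (F × ℝ) ≃ₗᵢ[ℝ] E') : Measurable (lift J) := by
  have hJm : Measurable fun p : F × ℝ => J (WithLp.toLp 2 p) :=
    J.continuous.measurable.comp (WithLp.measurable_toLp 2 (F × ℝ))
  unfold lift
  fun_prop

theorem inner_lift_pole (J : WithLp 2 (F × ℝ) ≃ₗᵢ[ℝ] E') (p : F × ℝ) :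
    inner ℝ (J (WithLp.toLp 2 p)) (J (WithLp.toLp 2 (0, 1))) = p.2 := by
  rw [J.inner_map_map]
  simp [WithLp.prod_inner_apply]

theorem map_lift_cyl [Nontrivial F] (J : WithLp 2 (F × ℝ) ≃ₗᵢ[ℝ] E') :
    (cyl F).map (lift J) =
      (sphMeasure E').restrict (halfSphere (J (WithLp.toLp 2 (0, 1)))) := by
  set e := J (WithLp.toLp 2 (0, 1)) with he
  have hJm : Measurable fun p : F × ℝ => J (WithLp.toLp 2 p) :=
    J.continuous.measurable.comp (WithLp.measurable_toLp 2 (F × ℝ))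
  ext s hs
  rw [Measure.map_apply (measurable_lift J) hs, Measure.restrict_apply hs]
  -- The cone over `s` in the open upper half-space. Its indicator is constant on rays, as
  -- `lintegral_cylinder` requires, and the equator lost by the strict inequality is null.
  set A : Set E' := {x | ‖x‖⁻¹ • x ∈ s ∧ 0 < inner ℝ x e} with hA
  have hAm : MeasurableSet A := by
    have h1 : Measurable fun x : E' => ‖x‖⁻¹ • x := by fun_prop
    have h2 : Measurable fun x : E' => inner ℝ x e := by fun_prop
    exact (h1 hs).inter (measurableSet_lt measurable_const h2)
  have hE : Nontrivial E' := ⟨e, 0, fun h => by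
    have : ‖e‖ = 1 := by rw [he, J.norm_map]; simp
    rw [h, norm_zero] at this; exact zero_ne_one this⟩
  have h0 : sphMeasure E' {x | inner ℝ x e = 0} = 0 := by
    have h1 := sphMeasure_submodule (V := E') (Submodule.span ℝ {e})ᗮ (by
      intro h
      have h2 : e ∈ (Submodule.span ℝ {e})ᗮ := by rw [h]; trivial
      have h3 := (Submodule.mem_orthogonal_singleton_iff_inner_left.1 h2)
      have : e = 0 := inner_self_eq_zero.1 h3
      rw [he, map_eq_zero_iff J J.injective] at this
      have h4 := congrArg (fun q : WithLp 2 (F × ℝ) => q.snd) this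
      simp at h4)
    refine measure_mono_null (fun x hx => ?_) h1
    exact Submodule.mem_orthogonal_singleton_iff_inner_left.2 hx
  have h1 : sphMeasure E' (s ∩ halfSphere e) = ∫⁻ x, A.indicator 1 x ∂sphMeasure E' := by
    rw [lintegral_indicator_one hAm]
    apply measure_congr
    have h0' : ∀ᵐ x ∂sphMeasure E', inner ℝ x e ≠ 0 := by
      rw [ae_iff]; simpa using h0
    filter_upwards [ae_sphMeasure_norm (V := E'), h0'] with x hx hx0
    apply propext
    change (x ∈ s ∧ x ∈ Metric.sphere 0 1 ∧ 0 ≤ inner ℝ x e) ↔ (‖x‖⁻¹ • x ∈ s ∧ 0 < inner ℝ x e)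
    rw [hx, inv_one, one_smul]
    simp only [mem_sphere_iff_norm, sub_zero, hx, true_and]
    exact ⟨fun h => ⟨h.1, lt_of_le_of_ne h.2 hx0.symm⟩, fun h => ⟨h.1, h.2.le⟩⟩
  have hhom : ∀ r : ℝ, 0 < r → ∀ x, A.indicator (1 : E' → ℝ≥0∞) (r • x) = A.indicator 1 x := by
    intro r hr x
    have : r • x ∈ A ↔ x ∈ A := by
      change (‖r • x‖⁻¹ • r • x ∈ s ∧ 0 < inner ℝ (r • x) e) ↔ (‖x‖⁻¹ • x ∈ s ∧ 0 < inner ℝ x e)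
      rw [norm_smul, Real.norm_eq_abs, abs_of_pos hr, smul_smul, mul_inv, mul_comm, ← mul_assoc,
        mul_inv_cancel₀ hr.ne', one_mul, real_inner_smul_left, mul_pos_iff_of_pos_left hr]
    by_cases hx : x ∈ A
    · rw [Set.indicator_of_mem hx, Set.indicator_of_mem (this.2 hx)]; rfl
    · rw [Set.indicator_of_notMem hx, Set.indicator_of_notMem fun h => hx (this.1 h)]
  rw [h1, lintegral_cylinder J (measurable_one.indicator hAm) hhom,
    ← lintegral_indicator_one (measurable_lift J hs), lintegral_cyl]
  swap
  · exact measurable_one.indicator (measurable_lift J hs)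
  refine lintegral_congr fun u => ?_
  rw [← lintegral_indicator measurableSet_Ioi]
  refine lintegral_congr fun t => ?_
  have h5 : J (WithLp.toLp 2 (u, t)) ∈ A ↔ lift J (u, t) ∈ s ∧ 0 < t := by
    change (_ ∧ 0 < inner ℝ (J (WithLp.toLp 2 (u, t))) e) ↔ _
    rw [he, inner_lift_pole]
    rfl
  by_cases ht : 0 < t
  · rw [Set.indicator_of_mem (show t ∈ Set.Ioi 0 from ht)]
    congr 1
    by_cases hl : lift J (u, t) ∈ s
    · rw [Set.indicator_of_mem (show (u, t) ∈ lift J ⁻¹' s from hl),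
        Set.indicator_of_mem (h5.2 ⟨hl, ht⟩)]
      rfl
    · rw [Set.indicator_of_notMem (show (u, t) ∉ lift J ⁻¹' s from hl),
        Set.indicator_of_notMem fun h => hl (h5.1 h).1]
  · rw [Set.indicator_of_notMem (show t ∉ Set.Ioi 0 from ht),
      Set.indicator_of_notMem fun h => ht (h5.1 h).2, mul_zero]

end Cyl

end SphPoly

namespace SphPoly

/-! ### The probability measure on the cylinder, its null sets, and the transfer of hulls. -/

theorem measurableSet_halfSphere {V : Type*} [NormedAddCommGroup V] [InnerProductSpace ℝ V]
    [MeasurableSpace V] [BorelSpace V] (e : V) : MeasurableSet (halfSphere e) := by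
  have h1 : IsClosed (Metric.sphere (0 : V) 1) := Metric.isClosed_sphere
  have h2 : IsClosed {u : V | 0 ≤ inner ℝ u e} := isClosed_le continuous_const (by fun_prop)
  exact (h1.inter h2).measurableSet

theorem sphMeasure_inner_eq_zero {V : Type*} [NormedAddCommGroup V] [InnerProductSpace ℝ V]
    [FiniteDimensional ℝ V] [MeasurableSpace V] [BorelSpace V] {e : V} (he : e ≠ 0) :
    sphMeasure V {x | inner ℝ x e = 0} = 0 := by
  have : Nontrivial V := ⟨e, 0, he⟩
  have h1 := sphMeasure_submodule (V := V) (Submodule.span ℝ {e})ᗮ (by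
    intro h
    have h2 : e ∈ (Submodule.span ℝ {e})ᗮ := by rw [h]; trivial
    exact he (inner_self_eq_zero.1 (Submodule.mem_orthogonal_singleton_iff_inner_left.1 h2)))
  exact measure_mono_null (fun x hx => Submodule.mem_orthogonal_singleton_iff_inner_left.2 hx) h1

/-- The half-sphere and its antipode have equal measure, cover the sphere, and overlap in a null
set. -/
theorem sphMeasure_halfSphere {V : Type*} [NormedAddCommGroup V] [InnerProductSpace ℝ V]
    [FiniteDimensional ℝ V] [MeasurableSpace V] [BorelSpace V] {e : V} (he : e ≠ 0) :
    sphMeasure V (halfSphere e) = ENNReal.ofReal (omega (Module.finrank ℝ V) / 2) := by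
  have : Nontrivial V := ⟨e, 0, he⟩
  have h0 := sphMeasure_inner_eq_zero he
  have h1 : sphMeasure V (halfSphere (-e)) = sphMeasure V (halfSphere e) := by
    conv_lhs => rw [← map_sphMeasure (LinearIsometryEquiv.neg ℝ (E := V))]
    rw [Measure.map_apply (LinearIsometryEquiv.continuous _).measurable
      (measurableSet_halfSphere _)]
    congr 1
    ext x
    simp [halfSphere]
  have h2 : sphMeasure V (halfSphere e ∪ halfSphere (-e)) = sphMeasure V Set.univ := by
    apply measure_congr
    filter_upwards [ae_sphMeasure_norm (V := V)] with x hx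
    apply propext
    simp only [halfSphere]
    change ((x ∈ Metric.sphere 0 1 ∧ 0 ≤ inner ℝ x e) ∨ (x ∈ Metric.sphere 0 1 ∧
      0 ≤ inner ℝ x (-e))) ↔ True
    simp only [mem_sphere_iff_norm, sub_zero, hx, true_and, inner_neg_right, iff_true]
    rcases le_total 0 (inner ℝ x e) with h | h
    · exact Or.inl h
    · exact Or.inr (by linarith)
  have h3 : sphMeasure V (halfSphere e ∩ halfSphere (-e)) = 0 := by
    refine measure_mono_null (fun x hx => ?_) h0
    have h4 := hx.1.2
    have h5 := hx.2.2
    rw [inner_neg_right] at h5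
    exact le_antisymm (by linarith) h4
  have h6 := measure_union_add_inter (μ := sphMeasure V) (halfSphere e)
    (measurableSet_halfSphere (-e))
  rw [h3, add_zero, h2, h1, sphMeasure_univ, ← two_mul] at h6
  have h7 : ENNReal.ofReal (omega (Module.finrank ℝ V)) =
      2 * ENNReal.ofReal (omega (Module.finrank ℝ V) / 2) := by
    rw [← ENNReal.ofReal_ofNat 2, ← ENNReal.ofReal_mul (by norm_num)]
    congr 1
    ring
  rw [h7] at h6
  exact ((ENNReal.mul_right_inj (by norm_num) (by norm_num)).1 h6).symm

section Cyl

variable {F : Type*} [NormedAddCommGroup F] [InnerProductSpace ℝ F] [FiniteDimensional ℝ F]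
  [MeasurableSpace F] [BorelSpace F]

theorem norm_pole {E' : Type*} [NormedAddCommGroup E'] [InnerProductSpace ℝ E']
    (J : WithLp 2 (F × ℝ) ≃ₗᵢ[ℝ] E') : ‖J (WithLp.toLp 2 (0, 1))‖ = 1 := by
  rw [J.norm_map]; simp

theorem finrank_withLp_prod_real :
    Module.finrank ℝ (WithLp 2 (F × ℝ)) = Module.finrank ℝ F + 1 := by
  rw [(WithLp.linearEquiv 2 ℝ (F × ℝ)).finrank_eq]
  simp

theorem cyl_univ [Nontrivial F] :
    cyl F Set.univ = ENNReal.ofReal (omega (Module.finrank ℝ F + 1) / 2) := by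
  have h := map_lift_cyl (LinearIsometryEquiv.refl ℝ (WithLp 2 (F × ℝ)))
  have h1 := congrArg (fun m => m Set.univ) h
  simp only [Measure.map_apply (measurable_lift _) MeasurableSet.univ, Set.preimage_univ,
    Measure.restrict_apply_univ] at h1
  rw [h1, sphMeasure_halfSphere, finrank_withLp_prod_real]
  exact norm_ne_zero_iff.1 (by rw [norm_pole]; norm_num)

instance [Nontrivial F] : IsFiniteMeasure (cyl F) :=
  ⟨by rw [cyl_univ]; exact ENNReal.ofReal_lt_top⟩

variable (F) in
/-- The normalisation of the measure on the cylinder. -/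
noncomputable def cylProb : Measure (F × ℝ) :=
  ENNReal.ofReal (2 / omega (Module.finrank ℝ F + 1)) • cyl F

instance [Nontrivial F] : IsProbabilityMeasure (cylProb F) := by
  refine ⟨?_⟩
  have h := omega_pos (Nat.succ_pos (Module.finrank ℝ F))
  rw [cylProb, Measure.smul_apply, cyl_univ, smul_eq_mul, ← ENNReal.ofReal_mul (by positivity),
    ← ENNReal.ofReal_one]
  congr 1
  simp only [Nat.succ_eq_add_one] at h
  field_simp

theorem map_lift_cylProb [Nontrivial F] {E' : Type*} [NormedAddCommGroup E']
    [InnerProductSpace ℝ E'] [FiniteDimensional ℝ E'] [MeasurableSpace E'] [BorelSpace E']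
    (J : WithLp 2 (F × ℝ) ≃ₗᵢ[ℝ] E') :
    (cylProb F).map (lift J) = uniformHalf (J (WithLp.toLp 2 (0, 1))) := by
  rw [cylProb, Measure.map_smul, map_lift_cyl, uniformHalf, ← J.toLinearEquiv.finrank_eq,
    finrank_withLp_prod_real]

theorem ae_cyl_iff_cylProb [Nontrivial F] {p : F × ℝ → Prop} :
    (∀ᵐ z ∂cylProb F, p z) ↔ ∀ᵐ z ∂cyl F, p z := by
  have h := omega_pos (Nat.succ_pos (Module.finrank ℝ F))
  rw [cylProb, Measure.ae_ennreal_smul_measure_iff]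
  rw [ne_eq, ENNReal.ofReal_eq_zero, not_le]
  positivity

theorem ae_cyl [Nontrivial F] : ∀ᵐ z ∂cyl F, ‖z.1‖ = 1 ∧ 0 < z.2 := by
  have h1 : ∀ᵐ z ∂cyl F, ‖z.1‖ = 1 :=
    Measure.quasiMeasurePreserving_fst.ae ae_sphMeasure_norm
  have h2 : ∀ᵐ z ∂cyl F, 0 < z.2 := by
    refine Measure.quasiMeasurePreserving_snd.ae (p := fun t => 0 < t) ?_
    exact (withDensity_absolutelyContinuous _ _).ae_le (ae_restrict_mem measurableSet_Ioi)
  filter_upwards [h1, h2] with z h h' using ⟨h, h'⟩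

/-- Central projection only rescales points, so it maps a subspace into itself and the claim
descends from the sphere. -/
theorem cyl_submodule [Nontrivial F] (S : Submodule ℝ (F × ℝ)) (hS : S ≠ ⊤) : cyl F S = 0 := by
  set J := LinearIsometryEquiv.refl ℝ (WithLp 2 (F × ℝ))
  set L := (WithLp.linearEquiv 2 ℝ (F × ℝ)) with hL
  have hS' : S.comap (L : WithLp 2 (F × ℝ) →ₗ[ℝ] F × ℝ) ≠ ⊤ := by
    intro h
    apply hS
    rw [Submodule.eq_top_iff'] at h ⊢
    intro x
    simpa using h (L.symm x)
  have : Nontrivial (WithLp 2 (F × ℝ)) := by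
    apply Module.nontrivial_of_finrank_pos (R := ℝ)
    rw [finrank_withLp_prod_real]; omega
  have h0 := sphMeasure_submodule _ hS'
  have h1 : (cyl F).map (lift J) (S.comap (L : WithLp 2 (F × ℝ) →ₗ[ℝ] F × ℝ)) = 0 := by
    rw [map_lift_cyl]
    exact measure_mono_null le_rfl (Measure.absolutelyContinuous_of_le Measure.restrict_le_self h0)
  rw [Measure.map_apply (measurable_lift J)
    (Submodule.closed_of_finiteDimensional _).measurableSet] at h1
  refine measure_mono_null (fun z hz => ?_) h1
  change L (lift J z) ∈ S
  rw [lift, map_smul]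
  exact S.smul_mem _ hz

theorem cyl_fst_submodule [Nontrivial F] (S : Submodule ℝ F) (hS : S ≠ ⊤) :
    cyl F (Prod.fst ⁻¹' (S : Set F)) = 0 := by
  have h := cyl_submodule (S.comap (LinearMap.fst ℝ F ℝ)) (by
    intro h
    apply hS
    rw [Submodule.eq_top_iff'] at h ⊢
    intro x
    simpa using h (x, 0))
  exact h

theorem cylProb_submodule [Nontrivial F] (S : Submodule ℝ (F × ℝ)) (hS : S ≠ ⊤) :
    cylProb F S = 0 := by
  rw [cylProb, Measure.smul_apply, cyl_submodule S hS, smul_zero]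

theorem cylProb_fst_submodule [Nontrivial F] (S : Submodule ℝ F) (hS : S ≠ ⊤) :
    cylProb F (Prod.fst ⁻¹' (S : Set F)) = 0 := by
  rw [cylProb, Measure.smul_apply, cyl_fst_submodule S hS, smul_zero]

end Cyl

section Hull

theorem smul_mem_hull_range_smul_iff {ι V : Type*} [AddCommGroup V] [Module ℝ V]
    {a : ι → ℝ} (ha : ∀ i, 0 < a i) {b : ℝ} (hb : 0 < b) {x : ι → V} {v : V} :
    b • v ∈ PointedCone.hull ℝ (Set.range fun i => a i • x i) ↔
      v ∈ PointedCone.hull ℝ (Set.range x) := by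
  have h1 : PointedCone.hull ℝ (Set.range fun i => a i • x i) =
      PointedCone.hull ℝ (Set.range x) := by
    refine le_antisymm (Submodule.span_le.2 ?_) (Submodule.span_le.2 ?_)
    · rintro _ ⟨i, rfl⟩
      exact (PointedCone.hull ℝ (Set.range x)).smul_mem (ha i).le
        (Submodule.subset_span ⟨i, rfl⟩)
    · rintro _ ⟨i, rfl⟩
      have := (PointedCone.hull ℝ (Set.range fun i => a i • x i)).smul_mem
        (inv_nonneg.2 (ha i).le) (x := a i • x i) (Submodule.subset_span ⟨i, rfl⟩)
      rwa [smul_smul, inv_mul_cancel₀ (ha i).ne', one_smul] at this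
  rw [h1]
  constructor
  · intro h
    have := (PointedCone.hull ℝ (Set.range x)).smul_mem (inv_nonneg.2 hb.le) h
    rwa [smul_smul, inv_mul_cancel₀ hb.ne', one_smul] at this
  · exact fun h => (PointedCone.hull ℝ (Set.range x)).smul_mem hb.le h

theorem map_mem_hull_range_iff {ι V W : Type*} [Fintype ι] [AddCommGroup V] [Module ℝ V]
    [AddCommGroup W] [Module ℝ W] (L : V ≃ₗ[ℝ] W) {x : ι → V} {v : V} :
    L v ∈ PointedCone.hull ℝ (Set.range fun i => L (x i)) ↔
      v ∈ PointedCone.hull ℝ (Set.range x) := by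
  rw [mem_hull_range, mem_hull_range]
  refine exists_congr fun c => and_congr_right fun _ => ?_
  simp only [← map_smul, ← map_sum]
  exact L.injective.eq_iff

/-- Positive hulls are insensitive to positive rescaling of points, so everything about the polytope
can be decided on the cylinder. -/
theorem lift_mem_hull_range_iff {ι F E' : Type*} [Fintype ι] [NormedAddCommGroup F]
    [InnerProductSpace ℝ F] [NormedAddCommGroup E'] [InnerProductSpace ℝ E']
    (J : WithLp 2 (F × ℝ) ≃ₗᵢ[ℝ] E') {x : ι → F × ℝ} {z : F × ℝ} (hx : ∀ i, x i ≠ 0)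
    (hz : z ≠ 0) :
    lift J z ∈ PointedCone.hull ℝ (Set.range fun i => lift J (x i)) ↔
      z ∈ PointedCone.hull ℝ (Set.range x) := by
  have h0 : ∀ z : F × ℝ, z ≠ 0 → 0 < ‖J (WithLp.toLp 2 z)‖⁻¹ := by
    intro z hz
    rw [inv_pos, norm_pos_iff, ne_eq, map_eq_zero_iff J J.injective]
    exact fun h => hz (by simpa using congrArg WithLp.ofLp h)
  unfold lift
  rw [smul_mem_hull_range_smul_iff (fun i => h0 _ (hx i)) (h0 _ hz)]
  exact map_mem_hull_range_iff ((WithLp.linearEquiv 2 ℝ (F × ℝ)).symm.trans J.toLinearEquiv)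

end Hull

end SphPoly

namespace SphPoly

/-! ### The measure of a lune. -/

theorem lintegral_id_mul_inv_sqrt_pow {m : ℕ} (hm : 0 < m) :
    (∫⁻ s in Set.Ioi (0 : ℝ), ENNReal.ofReal (s * (√(1 + s ^ 2) ^ (m + 2))⁻¹))
      = ENNReal.ofReal (1 / m) := by
  have hm' : (0 : ℝ) < m := by exact_mod_cast hm
  have hpos : ∀ s : ℝ, 0 < √(1 + s ^ 2) := fun s => by positivity
  have hder : ∀ s ∈ Set.Ici (0 : ℝ), HasDerivAt (fun s : ℝ => -(1 / m) * (√(1 + s ^ 2) ^ m)⁻¹)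
      (s * (√(1 + s ^ 2) ^ (m + 2))⁻¹) s := by
    intro s _
    have h1 : HasDerivAt (fun s : ℝ => 1 + s ^ 2) (2 * s) s := by
      simpa using (hasDerivAt_pow 2 s).const_add 1
    have h2 := ((h1.sqrt (by positivity)).pow m).inv (pow_pos (hpos s) m).ne'
    convert! h2.const_mul (-(1 / (m : ℝ))) using 1
    obtain ⟨k, rfl⟩ : ∃ k, m = k + 1 := ⟨m - 1, by omega⟩
    have := hpos s
    simp only [Nat.add_sub_cancel, Pi.pow_apply]
    field_simp
    ring
  have hnn : ∀ s ∈ Set.Ioi (0 : ℝ), 0 ≤ s * (√(1 + s ^ 2) ^ (m + 2))⁻¹ := by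
    intro s hs
    have : 0 < s := hs
    positivity
  have hlim : Tendsto (fun s : ℝ => -(1 / m) * (√(1 + s ^ 2) ^ m)⁻¹) atTop (𝓝 0) := by
    have h1 : Tendsto (fun s : ℝ => √(1 + s ^ 2)) atTop atTop := by
      refine tendsto_atTop_mono (fun s => ?_) tendsto_id
      exact Real.le_sqrt_of_sq_le (by simp)
    have h2 := ((tendsto_pow_atTop hm.ne').comp h1).inv_tendsto_atTop
    simpa using h2.const_mul (-(1 / (m : ℝ)))
  rw [← ofReal_integral_eq_lintegral_ofReal (integrableOn_Ioi_deriv_of_nonneg' hder hnn hlim)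
    ((ae_restrict_iff' measurableSet_Ioi).2 (.of_forall hnn)),
    integral_Ioi_of_hasDerivAt_of_nonneg' hder hnn hlim]
  simp

theorem lintegral_inv_one_add_sq {r : ℝ} (hr : 0 ≤ r) :
    (∫⁻ x in Set.Ioc 0 r, ENNReal.ofReal ((1 + x ^ 2)⁻¹)) = ENNReal.ofReal (Real.arctan r) := by
  have hc : Continuous fun x : ℝ => (1 + x ^ 2)⁻¹ :=
    Continuous.inv₀ (by fun_prop) fun x => by positivity
  rw [← ofReal_integral_eq_lintegral_ofReal (hc.integrableOn_Ioc)
    (.of_forall fun x => by positivity), ← intervalIntegral.integral_of_le hr,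
    integral_inv_one_add_sq]
  simp

/-- The identity behind this is `(1 + s²)(1 + s²ρ²/(1 + s²)) = 1 + (1 + ρ²) s²`. On the right, `ρ`
enters only through the scale of `s`. -/
theorem kern_mul_kern {m : ℕ} {s ρ : ℝ} (hs : 0 < s) :
    kern m s * (s / √(1 + s ^ 2) * kern (m + 1) (s / √(1 + s ^ 2) * ρ)) =
      s * (√(1 + (√(1 + ρ ^ 2) * s) ^ 2) ^ (m + 2))⁻¹ := by
  unfold kern
  have h1 : 0 < √(1 + s ^ 2) := by positivity
  have h2 : √(1 + (s / √(1 + s ^ 2) * ρ) ^ 2) =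
      √(1 + (√(1 + ρ ^ 2) * s) ^ 2) / √(1 + s ^ 2) := by
    rw [← Real.sqrt_div' _ (by positivity)]
    congr 1
    rw [mul_pow, div_pow, mul_pow, Real.sq_sqrt (by positivity), Real.sq_sqrt (by positivity)]
    field_simp
    ring
  have h3 : 0 < √(1 + (√(1 + ρ ^ 2) * s) ^ 2) := by positivity
  rw [h2, div_pow]
  field_simp
  ring

/-- Rescaling `s` by `√(1 + ρ²)` takes `ρ` out of the integral and leaves the derivative of
`arctan`. -/
theorem lintegral_kern_mul_kern {m : ℕ} (hm : 0 < m) (ρ : ℝ) :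
    (∫⁻ s in Set.Ioi (0 : ℝ), ENNReal.ofReal (kern m s) * ENNReal.ofReal
      (s / √(1 + s ^ 2) * kern (m + 1) (s / √(1 + s ^ 2) * ρ)))
      = ENNReal.ofReal (1 / m) * ENNReal.ofReal ((1 + ρ ^ 2)⁻¹) := by
  have hq : 0 < √(1 + ρ ^ 2) := by positivity
  have h := setLIntegral_Ioi_comp_const_mul hq
    (φ := fun s => ENNReal.ofReal (s * (√(1 + s ^ 2) ^ (m + 2))⁻¹)) (by fun_prop)
  rw [lintegral_id_mul_inv_sqrt_pow hm] at h
  have h2 : (∫⁻ s in Set.Ioi (0 : ℝ), ENNReal.ofReal (kern m s) * ENNReal.ofReal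
      (s / √(1 + s ^ 2) * kern (m + 1) (s / √(1 + s ^ 2) * ρ))) =
      ∫⁻ s in Set.Ioi (0 : ℝ), ENNReal.ofReal (√(1 + ρ ^ 2))⁻¹ * ENNReal.ofReal
        (√(1 + ρ ^ 2) * s * (√(1 + (√(1 + ρ ^ 2) * s) ^ 2) ^ (m + 2))⁻¹) := by
    refine setLIntegral_congr_fun measurableSet_Ioi fun s hs => ?_
    simp only [Set.mem_Ioi] at hs
    rw [← ENNReal.ofReal_mul (kern_pos m s).le, ← ENNReal.ofReal_mul (by positivity),
      kern_mul_kern hs]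
    congr 1
    field_simp
  rw [h2, lintegral_const_mul _ (by fun_prop), h, ← mul_assoc, mul_comm,
    ← ENNReal.ofReal_mul (by positivity)]
  congr 2
  rw [← mul_inv, Real.mul_self_sqrt (by positivity)]

theorem lintegral_kern_le {d : ℕ} {a : ℝ} (ha : 0 < a) (r : ℝ) :
    (∫⁻ t in Set.Ioi 0, ENNReal.ofReal (kern d t) * (if t ≤ r * a then 1 else 0)) =
      ∫⁻ ρ in Set.Ioi 0, ENNReal.ofReal (a * kern d (a * ρ)) * (if ρ ≤ r then 1 else 0) := by
  have hm : Measurable fun t : ℝ => ENNReal.ofReal (kern d t) *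
      (if t ≤ r * a then (1 : ℝ≥0∞) else 0) :=
    (by fun_prop : Measurable fun t : ℝ => ENNReal.ofReal (kern d t)).mul
      (Measurable.ite measurableSet_Iic measurable_const measurable_const)
  have h := setLIntegral_Ioi_comp_const_mul ha hm
  have h1 : ENNReal.ofReal a * ENNReal.ofReal a⁻¹ = 1 := by
    rw [← ENNReal.ofReal_mul ha.le, mul_inv_cancel₀ ha.ne', ENNReal.ofReal_one]
  have h2 := congrArg (ENNReal.ofReal a * ·) h
  simp only [← mul_assoc, h1, one_mul] at h2
  rw [← h2, ← lintegral_const_mul' _ _ ENNReal.ofReal_ne_top]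
  refine lintegral_congr fun ρ => ?_
  rw [ENNReal.ofReal_mul ha.le, mul_assoc]
  congr 3
  rw [mul_comm a ρ, mul_le_mul_iff_of_pos_right ha]

section Wedge

variable {F : Type*} [NormedAddCommGroup F] [InnerProductSpace ℝ F] [FiniteDimensional ℝ F]
  [MeasurableSpace F] [BorelSpace F]

/-- Cylindrical coordinates are used once more, now on the sphere of `F` with pole `w`, where `⟪x,
w⟫ = s / √(1 + s²)`. With the height written as `t = ρ ⟪x, w⟫`, the region becomes `ρ ≤ r`.
Integrating out `s` leaves a multiple of `(1 + ρ²)⁻¹`, and integrating that gives `arctan r`. -/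
theorem cyl_le_inner_aux {m : ℕ} (hm : 0 < m) (hF : Module.finrank ℝ F = m + 1) {w : F}
    (hw : ‖w‖ = 1) {r : ℝ} (hr : 0 ≤ r) :
    cyl F {z | z.2 ≤ inner ℝ (r • w) z.1} =
      ENNReal.ofReal (omega m) * (ENNReal.ofReal (1 / m) * ENNReal.ofReal (Real.arctan r)) := by
  have hms : MeasurableSet {z : F × ℝ | z.2 ≤ inner ℝ (r • w) z.1} :=
    measurableSet_le measurable_snd (by fun_prop)
  let F' := EuclideanSpace ℝ (Fin m)
  have hF' : Module.finrank ℝ F' = m := by simp [F']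
  have : Nontrivial F' := Module.nontrivial_of_finrank_pos (R := ℝ) (by omega)
  have : Nontrivial F := Module.nontrivial_of_finrank_pos (R := ℝ) (by omega)
  obtain ⟨J, hJ⟩ := exists_linearIsometryEquiv_map_eq (V := WithLp 2 (F' × ℝ)) (W := F)
    (v := WithLp.toLp 2 (0, 1)) (w := w) (by rw [finrank_withLp_prod_real, hF', hF]) (by simp) hw
  -- The division by `‖x‖` is trivial on the sphere and makes `f` constant on rays.
  set f : F → ℝ≥0∞ := fun x => ∫⁻ t in Set.Ioi 0, ENNReal.ofReal (kern (m + 1) t) *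
    (if t ≤ r * (inner ℝ x w / ‖x‖) then 1 else 0) with hf
  have hfm : Measurable f := by
    apply Measurable.lintegral_prod_right' (f := fun p : F × ℝ => ENNReal.ofReal (kern (m + 1) p.2) *
      (if p.2 ≤ r * (inner ℝ p.1 w / ‖p.1‖) then 1 else 0))
    exact (by fun_prop : Measurable fun p : F × ℝ => ENNReal.ofReal (kern (m + 1) p.2)).mul
      (Measurable.ite (measurableSet_le measurable_snd (by fun_prop)) measurable_const
        measurable_const)
  have hhom : ∀ c : ℝ, 0 < c → ∀ x, f (c • x) = f x := by
    intro c hc x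
    have : inner ℝ (c • x) w / ‖c • x‖ = inner ℝ x w / ‖x‖ := by
      rw [norm_smul, real_inner_smul_left, Real.norm_eq_abs, abs_of_pos hc,
        mul_div_mul_left _ _ hc.ne']
    simp only [hf, this]
  have h1 : cyl F {z | z.2 ≤ inner ℝ (r • w) z.1} = ∫⁻ x, f x ∂sphMeasure F := by
    rw [← lintegral_indicator_one hms, lintegral_cyl F (measurable_one.indicator hms), hF]
    apply lintegral_congr_ae
    filter_upwards [ae_sphMeasure_norm (V := F)] with u hu
    refine lintegral_congr fun t => ?_
    congr 1
    have : inner ℝ (r • w) u = r * (inner ℝ u w / ‖u‖) := by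
      rw [hu, div_one, real_inner_smul_left, real_inner_comm]
    by_cases h : t ≤ r * (inner ℝ u w / ‖u‖)
    · rw [if_pos h, Set.indicator_of_mem (show (u, t) ∈ {z : F × ℝ | z.2 ≤ inner ℝ (r • w) z.1} by
        change t ≤ inner ℝ (r • w) u; rwa [this])]
      rfl
    · rw [if_neg h, Set.indicator_of_notMem fun h' => h ?_]
      rw [← this]
      exact h'
  have h2 : ∀ᵐ u ∂sphMeasure F', (∫⁻ s : ℝ,
      ENNReal.ofReal (kern (Module.finrank ℝ F') s) * f (J (WithLp.toLp 2 (u, s)))) =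
      ENNReal.ofReal (1 / m) * ENNReal.ofReal (Real.arctan r) := by
    filter_upwards [ae_sphMeasure_norm (V := F')] with u hu
    have h3 : ∀ s : ℝ, inner ℝ (J (WithLp.toLp 2 (u, s))) w / ‖J (WithLp.toLp 2 (u, s))‖ =
        s / √(1 + s ^ 2) := by
      intro s
      rw [← hJ, inner_lift_pole, J.norm_map, WithLp.prod_norm_eq_of_L2]
      simp [hu]
    have h4 : (∫⁻ s : ℝ, ENNReal.ofReal (kern (Module.finrank ℝ F') s) *
        f (J (WithLp.toLp 2 (u, s)))) = ∫⁻ s in Set.Ioi (0 : ℝ),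
        ∫⁻ ρ in Set.Ioi (0 : ℝ), ENNReal.ofReal (kern m s) * ENNReal.ofReal
          (s / √(1 + s ^ 2) * kern (m + 1) (s / √(1 + s ^ 2) * ρ)) * (if ρ ≤ r then 1 else 0) := by
      rw [← lintegral_indicator measurableSet_Ioi]
      refine lintegral_congr fun s => ?_
      simp only [hf, h3, hF']
      by_cases hs : 0 < s
      · rw [Set.indicator_of_mem (show s ∈ Set.Ioi 0 from hs), lintegral_kern_le (by positivity),
          ← lintegral_const_mul' _ _ ENNReal.ofReal_ne_top]
        simp only [mul_assoc]
      · rw [Set.indicator_of_notMem (show s ∉ Set.Ioi 0 from hs)]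
        -- In the lower hemisphere the bound on the height is nonpositive, so no `t > 0` qualifies.
        have : ∫⁻ t in Set.Ioi (0 : ℝ), ENNReal.ofReal (kern (m + 1) t) *
            (if t ≤ r * (s / √(1 + s ^ 2)) then 1 else 0) = ∫⁻ t in Set.Ioi (0 : ℝ), 0 := by
          refine setLIntegral_congr_fun measurableSet_Ioi fun t ht => ?_
          have ht' : 0 < t := ht
          have h5 : r * (s / √(1 + s ^ 2)) ≤ 0 :=
            mul_nonpos_of_nonneg_of_nonpos hr
              (div_nonpos_of_nonpos_of_nonneg (not_lt.1 hs) (Real.sqrt_nonneg _))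
          rw [if_neg (by linarith), mul_zero]
        rw [this]
        simp
    rw [h4, lintegral_lintegral_swap]
    swap
    · refine Measurable.aemeasurable ?_
      exact (by fun_prop : Measurable fun p : ℝ × ℝ => ENNReal.ofReal (kern m p.1) *
        ENNReal.ofReal (p.1 / √(1 + p.1 ^ 2) * kern (m + 1) (p.1 / √(1 + p.1 ^ 2) * p.2))).mul
        (Measurable.ite (measurableSet_le measurable_snd measurable_const) measurable_const
          measurable_const)
    have h6 : ∀ ρ : ℝ, (∫⁻ s in Set.Ioi (0 : ℝ), ENNReal.ofReal (kern m s) * ENNReal.ofReal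
          (s / √(1 + s ^ 2) * kern (m + 1) (s / √(1 + s ^ 2) * ρ)) * (if ρ ≤ r then 1 else 0)) =
        (Set.Iic r).indicator (fun ρ => ENNReal.ofReal (1 / m) *
          ENNReal.ofReal ((1 + ρ ^ 2)⁻¹)) ρ := by
      intro ρ
      by_cases h : ρ ≤ r
      · rw [Set.indicator_of_mem (show ρ ∈ Set.Iic r from h), ← lintegral_kern_mul_kern hm]
        simp [h]
      · rw [Set.indicator_of_notMem (show ρ ∉ Set.Iic r from h)]
        simp [h]
    simp only [h6]
    rw [lintegral_indicator measurableSet_Iic, Measure.restrict_restrict measurableSet_Iic,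
      Set.inter_comm, Set.Ioi_inter_Iic, lintegral_const_mul _ (by fun_prop),
      lintegral_inv_one_add_sq hr]
  rw [h1, lintegral_cylinder J hfm hhom, lintegral_congr_ae h2, lintegral_const, sphMeasure_univ,
    hF', mul_comm]

/-- The part of the half-sphere below the hyperplane `t = ⟪h, u⟫` is a lune. -/
theorem cylProb_le_inner (hF : 2 ≤ Module.finrank ℝ F) (h : F) :
    cylProb F {z | z.2 ≤ inner ℝ h z.1} = ENNReal.ofReal (Real.arctan ‖h‖ / Real.pi) := by
  obtain ⟨m, hm⟩ : ∃ m, Module.finrank ℝ F = m + 1 := ⟨Module.finrank ℝ F - 1, by omega⟩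
  have hm0 : 0 < m := by omega
  have : Nontrivial F := Module.nontrivial_of_finrank_pos (R := ℝ) (by omega)
  obtain ⟨w, hw, hh⟩ : ∃ w : F, ‖w‖ = 1 ∧ h = ‖h‖ • w := by
    by_cases h0 : h = 0
    · obtain ⟨w, hw⟩ := exists_norm_eq F (zero_le_one (α := ℝ))
      exact ⟨w, hw, by simp [h0]⟩
    · exact ⟨‖h‖⁻¹ • h, by simp [norm_smul, h0], by simp [smul_smul, h0]⟩
  have h1 := cyl_le_inner_aux hm0 hm hw (norm_nonneg h)
  rw [← hh] at h1
  have hω := omega_pos hm0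
  have hm' : (0 : ℝ) < m := by exact_mod_cast hm0
  have ha : 0 ≤ Real.arctan ‖h‖ := Real.arctan_nonneg.2 (norm_nonneg h)
  -- The constants combine to `(2 / ω_{m+2}) · ω_m / m = 1 / π`.
  rw [cylProb, Measure.smul_apply, h1, hm, omega_add_two hm0, smul_eq_mul,
    ← ENNReal.ofReal_mul (by positivity), ← ENNReal.ofReal_mul (by positivity),
    ← ENNReal.ofReal_mul (by have := Real.pi_pos; positivity)]
  congr 1
  have := Real.pi_pos
  field_simp

end Wedge

end SphPoly

namespace SphPoly

/-- `ℝ^d`. -/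
abbrev H (d : ℕ) : Type := EuclideanSpace ℝ (Fin d)

/-! ### Hyperplanes through `d` points of the cylinder. -/

section Hyperplane

/-- The vector `h` with `⟪h, u i⟫ = t i` for all `i`, if the `u i` form a basis. -/
noncomputable def normalVec {d : ℕ} (y : Fin d → H d × ℝ) : H d :=
  WithLp.toLp 2 ((Matrix.of fun i j => (y i).1 j)⁻¹.mulVec fun i => (y i).2)

theorem measurable_normalVec {d : ℕ} : Measurable (normalVec (d := d)) := by
  have h1 : Continuous fun y : Fin d → H d × ℝ =>
      (Matrix.of fun i j => (y i).1 j : Matrix (Fin d) (Fin d) ℝ) :=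
    continuous_matrix fun i j => by
      simp only [Matrix.of_apply]
      fun_prop
  have h2 : Measurable fun y : Fin d → H d × ℝ =>
      (Matrix.of fun i j => (y i).1 j : Matrix (Fin d) (Fin d) ℝ).det := h1.matrix_det.measurable
  have h3 := h1.matrix_adjugate
  refine (WithLp.measurable_toLp 2 (Fin d → ℝ)).comp (measurable_pi_iff.2 fun i => ?_)
  simp only [Matrix.mulVec, dotProduct, Matrix.inv_def, Matrix.smul_apply, smul_eq_mul,
    Ring.inverse_eq_inv']
  refine Finset.measurable_sum _ fun j _ => Measurable.mul (h2.inv.mul ?_) (by fun_prop)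
  exact (h3.matrix_elem i j).measurable

theorem isUnit_of_linearIndependent {d : ℕ} {u : Fin d → H d} (hu : LinearIndependent ℝ u) :
    IsUnit (Matrix.of fun i j => u i j : Matrix (Fin d) (Fin d) ℝ) := by
  rw [← Matrix.linearIndependent_rows_iff_isUnit]
  exact hu.map' (WithLp.linearEquiv 2 ℝ (Fin d → ℝ) : H d →ₗ[ℝ] (Fin d → ℝ))
    (LinearEquiv.ker _)

theorem inner_normalVec {d : ℕ} {y : Fin d → H d × ℝ}
    (hy : LinearIndependent ℝ fun i => (y i).1) (i : Fin d) :
    inner ℝ (normalVec y) (y i).1 = (y i).2 := by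
  have hu := (isUnit_of_linearIndependent hy)
  have h : (Matrix.of fun i j => (y i).1 j : Matrix (Fin d) (Fin d) ℝ).mulVec
      ((Matrix.of fun i j => (y i).1 j : Matrix (Fin d) (Fin d) ℝ)⁻¹.mulVec fun i => (y i).2) =
      fun i => (y i).2 := by
    rw [Matrix.mulVec_mulVec, Matrix.mul_nonsing_inv _ ((Matrix.isUnit_iff_isUnit_det _).1 hu),
      Matrix.one_mulVec]
  have h2 := congr_fun h i
  rw [← h2, PiLp.inner_apply]
  simp [Matrix.mulVec, dotProduct, normalVec]

theorem eq_normalVec {d : ℕ} {y : Fin d → H d × ℝ}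
    (hy : LinearIndependent ℝ fun i => (y i).1) {h : H d}
    (hh : ∀ i, inner ℝ h (y i).1 = (y i).2) : h = normalVec y := by
  have hb : Submodule.span ℝ (Set.range fun i => (y i).1) = ⊤ :=
    hy.span_eq_top_of_card_eq_finrank' (by simp)
  have h0 : ∀ v : H d, inner ℝ (h - normalVec y) v = 0 := by
    intro v
    have hv : v ∈ Submodule.span ℝ (Set.range fun i => (y i).1) := by rw [hb]; trivial
    induction hv using Submodule.span_induction with
    | mem x hx =>
      obtain ⟨i, rfl⟩ := hx
      rw [inner_sub_left, hh, inner_normalVec hy, sub_self]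
    | zero => simp
    | add x y _ _ hx hy => rw [inner_add_right, hx, hy, add_zero]
    | smul a x _ hx => rw [inner_smul_right, hx, mul_zero]
  exact sub_eq_zero.1 (inner_self_eq_zero.1 (h0 _))

/-- The points over the simplex spanned by the `y i` and below the hyperplane through them. -/
def below {d : ℕ} (y : Fin d → H d × ℝ) : Set (H d × ℝ) :=
  {z | z.1 ∈ PointedCone.hull ℝ (Set.range fun i => (y i).1) ∧ z.2 < inner ℝ (normalVec y) z.1}

theorem measurableSet_below_prod {d : ℕ} :
    MeasurableSet {p : (Fin d → H d × ℝ) × (H d × ℝ) | p.2 ∈ below p.1} := by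
  have h1 : MeasurableSet {p : (Fin d → H d × ℝ) × (H d × ℝ) |
      p.2.1 ∈ PointedCone.hull ℝ (Set.range fun i => (p.1 i).1)} := by
    have hf : Measurable fun p : (Fin d → H d × ℝ) × (H d × ℝ) =>
      ((fun i => (p.1 i).1), p.2.1) := by fun_prop
    exact hf (measurableSet_mem_hull (ι := Fin d) (V := H d))
  have h2 : MeasurableSet {p : (Fin d → H d × ℝ) × (H d × ℝ) |
      p.2.2 < inner ℝ (normalVec p.1) p.2.1} :=
    measurableSet_lt (by fun_prop)
      ((measurable_normalVec.comp measurable_fst).inner (by fun_prop))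
  exact h1.inter h2

end Hyperplane

/-! ### Meeting every orthant implies positive spanning. -/

section Orthants

/-- The open orthant with sign pattern `s`. -/
def orthant {d : ℕ} (s : Fin d → Bool) : Set (H d) :=
  {u | ∀ j, if s j then 0 < u j else u j < 0}

theorem isOpen_orthant {d : ℕ} (s : Fin d → Bool) : IsOpen (orthant s) := by
  have : orthant s = ⋂ j, {u : H d | if s j then 0 < u j else u j < 0} := by
    ext; simp [orthant]
  rw [this]
  refine isOpen_iInter_of_finite fun j => ?_
  cases s j
  · simpa using isOpen_lt (by fun_prop) continuous_const
  · simpa using isOpen_lt continuous_const (by fun_prop)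

/-- The convex hull contains a cube around the origin. A functional separating a point of a
sufficiently small cube from the hull would be at most as large at the chosen point whose
coordinates have signs opposite to its coefficients. A cone containing a neighbourhood of the origin
is everything. -/
theorem hull_eq_top_of_orthants {ι : Type*} [Finite ι] {d : ℕ} {u : ι → H d}
    (h : ∀ s : Fin d → Bool, ∃ i, u i ∈ orthant s) :
    PointedCone.hull ℝ (Set.range u) = ⊤ := by
  choose p hp using h
  obtain ⟨ε, hε, hεp⟩ : ∃ ε > 0, ∀ s j, ε ≤ |u (p s) j| := by
    have h1 : ∀ q : (Fin d → Bool) × Fin d, 0 < |u (p q.1) q.2| := by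
      intro q
      have := hp q.1 q.2
      rw [abs_pos]
      split_ifs at this
      · exact this.ne'
      · exact this.ne
    have h2 : ∀ᶠ ε in 𝓝[>] (0 : ℝ), ∀ q : (Fin d → Bool) × Fin d, ε ≤ |u (p q.1) q.2| :=
      eventually_all.2 fun q =>
        nhdsWithin_le_nhds ((eventually_lt_nhds (h1 q)).mono fun _ h => h.le)
    obtain ⟨ε, h3, h4⟩ := (h2.and self_mem_nhdsWithin).exists
    exact ⟨ε, h4, fun s j => h3 (s, j)⟩
  have hsmall : ∀ v : H d, (∀ j, |v j| ≤ ε) → v ∈ convexHull ℝ (Set.range u) := by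
    intro v hv
    by_contra hnot
    have hcl : IsClosed (convexHull ℝ (Set.range u)) :=
      ((Set.finite_range u).isCompact_convexHull (𝕜 := ℝ)).isClosed
    obtain ⟨f, a, hfv, hfa⟩ := geometric_hahn_banach_point_closed (convex_convexHull ℝ _) hcl hnot
    set b : Fin d → ℝ := fun j => f (EuclideanSpace.single j 1) with hb
    have hf : ∀ x : H d, f x = ∑ j, x j * b j := by
      intro x
      conv_lhs => rw [← (EuclideanSpace.basisFun (Fin d) ℝ).sum_repr x]
      simp [hb]
    -- Signs opposite to those of the coefficients `b`; a vanishing coefficient does not matter.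
    set s : Fin d → Bool := fun j => decide (b j < 0) with hs
    have h1 := hfv.trans (hfa _ (subset_convexHull ℝ _ ⟨p s, rfl⟩))
    rw [hf, hf] at h1
    refine absurd h1 (not_lt.2 (Finset.sum_le_sum fun j _ => ?_))
    have h2 := hp s j
    have h3 := hεp s j
    have h4 := abs_le.1 (hv j)
    by_cases hbj : b j < 0
    · have : s j = true := by simp [hs, hbj]
      rw [if_pos this] at h2
      rw [abs_of_pos h2] at h3
      nlinarith
    · have : s j = false := by simp [hs, hbj]
      rw [this] at h2
      simp only [Bool.false_eq_true, if_false] at h2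
      rw [abs_of_neg h2] at h3
      nlinarith [not_lt.1 hbj]
  rw [Submodule.eq_top_iff']
  intro v
  set c : ℝ := ε / (1 + ‖v‖) with hc
  have hc0 : 0 < c := by positivity
  have h1 : c • v ∈ convexHull ℝ (Set.range u) := by
    refine hsmall _ fun j => ?_
    have h2 : |v j| ≤ ‖v‖ := PiLp.norm_apply_le v j
    rw [PiLp.smul_apply, smul_eq_mul, abs_mul, abs_of_pos hc0, hc, div_mul_eq_mul_div,
      div_le_iff₀ (by positivity)]
    nlinarith
  have h2 : convexHull ℝ (Set.range u) ⊆ (PointedCone.hull ℝ (Set.range u) : Set (H d)) :=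
    convexHull_min Submodule.subset_span (PointedCone.convex _)
  have h3 := (PointedCone.hull ℝ (Set.range u)).smul_mem (inv_nonneg.2 hc0.le) (h2 h1)
  rwa [smul_smul, inv_mul_cancel₀ hc0.ne', one_smul] at h3

theorem orthant_inter_sphere {d : ℕ} (hd : 0 < d) (s : Fin d → Bool) :
    ∃ u ∈ orthant s, ‖u‖ = 1 := by
  set v : H d := WithLp.toLp 2 fun j => if s j then (1 : ℝ) else -1 with hv
  have hv0 : v ≠ 0 := by
    intro h
    have := congrArg (fun x : H d => x ⟨0, hd⟩) h
    simp only [hv, PiLp.zero_apply] at this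
    split_ifs at this <;> norm_num at this
  refine ⟨‖v‖⁻¹ • v, fun j => ?_, by simp [norm_smul, hv0]⟩
  have : 0 < ‖v‖⁻¹ := inv_pos.2 (norm_pos_iff.2 hv0)
  rw [PiLp.smul_apply, smul_eq_mul]
  by_cases h : s j
  · simpa [hv, h] using this
  · simpa [hv, h] using this

theorem cylProb_orthant_pos {d : ℕ} (hd : 0 < d) (s : Fin d → Bool) :
    0 < cylProb (H d) (Prod.fst ⁻¹' orthant s) := by
  have hn : Nontrivial (H d) := Module.nontrivial_of_finrank_pos (R := ℝ) (by simpa using hd)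
  rw [pos_iff_ne_zero]
  intro h0
  have h1 : cyl (H d) (Prod.fst ⁻¹' orthant s) = 0 := by
    have := (ae_cyl_iff_cylProb (F := H d) (p := fun z => z ∉ Prod.fst ⁻¹' orthant s)).1
      (by rw [ae_iff]; simp only [not_not]; exact h0)
    rw [ae_iff] at this
    simp only [not_not] at this
    exact this
  have h2 : sphMeasure (H d) (orthant s) ≠ 0 := by
    unfold sphMeasure
    rw [Measure.map_apply measurable_subtype_coe (isOpen_orthant s).measurableSet]
    refine IsOpen.measure_ne_zero _ ((isOpen_orthant s).preimage continuous_subtype_val) ?_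
    obtain ⟨u, hu, hu1⟩ := orthant_inter_sphere hd s
    exact ⟨⟨u, by simpa using hu1⟩, hu⟩
  have h3 : heights (Module.finrank ℝ (H d)) Set.univ ≠ 0 := by
    intro h
    have h4 : cyl (H d) Set.univ = 0 := by
      rw [cyl, ← Set.univ_prod_univ, Measure.prod_prod, h, mul_zero]
    rw [cyl_univ, ENNReal.ofReal_eq_zero] at h4
    have := omega_pos (Nat.succ_pos (Module.finrank ℝ (H d)))
    simp only [Nat.succ_eq_add_one] at this
    linarith
  rw [cyl, ← Set.prod_univ, Measure.prod_prod] at h1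
  exact (mul_ne_zero h2 h3) h1

end Orthants

end SphPoly

namespace SphPoly

/-! ### Decomposition of the missed region by facets. -/

section Facets

variable {d n : ℕ}

/-- The sub-tuple of `x` with indices in `I`. -/
def subTuple (I : {I : Finset (Fin n) // I.card = d}) (x : Fin n → H d × ℝ) : Fin d → H d × ℝ :=
  fun k => x (I.1.orderEmbOfFin I.2 k)

/-- The points lying below the facet of the lower hull of `x` with vertices in `I`. -/
def belowFacet (I : {I : Finset (Fin n) // I.card = d}) (x : Fin n → H d × ℝ) :
    Set (H d × ℝ) :=
  {z | z ∈ below (subTuple I x) ∧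
    ∀ j ∉ I.1, inner ℝ (normalVec (subTuple I x)) (x j).1 < (x j).2}

theorem measurable_subTuple (I : {I : Finset (Fin n) // I.card = d}) :
    Measurable (subTuple I) := by
  unfold subTuple; fun_prop

theorem measurableSet_belowFacet_prod (I : {I : Finset (Fin n) // I.card = d}) :
    MeasurableSet {p : (Fin n → H d × ℝ) × (H d × ℝ) | p.2 ∈ belowFacet I p.1} := by
  have h1 : MeasurableSet {p : (Fin n → H d × ℝ) × (H d × ℝ) | p.2 ∈ below (subTuple I p.1)} := by
    have hf : Measurable fun p : (Fin n → H d × ℝ) × (H d × ℝ) => (subTuple I p.1, p.2) :=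
      ((measurable_subTuple I).comp measurable_fst).prodMk measurable_snd
    exact hf measurableSet_below_prod
  have h2 : MeasurableSet {p : (Fin n → H d × ℝ) × (H d × ℝ) |
      ∀ j ∉ I.1, inner ℝ (normalVec (subTuple I p.1)) (p.1 j).1 < (p.1 j).2} := by
    simp only [Set.ofPred_forall]
    refine MeasurableSet.iInter fun j => MeasurableSet.iInter fun _ => ?_
    exact measurableSet_lt ((measurable_normalVec.comp ((measurable_subTuple I).comp
      measurable_fst)).inner (by fun_prop)) (by fun_prop)
  exact h1.inter h2

/-- The points of the tuple are in general position. -/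
structure GenericTuple (x : Fin n → H d × ℝ) : Prop where
  pos : ∀ i, 0 < (x i).2
  fst : ∀ (i : Fin n) (S : Finset (Fin n)), i ∉ S → S.card < d →
    (x i).1 ∉ Submodule.span ℝ ((fun j => (x j).1) '' S)
  lift : ∀ (i : Fin n) (S : Finset (Fin n)), i ∉ S → S.card < d + 1 →
    x i ∉ Submodule.span ℝ (x '' S)

theorem ae_genericTuple (hd : 0 < d) :
    ∀ᵐ x ∂(Measure.pi fun _ : Fin n => cylProb (H d)), GenericTuple x := by
  have hn : Nontrivial (H d) := Module.nontrivial_of_finrank_pos (R := ℝ) (by simpa using hd)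
  have h1 : ∀ᵐ x ∂(Measure.pi fun _ : Fin n => cylProb (H d)),
      ∀ i, ‖(x i).1‖ = 1 ∧ 0 < (x i).2 := by
    rw [ae_all_iff]
    intro i
    exact (Measure.quasiMeasurePreserving_eval (fun _ : Fin n => cylProb (H d)) i).ae
      (ae_cyl_iff_cylProb.2 ae_cyl)
  have h2 := ae_pi_notMem_span (n := n) (ν := cylProb (H d)) (measurable_fst (α := H d) (β := ℝ))
    fun S hS => cylProb_fst_submodule S hS
  have h3 := ae_pi_notMem_span (n := n) (ν := cylProb (H d)) (measurable_id (α := H d × ℝ))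
    fun S hS => cylProb_submodule S hS
  filter_upwards [h1, h2, h3] with x h1 h2 h3
  refine ⟨fun i => (h1 i).2, fun i S hi hS => h2 i S hi (by simpa using hS),
    fun i S hi hS => h3 i S hi (by simpa using hS)⟩

/-- Only the condition `card_le` involves `z`: its direction has to avoid the spans of fewer than
`d` of the points, which are finitely many proper subspaces. -/
theorem GenericTuple.ae_generalPosition (hd : 0 < d) {x : Fin n → H d × ℝ}
    (hx : GenericTuple x) :
    ∀ᵐ z ∂cyl (H d), GeneralPosition d (fun i => (x i).1) (fun i => (x i).2) z.1 := by
  classical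
  have hn : Nontrivial (H d) := Module.nontrivial_of_finrank_pos (R := ℝ) (by simpa using hd)
  have h1 : ∀ᵐ z ∂cyl (H d), ∀ S : Finset (Fin n), S.card < d →
      z.1 ∉ Submodule.span ℝ ((fun j => (x j).1) '' S) := by
    rw [ae_all_iff]; intro S
    rw [ae_all_iff]; intro hS
    rw [ae_iff]
    simp only [not_not]
    exact cyl_fst_submodule _ (finrank_span_image_lt (by simpa using hS))
  filter_upwards [h1] with z hz
  refine ⟨hx.pos, fun c hc h0 => ?_, fun c hc h0 h0' => ?_, fun c hc => ?_⟩
  · exact eq_zero_of_notMem_span hx.fst c _ (fun i hi => by simpa using hi) hc h0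
  · refine eq_zero_of_notMem_span hx.lift c _ (fun i hi => by simpa using hi) hc ?_
    rw [Prod.ext_iff, Prod.fst_sum, Prod.snd_sum]
    exact ⟨h0, h0'⟩
  · by_contra hlt
    refine hz _ (not_le.1 hlt) ?_
    rw [← hc]
    refine Submodule.sum_mem _ fun i _ => ?_
    by_cases hi : c i = 0
    · simp [hi]
    · exact Submodule.smul_mem _ _ (Submodule.subset_span ⟨i, by simpa using hi, rfl⟩)

theorem GenericTuple.linearIndependent {x : Fin n → H d × ℝ} (hx : GenericTuple x)
    (I : {I : Finset (Fin n) // I.card = d}) :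
    LinearIndependent ℝ fun k => (subTuple I x k).1 := by
  rw [linearIndependent_iff_notMem_span]
  intro k
  set S := (Finset.univ.erase k).map (I.1.orderEmbOfFin I.2).toEmbedding with hS
  have h1 := hx.fst (I.1.orderEmbOfFin I.2 k) S (by simp [hS]) (by
    rw [hS, Finset.card_map]
    have := Finset.card_erase_lt_of_mem (Finset.mem_univ k)
    simpa using this)
  have h2 : (fun j => (x j).1) '' (S : Set (Fin n)) =
      (fun k => (subTuple I x k).1) '' (Set.univ \ {k}) := by
    rw [hS, Finset.coe_map, Set.image_image, Finset.coe_erase, Finset.coe_univ]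
    rfl
  rwa [h2] at h1

theorem linearMap_normalVec {x : Fin n → H d × ℝ} (hx : GenericTuple x)
    (I : {I : Finset (Fin n) // I.card = d}) (i : Fin n) (hi : i ∈ I.1) :
    inner ℝ (normalVec (subTuple I x)) (x i).1 = (x i).2 := by
  obtain ⟨k, rfl⟩ : ∃ k, I.1.orderEmbOfFin I.2 k = i := by
    have : i ∈ Set.range (I.1.orderEmbOfFin I.2) := by
      rw [Finset.range_orderEmbOfFin]; exact hi
    exact this
  exact inner_normalVec (hx.linearIndependent I) k

theorem mem_hull_subTuple (I : {I : Finset (Fin n) // I.card = d}) {x : Fin n → H d × ℝ}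
    {v : H d} : v ∈ PointedCone.hull ℝ (Set.range fun k => (subTuple I x k).1) ↔
      ∃ c : Fin n → ℝ, (∀ i, 0 ≤ c i) ∧ (∀ i ∉ I.1, c i = 0) ∧ ∑ i, c i • (x i).1 = v := by
  have : (Set.range fun k => (subTuple I x k).1) = (fun i => (x i).1) '' (I.1 : Set (Fin n)) := by
    rw [← Finset.range_orderEmbOfFin I.1 I.2, ← Set.range_comp]
    rfl
  rw [this, mem_hull_image]
  simp

theorem isOptimal_iff {x : Fin n → H d × ℝ} (I : {I : Finset (Fin n) // I.card = d})
    {z : H d × ℝ} :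
    z ∈ belowFacet I x ↔ IsOptimal (fun i => (x i).1) (fun i => (x i).2) z.1 I.1
      (innerₗ (H d) (normalVec (subTuple I x))) ∧ z.2 < inner ℝ (normalVec (subTuple I x)) z.1 := by
  constructor
  · rintro ⟨⟨h1, h2⟩, h3⟩
    exact ⟨⟨(mem_hull_subTuple I).1 h1, h3⟩, h2⟩
  · rintro ⟨⟨h1, h3⟩, h2⟩
    exact ⟨⟨(mem_hull_subTuple I).2 h1, h2⟩, h3⟩

/-- Strong duality: over the direction `z.1`, the hull consists of the heights at or above the
hyperplane of an optimal basis. -/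
theorem notMem_hull_iff (hd : 0 < d) {x : Fin n → H d × ℝ} (hx : GenericTuple x) {z : H d × ℝ}
    (hz : GeneralPosition d (fun i => (x i).1) (fun i => (x i).2) z.1)
    (htop : PointedCone.hull ℝ (Set.range fun i => (x i).1) = ⊤) :
    z ∉ PointedCone.hull ℝ (Set.range x) ↔ ∃ I, z ∈ belowFacet I x := by
  classical
  have hne : Nonempty (Fin n) := by
    by_contra h
    rw [not_nonempty_iff] at h
    have hn : Nontrivial (H d) := Module.nontrivial_of_finrank_pos (R := ℝ) (by simpa using hd)
    obtain ⟨v, hv⟩ := exists_ne (0 : H d)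
    have : v ∈ PointedCone.hull ℝ (Set.range fun i => (x i).1) := by rw [htop]; trivial
    obtain ⟨c, -, hc⟩ := mem_hull_range.1 this
    exact hv (by simpa using hc.symm)
  constructor
  · intro h
    obtain ⟨I, hI, ho⟩ := exists_isOptimal (by simp) hz (by rw [htop]; trivial)
      (fun I => if h : I.card = d then innerₗ (H d) (normalVec (subTuple ⟨I, h⟩ x)) else 0)
      (fun I hI i hi => by
        rw [dif_pos hI]
        exact linearMap_normalVec hx ⟨I, hI⟩ i hi)
    rw [dif_pos hI] at ho
    refine ⟨⟨I, hI⟩, (isOptimal_iff _).2 ⟨ho, ?_⟩⟩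
    by_contra hle
    exact h (mem_hull_of_le hx.pos htop (fun i hi => linearMap_normalVec hx ⟨I, hI⟩ i hi) ho
      (not_lt.1 hle))
  · rintro ⟨I, hI⟩ hmem
    obtain ⟨ho, hlt⟩ := (isOptimal_iff I).1 hI
    exact absurd hlt (not_lt.2 (ho.le_of_mem_hull (fun i hi => linearMap_normalVec hx I i hi) hmem))

theorem belowFacet_inj {x : Fin n → H d × ℝ} (hx : GenericTuple x) {z : H d × ℝ}
    (hz : GeneralPosition d (fun i => (x i).1) (fun i => (x i).2) z.1)
    {I J : {I : Finset (Fin n) // I.card = d}} (hI : z ∈ belowFacet I x)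
    (hJ : z ∈ belowFacet J x) : I = J :=
  Subtype.ext (((isOptimal_iff I).1 hI).1.unique hz I.2 J.2
    (fun i hi => linearMap_normalVec hx I i hi) (fun i hi => linearMap_normalVec hx J i hi)
    ((isOptimal_iff J).1 hJ).1)

/-- The tuples that miss some orthant. -/
def missesOrthant (d n : ℕ) : Set (Fin n → H d × ℝ) :=
  ⋃ s : Fin d → Bool, {x | ∀ i, x i ∈ (Prod.fst ⁻¹' orthant s : Set (H d × ℝ))ᶜ}

/-- The optimal basis is unique, so the pieces are disjoint up to null sets. Positive spanning is
not needed here, which lets `le_missInt` bound the sum by the total mass also for tuples that miss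
an orthant. -/
theorem sum_belowFacet_eq (hd : 0 < d) {x : Fin n → H d × ℝ} (hx : GenericTuple x) :
    ∑ I, cyl (H d) (belowFacet I x) = cyl (H d) (⋃ I, belowFacet I x) := by
  have hms : ∀ I, MeasurableSet (belowFacet I x) := fun I =>
    measurable_prodMk_left (measurableSet_belowFacet_prod I)
  rw [measure_iUnion₀ _ fun I => (hms I).nullMeasurableSet, tsum_fintype]
  intro I J hIJ
  have h := hx.ae_generalPosition hd
  rw [ae_iff] at h
  exact measure_mono_null (fun z hz hg => hIJ (belowFacet_inj hx hg hz.1 hz.2)) h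

theorem measure_notMem_hull_eq (hd : 0 < d) {x : Fin n → H d × ℝ} (hx : GenericTuple x)
    (hB : x ∉ missesOrthant d n) :
    cyl (H d) {z | z ∉ PointedCone.hull ℝ (Set.range x)} =
      ∑ I, cyl (H d) (belowFacet I x) := by
  have htop : PointedCone.hull ℝ (Set.range fun i => (x i).1) = ⊤ := by
    refine hull_eq_top_of_orthants fun s => ?_
    by_contra! h
    exact hB (Set.mem_iUnion.2 ⟨s, fun i => h i⟩)
  rw [sum_belowFacet_eq hd hx]
  apply measure_congr
  filter_upwards [hx.ae_generalPosition hd] with z hz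
  apply propext
  have := notMem_hull_iff hd hx hz htop
  rw [← Set.mem_iUnion] at this
  exact this

/-- The expected measure of the part of the half-sphere missed by the convex hull of `n` points. -/
noncomputable def missInt (d n : ℕ) : ℝ≥0∞ :=
  ∫⁻ x, cyl (H d) {z | z ∉ PointedCone.hull ℝ (Set.range x)}
    ∂(Measure.pi fun _ : Fin n => cylProb (H d))

/-- The expected measure of the part of the half-sphere below a given facet. -/
noncomputable def facetInt (d k : ℕ) : ℝ≥0∞ :=
  ∫⁻ y, cyl (H d) (below y) * ENNReal.ofReal (1 - Real.arctan ‖normalVec y‖ / Real.pi) ^ k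
    ∂(Measure.pi fun _ : Fin d => cylProb (H d))

theorem cylProb_inner_lt (hd : 2 ≤ d) (h : H d) :
    cylProb (H d) {z | inner ℝ h z.1 < z.2} =
      ENNReal.ofReal (1 - Real.arctan ‖h‖ / Real.pi) := by
  have hn : Nontrivial (H d) := Module.nontrivial_of_finrank_pos (R := ℝ) (by simp; omega)
  have hms : MeasurableSet {z : H d × ℝ | z.2 ≤ inner ℝ h z.1} :=
    measurableSet_le measurable_snd (by fun_prop)
  have h1 : {z : H d × ℝ | inner ℝ h z.1 < z.2} = {z : H d × ℝ | z.2 ≤ inner ℝ h z.1}ᶜ := by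
    ext z; simp
  rw [h1, prob_compl_eq_one_sub hms, cylProb_le_inner (by simpa using hd),
    ENNReal.ofReal_sub _ (div_nonneg (Real.arctan_nonneg.2 (norm_nonneg h)) Real.pi_pos.le),
    ENNReal.ofReal_one]

theorem measurable_measure_belowFacet (I : {I : Finset (Fin n) // I.card = d}) :
    Measurable fun x : Fin n → H d × ℝ => cyl (H d) (belowFacet I x) :=
  measurable_measure_prodMk_left (measurableSet_belowFacet_prod I)

/-- Conditionally on the `d` points indexed by `I`, the other `n - d` are independent and each lies
above the hyperplane with the complementary probability of a lune. -/
theorem lintegral_belowFacet (hd : 2 ≤ d) (I : {I : Finset (Fin n) // I.card = d}) :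
    ∫⁻ x, cyl (H d) (belowFacet I x) ∂(Measure.pi fun _ : Fin n => cylProb (H d)) =
      facetInt d (n - d) := by
  have hn : Nontrivial (H d) := Module.nontrivial_of_finrank_pos (R := ℝ) (by simp; omega)
  have hIc : I.1ᶜ.card = n - d := by rw [Finset.card_compl, I.2, Fintype.card_fin]
  -- Relabelling that lists `I` in increasing order and then its complement, so that the product
  -- measure splits and `subTuple I` reads off the first factor.
  set σ := finSumEquivOfFinset I.2 hIc with hσ
  have hmp := (measurePreserving_piCongrLeft (α := fun _ => H d × ℝ)
    (fun _ : Fin n => cylProb (H d)) σ).comp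
    (measurePreserving_sumPiEquivProdPi_symm (X := fun _ : Fin d ⊕ Fin (n - d) => H d × ℝ)
      (fun _ => cylProb (H d)))
  have hms := measurable_measure_belowFacet I
  rw [← hmp.lintegral_comp hms, facetInt]
  refine (lintegral_prod _ (hms.comp hmp.measurable).aemeasurable).trans
    (lintegral_congr fun y => ?_)
  simp only [Function.comp_def (fun x : Fin n → H d × ℝ => cyl (H d) (belowFacet I x))]
  have hval : ∀ (w : Fin (n - d) → H d × ℝ) (q : Fin d ⊕ Fin (n - d)),
      ((MeasurableEquiv.piCongrLeft (fun _ => H d × ℝ) σ) ∘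
        (MeasurableEquiv.sumPiEquivProdPi fun _ : Fin d ⊕ Fin (n - d) => H d × ℝ).symm) (y, w)
        (σ q) = Sum.elim y w q := by
    intro w q
    rw [Function.comp_apply, MeasurableEquiv.piCongrLeft_apply_apply]
    cases q <;> rfl
  have hsub : ∀ w : Fin (n - d) → H d × ℝ, subTuple I
      (((MeasurableEquiv.piCongrLeft (fun _ => H d × ℝ) σ) ∘
        (MeasurableEquiv.sumPiEquivProdPi fun _ : Fin d ⊕ Fin (n - d) => H d × ℝ).symm) (y, w))
        = y := by
    intro w
    ext1 k
    exact hval w (Sum.inl k)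
  have hcond : ∀ w : Fin (n - d) → H d × ℝ, (∀ j ∉ I.1, inner ℝ (normalVec y)
      (((MeasurableEquiv.piCongrLeft (fun _ => H d × ℝ) σ) ∘
        (MeasurableEquiv.sumPiEquivProdPi fun _ : Fin d ⊕ Fin (n - d) => H d × ℝ).symm) (y, w)
        j).1 < (((MeasurableEquiv.piCongrLeft (fun _ => H d × ℝ) σ) ∘
        (MeasurableEquiv.sumPiEquivProdPi fun _ : Fin d ⊕ Fin (n - d) => H d × ℝ).symm) (y, w)
        j).2) ↔ w ∈ Set.univ.pi fun _ => {z : H d × ℝ | inner ℝ (normalVec y) z.1 < z.2} := by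
    intro w
    constructor
    · intro h k _
      have h1 : σ (Sum.inr k) ∉ I.1 := by
        rw [hσ, finSumEquivOfFinset_inr]
        exact Finset.mem_compl.1 (Finset.orderEmbOfFin_mem _ hIc k)
      have h2 := h _ h1
      rwa [hval] at h2
    · intro h j hj
      obtain ⟨q, rfl⟩ := σ.surjective j
      rcases q with k | k
      · exact absurd (Finset.orderEmbOfFin_mem _ I.2 k) hj
      · rw [hval]
        exact h k trivial
  have hmt : MeasurableSet {z : H d × ℝ | inner ℝ (normalVec y) z.1 < z.2} :=
    measurableSet_lt (by fun_prop) measurable_snd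
  have hfun : ∀ w : Fin (n - d) → H d × ℝ, cyl (H d) (belowFacet I
      (((MeasurableEquiv.piCongrLeft (fun _ => H d × ℝ) σ) ∘
        (MeasurableEquiv.sumPiEquivProdPi fun _ : Fin d ⊕ Fin (n - d) => H d × ℝ).symm) (y, w)))
      = cyl (H d) (below y) * (Set.univ.pi fun _ : Fin (n - d) =>
        {z : H d × ℝ | inner ℝ (normalVec y) z.1 < z.2}).indicator 1 w := by
    intro w
    unfold belowFacet
    rw [hsub w]
    simp only [hcond w]
    by_cases h : w ∈ Set.univ.pi fun _ : Fin (n - d) =>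
        {z : H d × ℝ | inner ℝ (normalVec y) z.1 < z.2}
    · rw [Set.indicator_of_mem h, Pi.one_apply, mul_one]
      congr 1
      ext z
      exact and_iff_left h
    · rw [Set.indicator_of_notMem h, mul_zero]
      convert! measure_empty (μ := cyl (H d))
      ext z
      exact iff_of_false (fun hz => h hz.2) (Set.notMem_empty z)
  simp only [hfun]
  rw [lintegral_const_mul' _ _ (measure_ne_top _ _),
    lintegral_indicator_one (MeasurableSet.univ_pi fun _ => hmt), Measure.pi_pi]
  simp only [cylProb_inner_lt hd, Finset.prod_const, Finset.card_univ, Fintype.card_fin]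

theorem measurableSet_missesOrthant : MeasurableSet (missesOrthant d n) := by
  refine MeasurableSet.iUnion fun s => ?_
  simp only [Set.ofPred_forall]
  exact MeasurableSet.iInter fun i => (measurable_pi_apply i)
    ((measurable_fst (isOpen_orthant s).measurableSet).compl)

theorem measurable_measure_notMem_hull :
    Measurable fun x : Fin n → H d × ℝ => cyl (H d) {z | z ∉ PointedCone.hull ℝ (Set.range x)} :=
  measurable_measure_prodMk_left
    (measurableSet_mem_hull (ι := Fin n) (V := H d × ℝ)).compl

/-- Expectation of `measure_notMem_hull_eq`; on tuples missing an orthant the missed measure is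
bounded by the total mass. -/
theorem missInt_le (hd : 2 ≤ d) :
    missInt d n ≤ (n.choose d : ℝ≥0∞) * facetInt d (n - d) + cyl (H d) Set.univ *
      (Measure.pi fun _ : Fin n => cylProb (H d)) (missesOrthant d n) := by
  have hn : Nontrivial (H d) := Module.nontrivial_of_finrank_pos (R := ℝ) (by simp; omega)
  have hmB : Measurable fun x : Fin n → H d × ℝ =>
      cyl (H d) Set.univ * (missesOrthant d n).indicator 1 x :=
    measurable_const.mul (measurable_one.indicator measurableSet_missesOrthant)
  have h1 : ∀ᵐ x ∂(Measure.pi fun _ : Fin n => cylProb (H d)),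
      cyl (H d) {z | z ∉ PointedCone.hull ℝ (Set.range x)} ≤
      (∑ I, cyl (H d) (belowFacet I x)) +
        cyl (H d) Set.univ * (missesOrthant d n).indicator 1 x := by
    filter_upwards [ae_genericTuple (n := n) (by omega)] with x hx
    by_cases hB : x ∈ missesOrthant d n
    · rw [Set.indicator_of_mem hB, Pi.one_apply, mul_one]
      exact (measure_mono (Set.subset_univ _)).trans le_add_self
    · rw [measure_notMem_hull_eq (by omega) hx hB]
      exact le_self_add
  refine (lintegral_mono_ae h1).trans ?_
  rw [lintegral_add_right _ hmB, lintegral_finsetSum _ fun I _ =>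
    measurable_measure_belowFacet I,
    lintegral_const_mul _ (measurable_one.indicator measurableSet_missesOrthant),
    lintegral_indicator_one measurableSet_missesOrthant]
  simp only [lintegral_belowFacet hd, Finset.sum_const, Finset.card_univ, nsmul_eq_mul,
    Fintype.card_finset_len, Fintype.card_fin]
  exact le_rfl

theorem le_missInt (hd : 2 ≤ d) :
    (n.choose d : ℝ≥0∞) * facetInt d (n - d) ≤ missInt d n + cyl (H d) Set.univ *
      (Measure.pi fun _ : Fin n => cylProb (H d)) (missesOrthant d n) := by
  have hn : Nontrivial (H d) := Module.nontrivial_of_finrank_pos (R := ℝ) (by simp; omega)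
  have hmB : Measurable fun x : Fin n → H d × ℝ =>
      cyl (H d) Set.univ * (missesOrthant d n).indicator 1 x :=
    measurable_const.mul (measurable_one.indicator measurableSet_missesOrthant)
  have h1 : ∀ᵐ x ∂(Measure.pi fun _ : Fin n => cylProb (H d)),
      (∑ I, cyl (H d) (belowFacet I x)) ≤
      cyl (H d) {z | z ∉ PointedCone.hull ℝ (Set.range x)} +
        cyl (H d) Set.univ * (missesOrthant d n).indicator 1 x := by
    filter_upwards [ae_genericTuple (n := n) (by omega)] with x hx
    by_cases hB : x ∈ missesOrthant d n
    · rw [Set.indicator_of_mem hB, Pi.one_apply, mul_one, sum_belowFacet_eq (by omega) hx]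
      exact (measure_mono (Set.subset_univ _)).trans le_add_self
    · rw [measure_notMem_hull_eq (by omega) hx hB]
      exact le_self_add
  have h2 := lintegral_mono_ae h1
  rw [lintegral_add_right _ hmB, lintegral_finsetSum _ fun I _ =>
    measurable_measure_belowFacet I,
    lintegral_const_mul _ (measurable_one.indicator measurableSet_missesOrthant),
    lintegral_indicator_one measurableSet_missesOrthant] at h2
  simp only [lintegral_belowFacet hd, Finset.sum_const, Finset.card_univ, nsmul_eq_mul,
    Fintype.card_finset_len, Fintype.card_fin] at h2
  exact h2

/-- Each of the `2 ^ d` orthants has positive probability. The base `ρ` is the largest probability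
that a single point avoids a given orthant, and the orthants are joined by a union bound. -/
theorem exists_missesOrthant_le (hd : 0 < d) : ∃ ρ : ℝ, 0 ≤ ρ ∧ ρ < 1 ∧ ∀ n : ℕ,
    (Measure.pi fun _ : Fin n => cylProb (H d)) (missesOrthant d n) ≤
      ENNReal.ofReal (2 ^ d * ρ ^ n) := by
  have hn : Nontrivial (H d) := Module.nontrivial_of_finrank_pos (R := ℝ) (by simpa using hd)
  set q : (Fin d → Bool) → ℝ := fun s =>
    (cylProb (H d)).real (Prod.fst ⁻¹' orthant s : Set (H d × ℝ))ᶜ with hq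
  have hq1 : ∀ s, q s < 1 := by
    intro s
    have hm : MeasurableSet (Prod.fst ⁻¹' orthant s : Set (H d × ℝ)) :=
      measurable_fst (isOpen_orthant s).measurableSet
    simp only [hq, probReal_compl_eq_one_sub hm]
    have := ENNReal.toReal_pos (cylProb_orthant_pos hd s).ne' (measure_ne_top _ _)
    simp only [Measure.real]
    linarith
  obtain ⟨s₀, hs₀⟩ := Finite.exists_max q
  refine ⟨q s₀, measureReal_nonneg, hq1 s₀, fun n => (measure_iUnion_le _).trans ?_⟩
  rw [tsum_fintype]
  have h1 : ∀ s, (Measure.pi fun _ : Fin n => cylProb (H d))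
      {x | ∀ i, x i ∈ (Prod.fst ⁻¹' orthant s : Set (H d × ℝ))ᶜ} ≤
      ENNReal.ofReal (q s₀ ^ n) := by
    intro s
    have : {x : Fin n → H d × ℝ | ∀ i, x i ∈ (Prod.fst ⁻¹' orthant s : Set (H d × ℝ))ᶜ} =
        Set.univ.pi fun _ => (Prod.fst ⁻¹' orthant s : Set (H d × ℝ))ᶜ := by
      ext; simp
    rw [this, Measure.pi_pi, Finset.prod_const, Finset.card_univ, Fintype.card_fin,
      ENNReal.ofReal_pow measureReal_nonneg]
    gcongr
    rw [← ofReal_measureReal]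
    exact ENNReal.ofReal_le_ofReal (hs₀ s)
  refine (Finset.sum_le_sum fun s _ => h1 s).trans ?_
  rw [Finset.sum_const, Finset.card_univ, nsmul_eq_mul, ENNReal.ofReal_mul (by positivity)]
  simp

end Facets

end SphPoly

namespace SphPoly

/-! ### The contribution of one facet as a radial integral. -/

section ProductDensity

theorem lintegral_fin_prod_eq_prod {α : Type*} [MeasurableSpace α] {n : ℕ}
    (ν : Fin n → Measure α) [∀ i, SigmaFinite (ν i)] {f : Fin n → α → ℝ≥0∞}
    (hf : ∀ i, Measurable (f i)) :
    ∫⁻ x, ∏ i, f i (x i) ∂(Measure.pi ν) = ∏ i, ∫⁻ a, f i a ∂ν i := by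
  induction n with
  | zero => simp
  | succ n ih =>
    rw [← ((measurePreserving_piFinSuccAbove ν 0).symm).lintegral_comp (by fun_prop)]
    have : ∀ p : α × (Fin n → α), ∏ i, f i ((MeasurableEquiv.piFinSuccAbove (fun _ => α) 0).symm
        p i) = f 0 p.1 * ∏ i : Fin n, f i.succ (p.2 i) := by
      intro p
      rw [Fin.prod_univ_succ]
      rfl
    simp only [this]
    refine (lintegral_prod_mul (μ := ν 0) (ν := Measure.pi fun i : Fin n => ν i.succ) (f := f 0)
      (g := fun y : Fin n → α => ∏ i, f i.succ (y i)) (hf 0).aemeasurable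
      (Finset.measurable_prod _ fun i _ =>
        (hf i.succ).comp (measurable_pi_apply i)).aemeasurable).trans ?_
    rw [Fin.prod_univ_succ]
    congr 1
    exact ih (fun i => ν i.succ) fun i => hf i.succ

theorem pi_withDensity {α : Type*} [MeasurableSpace α] {n : ℕ} (ν : Measure α) [SigmaFinite ν]
    {f : α → ℝ≥0∞} (hf : Measurable f) [SigmaFinite (ν.withDensity f)] :
    Measure.pi (fun _ : Fin n => ν.withDensity f) =
      (Measure.pi fun _ => ν).withDensity fun x => ∏ i, f (x i) := by
  refine Measure.pi_eq fun s hs => ?_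
  rw [withDensity_apply _ (MeasurableSet.univ_pi hs), Measure.restrict_pi_pi,
    lintegral_fin_prod_eq_prod _ fun _ => hf]
  exact Finset.prod_congr rfl fun i _ => (withDensity_apply _ (hs i)).symm

theorem pi_const_smul {α : Type*} [MeasurableSpace α] {n : ℕ} (ν : Measure α)
    [IsFiniteMeasure ν] {c : ℝ≥0∞} (hc : c ≠ ⊤) :
    Measure.pi (fun _ : Fin n => c • ν) = c ^ n • Measure.pi fun _ => ν := by
  have : IsFiniteMeasure (c • ν) := ν.smul_finite hc
  refine Measure.pi_eq fun s hs => ?_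
  rw [Measure.smul_apply, Measure.pi_pi]
  simp [Finset.prod_mul_distrib]

end ProductDensity

section Determinant

variable {d : ℕ}

theorem volume_parallelepiped (u : Fin d → H d) :
    volume (parallelepiped u) =
      ENNReal.ofReal |(Matrix.of fun i j => u i j : Matrix (Fin d) (Fin d) ℝ).det| := by
  rw [← (EuclideanSpace.basisFun (Fin d) ℝ).addHaar_eq_volume, Measure.addHaar_parallelepiped,
    Module.Basis.det_apply, ← Matrix.det_transpose]
  rfl

theorem measurable_volume_parallelepiped :
    Measurable fun u : Fin d → H d => volume (parallelepiped u) := by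
  simp only [volume_parallelepiped]
  have h1 : Continuous fun u : Fin d → H d =>
      (Matrix.of fun i j => u i j : Matrix (Fin d) (Fin d) ℝ) :=
    continuous_matrix fun i j => by
      simp only [Matrix.of_apply]
      fun_prop
  exact (h1.matrix_det.abs.measurable).ennreal_ofReal

theorem volume_parallelepiped_le {u : Fin d → H d} (hu : ∀ i, ‖u i‖ = 1) :
    volume (parallelepiped u) ≤ ENNReal.ofReal d.factorial := by
  rw [volume_parallelepiped]
  refine ENNReal.ofReal_le_ofReal ?_
  have := Matrix.det_le (A := (Matrix.of fun i j => u i j : Matrix (Fin d) (Fin d) ℝ))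
    (abv := AbsoluteValue.abs) (x := 1) fun i j => by
      have := PiLp.norm_apply_le (u i) j
      rw [hu i] at this
      exact this
  simpa using this

/-- Linear change of variables from the normal `h` to the heights `⟪h, u i⟫`, with the volume of the
parallelepiped as Jacobian. On the cylinder this plays the role of a Blaschke–Petkantschin formula.
-/
theorem lintegral_eq_lintegral_inner {u : Fin d → H d} (hu : LinearIndependent ℝ u)
    {g : (Fin d → ℝ) → ℝ≥0∞} (hg : Measurable g) :
    (∫⁻ t, g t) = volume (parallelepiped u) * ∫⁻ h : H d, g fun i => inner ℝ h (u i) := by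
  set M : Matrix (Fin d) (Fin d) ℝ := Matrix.of fun i j => u i j with hM
  have hdet : M.det ≠ 0 :=
    ((Matrix.isUnit_iff_isUnit_det _).1 (isUnit_of_linearIndependent hu)).ne_zero
  have h1 := Real.map_matrix_volume_pi_eq_smul_volume_pi hdet
  have hlin : Measurable (Matrix.toLin' M) := (LinearMap.continuous_of_finiteDimensional _).measurable
  have h2 : ∫⁻ t, g t ∂(Measure.map (Matrix.toLin' M) volume) = ∫⁻ t, g (Matrix.toLin' M t) :=
    lintegral_map hg hlin
  rw [h1, lintegral_smul_measure, smul_eq_mul] at h2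
  have h3 : (∫⁻ h : H d, g fun i => inner ℝ h (u i)) = ∫⁻ t, g (Matrix.toLin' M t) := by
    refine Eq.trans ?_ ((PiLp.volume_preserving_ofLp (Fin d)).lintegral_comp (hg.comp hlin))
    refine lintegral_congr fun h => ?_
    refine congrArg g (funext fun i => ?_)
    simp [hM, Matrix.mulVec, dotProduct, PiLp.inner_apply]
  rw [h3, ← h2, volume_parallelepiped, ← mul_assoc, ← ENNReal.ofReal_mul (abs_nonneg _), ← abs_mul,
    mul_inv_cancel₀ hdet, abs_one, ENNReal.ofReal_one, one_mul]

end Determinant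

section Facet

variable {d : ℕ}

/-- The points over the simplex spanned by the `u i` and below the hyperplane with normal `h`. -/
def belowPlane (u : Fin d → H d) (h : H d) : Set (H d × ℝ) :=
  {z | z.1 ∈ PointedCone.hull ℝ (Set.range u) ∧ z.2 < inner ℝ h z.1}

theorem measurableSet_belowPlane_prod :
    MeasurableSet {p : ((Fin d → H d) × H d) × (H d × ℝ) | p.2 ∈ belowPlane p.1.1 p.1.2} := by
  have h1 : MeasurableSet {p : ((Fin d → H d) × H d) × (H d × ℝ) |
      p.2.1 ∈ PointedCone.hull ℝ (Set.range p.1.1)} := by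
    have hf : Measurable fun p : ((Fin d → H d) × H d) × (H d × ℝ) => (p.1.1, p.2.1) := by fun_prop
    exact hf (measurableSet_mem_hull (ι := Fin d) (V := H d))
  have h2 : MeasurableSet {p : ((Fin d → H d) × H d) × (H d × ℝ) |
      p.2.2 < inner ℝ p.1.2 p.2.1} :=
    measurableSet_lt (by fun_prop) (by fun_prop)
  exact h1.inter h2

theorem measurable_cyl_belowPlane :
    Measurable fun p : (Fin d → H d) × H d => cyl (H d) (belowPlane p.1 p.2) :=
  measurable_measure_prodMk_left measurableSet_belowPlane_prod

/-- The density of the heights, extended by zero. -/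
noncomputable def posKern (d : ℕ) : ℝ → ℝ≥0∞ :=
  (Set.Ioi 0).indicator fun t => ENNReal.ofReal (kern d t)

@[fun_prop]
theorem measurable_posKern : Measurable (posKern d) :=
  (by fun_prop : Measurable fun t => ENNReal.ofReal (kern d t)).indicator measurableSet_Ioi

theorem heights_eq : heights d = volume.withDensity (posKern d) := by
  rw [heights, posKern, withDensity_indicator measurableSet_Ioi]

instance : SigmaFinite (volume.withDensity (posKern d)) := by
  refine SigmaFinite.withDensity_of_ne_top (.of_forall fun t => ?_)
  unfold posKern
  by_cases h : t ∈ Set.Ioi (0 : ℝ)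
  · simp [Set.indicator_of_mem h]
  · simp [Set.indicator_of_notMem h]

/-- The radial part of the integral over the hyperplanes through `d` points. -/
noncomputable def radialInt (d : ℕ) (r : ℝ) : ℝ≥0∞ :=
  ∫⁻ w, (∫⁻ u, volume (parallelepiped u) * ((∏ i, posKern d (inner ℝ (r • w) (u i))) *
    cyl (H d) (belowPlane u (r • w))) ∂(Measure.pi fun _ : Fin d => sphMeasure (H d)))
      ∂sphMeasure (H d)

theorem ae_linearIndependent (hd : 0 < d) :
    ∀ᵐ u ∂(Measure.pi fun _ : Fin d => sphMeasure (H d)), LinearIndependent ℝ u := by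
  have hn : Nontrivial (H d) := Module.nontrivial_of_finrank_pos (R := ℝ) (by simpa using hd)
  filter_upwards [ae_pi_notMem_span (n := d) (ν := sphMeasure (H d)) (measurable_id (α := H d))
    fun S hS => sphMeasure_submodule S hS] with u hu
  rw [Fintype.linearIndependent_iff]
  intro c hc i
  have hc' := eq_zero_of_notMem_span (k := d)
    (fun i S hi hS => hu i S hi (by simpa using hS)) c Finset.univ (by simp) (by simp) hc
  rw [hc']
  rfl

theorem lintegral_pi_prod_withDensity {α : Type*} [MeasurableSpace α] {n : ℕ} (σ : Measure α)
    [SigmaFinite σ] {f : ℝ → ℝ≥0∞} (hf : Measurable f) [SigmaFinite (volume.withDensity f)]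
    {Φ : (Fin n → α × ℝ) → ℝ≥0∞} (hΦ : Measurable Φ) :
    ∫⁻ y, Φ y ∂(Measure.pi fun _ : Fin n => σ.prod (volume.withDensity f)) =
      ∫⁻ u, (∫⁻ t : Fin n → ℝ, (∏ i, f (t i)) * Φ fun i => (u i, t i))
        ∂(Measure.pi fun _ : Fin n => σ) := by
  have hmp := (measurePreserving_arrowProdEquivProdArrow α ℝ (Fin n)
    (fun _ => σ) (fun _ => volume.withDensity f)).symm
  rw [← hmp.lintegral_comp hΦ]
  refine (lintegral_prod _ (hΦ.comp hmp.measurable).aemeasurable).trans ?_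
  refine lintegral_congr fun u => ?_
  have hΦu : Measurable fun t : Fin n → ℝ => Φ fun i => (u i, t i) := by
    refine hΦ.comp ?_
    fun_prop
  have hpm : Measurable fun t : Fin n → ℝ => ∏ i, f (t i) :=
    Finset.measurable_prod _ fun i _ => hf.comp (measurable_pi_apply i)
  rw [pi_withDensity _ hf]
  exact lintegral_withDensity_eq_lintegral_mul _ hpm hΦu

theorem measurable_facet_integrand (k : ℕ) : Measurable fun y : Fin d → H d × ℝ =>
    cyl (H d) (below y) * ENNReal.ofReal (1 - Real.arctan ‖normalVec y‖ / Real.pi) ^ k := by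
  have h1 : Measurable fun y : Fin d → H d × ℝ => cyl (H d) (below y) :=
    measurable_measure_prodMk_left measurableSet_below_prod
  have h2 : Measurable fun y : Fin d → H d × ℝ => Real.arctan ‖normalVec y‖ :=
    Real.measurable_arctan.comp (measurable_normalVec (d := d)).norm
  have h3 : Measurable fun y : Fin d → H d × ℝ =>
      ENNReal.ofReal (1 - Real.arctan ‖normalVec y‖ / Real.pi) ^ k := by fun_prop
  exact h1.mul h3

/-- For fixed directions `u`, almost surely a basis, the heights of the `d` points are exchanged for
the normal `h` of the hyperplane through them; `normalVec` then returns `h` itself. -/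
theorem facetInt_eq_lintegral_plane (hd : 2 ≤ d) (k : ℕ) :
    facetInt d k = ENNReal.ofReal (2 / omega (d + 1)) ^ d *
      ∫⁻ u, volume (parallelepiped u) * (∫⁻ h : H d, (∏ i, posKern d (inner ℝ h (u i))) *
        (cyl (H d) (belowPlane u h) * ENNReal.ofReal (1 - Real.arctan ‖h‖ / Real.pi) ^ k))
          ∂(Measure.pi fun _ : Fin d => sphMeasure (H d)) := by
  have hn : Nontrivial (H d) := Module.nontrivial_of_finrank_pos (R := ℝ) (by simp; omega)
  have hfin : Module.finrank ℝ (H d) = d := by simp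
  have hΦm := measurable_facet_integrand (d := d) k
  have hcyl : cyl (H d) = (sphMeasure (H d)).prod (volume.withDensity (posKern d)) := by
    rw [cyl, heights_eq, hfin]
  have hpi : Measure.pi (fun _ : Fin d => cyl (H d)) = Measure.pi fun _ : Fin d =>
      (sphMeasure (H d)).prod (volume.withDensity (posKern d)) := by rw [hcyl]
  rw [facetInt, cylProb, hfin, pi_const_smul _ ENNReal.ofReal_ne_top, lintegral_smul_measure,
    smul_eq_mul, hpi, lintegral_pi_prod_withDensity _ measurable_posKern hΦm]
  congr 1
  apply lintegral_congr_ae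
  filter_upwards [ae_linearIndependent (d := d) (by omega)] with u hu
  have hpm : Measurable fun t : Fin d → ℝ => ∏ i, posKern d (t i) :=
    Finset.measurable_prod _ fun i _ => measurable_posKern.comp (measurable_pi_apply i)
  have hg := hpm.mul (hΦm.comp (g := fun y : Fin d → H d × ℝ => cyl (H d) (below y) *
    ENNReal.ofReal (1 - Real.arctan ‖normalVec y‖ / Real.pi) ^ k)
    (f := fun t : Fin d → ℝ => fun i => (u i, t i)) (by fun_prop))
  refine (lintegral_eq_lintegral_inner hu hg).trans ?_
  congr 1
  refine lintegral_congr fun h => ?_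
  have hnv : normalVec (fun i => (u i, inner ℝ h (u i))) = h := (eq_normalVec hu fun i => rfl).symm
  have hb : below (fun i => (u i, inner ℝ h (u i))) = belowPlane u h := by
    simp only [below, belowPlane, hnv]
  change (∏ i, posKern d (inner ℝ h (u i))) * (cyl (H d) (below fun i => (u i, inner ℝ h (u i))) *
    ENNReal.ofReal (1 - Real.arctan ‖normalVec fun i => (u i, inner ℝ h (u i))‖ / Real.pi) ^ k) = _
  rw [hnv, hb]

theorem lintegral_prod_polar {α V : Type*} [MeasurableSpace α] {ρ : Measure α} [SFinite ρ]
    [NormedAddCommGroup V] [InnerProductSpace ℝ V] [FiniteDimensional ℝ V] [MeasurableSpace V]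
    [BorelSpace V] [Nontrivial V] {Ψ : α × V → ℝ≥0∞} (hΨ : Measurable Ψ) {A : ℝ → ℝ≥0∞}
    (hA : Measurable A) :
    ∫⁻ u, (∫⁻ h : V, Ψ (u, h) * A ‖h‖) ∂ρ = ∫⁻ r in Set.Ioi (0 : ℝ),
      ENNReal.ofReal (r ^ (Module.finrank ℝ V - 1)) * A r *
        ∫⁻ w, (∫⁻ u, Ψ (u, r • w) ∂ρ) ∂sphMeasure V := by
  have hm : Measurable fun p : α × V => Ψ p * A ‖p.2‖ :=
    hΨ.mul (hA.comp measurable_snd.norm)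
  rw [lintegral_lintegral_swap (f := fun u h => Ψ (u, h) * A ‖h‖) hm.aemeasurable]
  have e2 : ∀ h : V, ∫⁻ u, Ψ (u, h) * A ‖h‖ ∂ρ = (∫⁻ u, Ψ (u, h) ∂ρ) * A ‖h‖ := fun h =>
    lintegral_mul_const _ (hΨ.comp measurable_prodMk_right)
  simp only [e2]
  set Θ : V → ℝ≥0∞ := fun h => ∫⁻ u, Ψ (u, h) ∂ρ with hΘ
  have hΘm : Measurable Θ := hΨ.lintegral_prod_left'
  have hm3 : Measurable fun h : V => Θ h * A ‖h‖ := hΘm.mul (hA.comp measurable_norm)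
  change (∫⁻ h : V, Θ h * A ‖h‖) = _
  rw [lintegral_polar hm3]
  have hm2 : Measurable fun p : V × ℝ =>
      ENNReal.ofReal (p.2 ^ (Module.finrank ℝ V - 1)) * (Θ (p.2 • p.1) * A ‖p.2 • p.1‖) := by
    have h1 : Measurable fun p : V × ℝ => p.2 • p.1 := by fun_prop
    exact (by fun_prop : Measurable fun p : V × ℝ =>
      ENNReal.ofReal (p.2 ^ (Module.finrank ℝ V - 1))).mul
      ((hΘm.comp h1).mul (hA.comp h1.norm))
  rw [lintegral_lintegral_swap (f := fun u r =>
    ENNReal.ofReal (r ^ (Module.finrank ℝ V - 1)) * (Θ (r • u) * A ‖r • u‖)) hm2.aemeasurable]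
  refine setLIntegral_congr_fun measurableSet_Ioi fun r hr => ?_
  simp only [Set.mem_Ioi] at hr
  have hΘr : Measurable fun w : V => Θ (r • w) := hΘm.comp (measurable_const_smul r)
  change _ = _ * ∫⁻ w, Θ (r • w) ∂sphMeasure V
  rw [← lintegral_const_mul _ hΘr]
  apply lintegral_congr_ae
  filter_upwards [ae_sphMeasure_norm (V := V)] with w hw
  rw [norm_smul, hw, mul_one, Real.norm_eq_abs, abs_of_pos hr]
  ring

/-- The integrand over the hyperplanes with normal `p.2` through points over the `p.1 i`. -/
noncomputable def planeDensity (p : (Fin d → H d) × H d) : ℝ≥0∞ :=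
  volume (parallelepiped p.1) *
    ((∏ i, posKern d (inner ℝ p.2 (p.1 i))) * cyl (H d) (belowPlane p.1 p.2))

theorem measurable_planeDensity : Measurable (planeDensity (d := d)) := by
  refine Measurable.mul (measurable_volume_parallelepiped.comp measurable_fst)
    (Measurable.mul ?_ measurable_cyl_belowPlane)
  refine Finset.measurable_prod _ fun i _ => measurable_posKern.comp ?_
  fun_prop

theorem radialInt_eq (r : ℝ) : radialInt d r = ∫⁻ w, (∫⁻ u, planeDensity (u, r • w)
    ∂(Measure.pi fun _ : Fin d => sphMeasure (H d))) ∂sphMeasure (H d) := rfl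

theorem lintegral_planeDensity_mul (u : Fin d → H d) {A : ℝ → ℝ≥0∞} (hA : Measurable A) :
    volume (parallelepiped u) * (∫⁻ h : H d, (∏ i, posKern d (inner ℝ h (u i))) *
      (cyl (H d) (belowPlane u h) * A ‖h‖)) = ∫⁻ h : H d, planeDensity (u, h) * A ‖h‖ := by
  have h1 : Measurable fun h : H d => cyl (H d) (belowPlane u h) :=
    measurable_cyl_belowPlane.comp (g := fun p : (Fin d → H d) × H d =>
      cyl (H d) (belowPlane p.1 p.2)) (f := fun h => (u, h)) measurable_prodMk_left
  have h2 : Measurable fun h : H d => ∏ i, posKern d (inner ℝ h (u i)) :=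
    Finset.measurable_prod _ fun i _ => measurable_posKern.comp
      (measurable_id.inner measurable_const)
  have h3 : Measurable fun h : H d => (∏ i, posKern d (inner ℝ h (u i))) *
      (cyl (H d) (belowPlane u h) * A ‖h‖) := h2.mul (h1.mul (hA.comp measurable_norm))
  refine (lintegral_const_mul _ h3).symm.trans (lintegral_congr fun h => ?_)
  simp only [planeDensity, mul_assoc]

/-- Polar coordinates `h = r w`. The factor with exponent `k` depends on `r` alone, so all
dependence on the number of points is isolated in a one-dimensional integral. -/
theorem facetInt_eq (hd : 2 ≤ d) (k : ℕ) :
    facetInt d k = ENNReal.ofReal (2 / omega (d + 1)) ^ d *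
      ∫⁻ r in Set.Ioi (0 : ℝ), ENNReal.ofReal (r ^ (d - 1)) *
        ENNReal.ofReal (1 - Real.arctan r / Real.pi) ^ k * radialInt d r := by
  have hn : Nontrivial (H d) := Module.nontrivial_of_finrank_pos (R := ℝ) (by simp; omega)
  have hfin : Module.finrank ℝ (H d) = d := by simp
  have hAm : Measurable fun r : ℝ => ENNReal.ofReal (1 - Real.arctan r / Real.pi) ^ k := by
    have hmA : Measurable fun r : ℝ => Real.arctan r := Real.measurable_arctan
    fun_prop
  have key := lintegral_prod_polar (ρ := Measure.pi fun _ : Fin d => sphMeasure (H d))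
    measurable_planeDensity hAm
  rw [hfin] at key
  rw [facetInt_eq_lintegral_plane hd, lintegral_congr fun u => lintegral_planeDensity_mul u hAm, key]
  rfl

end Facet

end SphPoly

namespace SphPoly

/-! ### The constant `C(d)`: convergence and invariance. -/

section Weight

variable {V W : Type*} [NormedAddCommGroup V] [InnerProductSpace ℝ V] [FiniteDimensional ℝ V]
  [MeasurableSpace V] [BorelSpace V] [NormedAddCommGroup W] [InnerProductSpace ℝ W]
  [FiniteDimensional ℝ W] [MeasurableSpace W] [BorelSpace W] {d : ℕ}

theorem measurableSet_hull_range (u : Fin d → V) :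
    MeasurableSet {v : V | v ∈ PointedCone.hull ℝ (Set.range u)} :=
  measurable_prodMk_left (measurableSet_mem_hull (ι := Fin d) (V := V))

theorem inner_nonneg_of_mem_hull {u : Fin d → V} {w v : V} (hu : ∀ i, 0 ≤ inner ℝ w (u i))
    (hv : v ∈ PointedCone.hull ℝ (Set.range u)) : 0 ≤ inner ℝ w v := by
  obtain ⟨c, hc, rfl⟩ := mem_hull_range.1 hv
  rw [inner_sum]
  refine Finset.sum_nonneg fun i _ => ?_
  rw [inner_smul_right]
  exact mul_nonneg (hc i) (hu i)

theorem convS_range_ae_eq (u : Fin d → V) :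
    convS (Set.range u) =ᵐ[sphMeasure V] {v : V | v ∈ PointedCone.hull ℝ (Set.range u)} := by
  filter_upwards [ae_sphMeasure_norm (V := V)] with v hv
  refine propext ⟨fun h => h.2, fun h => ⟨by simpa using hv, h⟩⟩

/-- The boundary is null, so the open condition may be used; it matches the indicator in `posKern`.
-/
theorem restrict_halfSphere_eq {w : V} (hw : w ≠ 0) :
    (sphMeasure V).restrict (halfSphere w) =
      (sphMeasure V).withDensity fun x => (Set.Ioi (0 : ℝ)).indicator 1 (inner ℝ w x) := by
  have hs : MeasurableSet {x : V | 0 < inner ℝ w x} :=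
    measurableSet_lt measurable_const (by fun_prop)
  have h1 : (fun x : V => (Set.Ioi (0 : ℝ)).indicator (1 : ℝ → ℝ≥0∞) (inner ℝ w x)) =
      {x : V | 0 < inner ℝ w x}.indicator 1 := rfl
  rw [h1, withDensity_indicator_one hs]
  refine Measure.restrict_congr_set ?_
  have h0 := sphMeasure_inner_eq_zero hw
  rw [measure_eq_zero_iff_ae_notMem] at h0
  filter_upwards [ae_sphMeasure_norm (V := V), h0] with v hv hv0
  have hv0' : inner ℝ v w ≠ 0 := hv0
  refine propext ⟨fun h => ?_, fun h => ⟨by simpa using hv, ?_⟩⟩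
  · have h2 : 0 ≤ inner ℝ v w := h.2
    change 0 < inner ℝ w v
    rw [real_inner_comm]
    exact lt_of_le_of_ne h2 hv0'.symm
  · have h2 : 0 < inner ℝ w v := h
    rw [real_inner_comm] at h2
    exact h2.le

theorem lintegral_halfPow {w : V} (hw : w ≠ 0) {Φ : (Fin d → V) → ℝ≥0∞} (hΦ : Measurable Φ) :
    ∫⁻ u, Φ u ∂halfPow d w = ∫⁻ u, (∏ i, (Set.Ioi (0 : ℝ)).indicator 1 (inner ℝ w (u i))) * Φ u
      ∂(Measure.pi fun _ : Fin d => sphMeasure V) := by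
  have hf : Measurable fun x : V => (Set.Ioi (0 : ℝ)).indicator (1 : ℝ → ℝ≥0∞) (inner ℝ w x) :=
    (measurable_one.indicator measurableSet_Ioi).comp (by fun_prop)
  have hfin : SigmaFinite ((sphMeasure V).withDensity fun x =>
      (Set.Ioi (0 : ℝ)).indicator (1 : ℝ → ℝ≥0∞) (inner ℝ w x)) := by
    rw [← restrict_halfSphere_eq hw]; infer_instance
  have hp : Measurable fun u : Fin d → V =>
      ∏ i, (Set.Ioi (0 : ℝ)).indicator (1 : ℝ → ℝ≥0∞) (inner ℝ w (u i)) :=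
    Finset.measurable_prod _ fun i _ => hf.comp (measurable_pi_apply i)
  rw [halfPow, restrict_halfSphere_eq hw, pi_withDensity _ hf]
  exact lintegral_withDensity_eq_lintegral_mul _ hp hΦ

/-- The integral of the height `⟨w, ·⟩` over a spherical simplex, weighted by the volume of the
parallelepiped. -/
noncomputable def simplexInt (w : V) (u : Fin d → V) : ℝ≥0∞ :=
  volume (parallelepiped u) *
    ∫⁻ v in {v : V | v ∈ PointedCone.hull ℝ (Set.range u)}, ENNReal.ofReal (inner ℝ w v)
      ∂sphMeasure V

theorem volume_parallelepiped_lt_top (u : Fin d → V) :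
    (volume : Measure V) (parallelepiped u) < ⊤ := by
  have h : IsCompact (parallelepiped u) := by
    have : IsCompact (Set.Icc (0 : Fin d → ℝ) 1) := isCompact_Icc
    exact this.image (by fun_prop)
  exact h.measure_lt_top

theorem integrable_inner_sphMeasure (w : V) :
    Integrable (fun x => inner ℝ x w) (sphMeasure V) := by
  refine Integrable.of_bound (C := ‖w‖) (by fun_prop) ?_
  filter_upwards [ae_sphMeasure_norm (V := V)] with x hx
  simpa [hx] using norm_inner_le_norm (𝕜 := ℝ) x w

/-- The hull of points of a half-space stays in it, so the height `⟨x, ē⟩` is nonnegative over the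
simplex and the Bochner integral equals the Lebesgue integral. -/
theorem ofReal_weight {w : V} {u : Fin d → V} (hu : ∀ i, 0 ≤ inner ℝ w (u i)) :
    ENNReal.ofReal (weight d w u) = simplexInt w u := by
  have hm := measurableSet_hull_range u
  rw [weight, ENNReal.ofReal_mul measureReal_nonneg, simplexInt, Measure.real,
    ENNReal.ofReal_toReal (volume_parallelepiped_lt_top u).ne,
    Measure.restrict_congr_set (convS_range_ae_eq u),
    ofReal_integral_eq_lintegral_ofReal (integrable_inner_sphMeasure w).integrableOn]
  · simp only [real_inner_comm]
  · filter_upwards [ae_restrict_mem hm] with v hv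
    rw [Pi.zero_apply, real_inner_comm]
    exact inner_nonneg_of_mem_hull hu hv

theorem weight_nonneg {w : V} {u : Fin d → V} (hu : ∀ i, 0 ≤ inner ℝ w (u i)) :
    0 ≤ weight d w u := by
  have hm := measurableSet_hull_range u
  refine mul_nonneg measureReal_nonneg ?_
  rw [Measure.restrict_congr_set (convS_range_ae_eq u)]
  refine setIntegral_nonneg hm fun v hv => ?_
  rw [real_inner_comm]
  exact inner_nonneg_of_mem_hull hu hv

theorem ae_halfPow_nonneg (w : V) : ∀ᵐ u ∂halfPow d w, ∀ i, 0 ≤ inner ℝ w (u i) := by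
  rw [ae_all_iff]
  intro i
  refine (Measure.quasiMeasurePreserving_eval
    (fun _ : Fin d => (sphMeasure V).restrict (halfSphere w)) i).ae (p := fun x => 0 ≤ inner ℝ w x) ?_
  filter_upwards [ae_restrict_mem (measurableSet_halfSphere w)] with x hx
  rw [real_inner_comm]
  exact hx.2

theorem weight_map (φ : V ≃ₗᵢ[ℝ] W) (w : V) (u : Fin d → V) :
    weight d (φ w) (fun i => φ (u i)) = weight d w u := by
  have hφ : MeasurableEmbedding φ := φ.toHomeomorph.measurableEmbedding
  unfold weight
  congr 1
  · have h1 : parallelepiped (fun i => φ (u i)) = φ '' parallelepiped u := by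
      have := image_parallelepiped φ.toLinearEquiv.toLinearMap u
      exact this.symm
    rw [h1, Measure.real, Measure.real]
    congr 1
    have h2 := φ.measurePreserving
    rw [← h2.measure_preimage_emb hφ, Set.preimage_image_eq _ φ.injective]
  · rw [Measure.restrict_congr_set (convS_range_ae_eq _),
      Measure.restrict_congr_set (convS_range_ae_eq _), ← map_sphMeasure φ,
      hφ.setIntegral_map]
    have h3 : φ ⁻¹' {v : W | v ∈ PointedCone.hull ℝ (Set.range fun i => φ (u i))} =
        {v : V | v ∈ PointedCone.hull ℝ (Set.range u)} := by
      ext v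
      exact map_mem_hull_range_iff φ.toLinearEquiv
    rw [h3]
    simp only [φ.inner_map_map]

theorem measurePreserving_halfPow (φ : V ≃ₗᵢ[ℝ] W) (w : V) :
    MeasurePreserving (fun (u : Fin d → V) i => φ (u i)) (halfPow d w) (halfPow d (φ w)) := by
  unfold halfPow
  refine measurePreserving_pi _ _ fun _ => ?_
  have h1 : MeasurePreserving φ (sphMeasure V) (sphMeasure W) :=
    ⟨φ.continuous.measurable, map_sphMeasure φ⟩
  have h2 := h1.restrict_preimage (measurableSet_halfSphere (φ w))
  have h3 : φ ⁻¹' halfSphere (φ w) = halfSphere w := by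
    ext v
    simp [halfSphere]
  rwa [h3] at h2

theorem measurableEmbedding_pi_map (φ : V ≃ₗᵢ[ℝ] W) :
    MeasurableEmbedding (fun (u : Fin d → V) i => φ (u i)) :=
  (MeasurableEquiv.piCongrRight fun _ : Fin d => φ.toHomeomorph.toMeasurableEquiv).measurableEmbedding

theorem integrable_weight_map_iff (φ : V ≃ₗᵢ[ℝ] W) (w : V) :
    Integrable (weight d (φ w)) (halfPow d (φ w)) ↔ Integrable (weight d w) (halfPow d w) := by
  rw [← (measurePreserving_halfPow φ w).integrable_comp_emb (measurableEmbedding_pi_map φ)]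
  refine integrable_congr (.of_forall fun u => weight_map φ w u)

theorem integral_weight_map (φ : V ≃ₗᵢ[ℝ] W) (w : V) :
    ∫ u, weight d (φ w) u ∂halfPow d (φ w) = ∫ u, weight d w u ∂halfPow d w := by
  rw [← (measurePreserving_halfPow φ w).integral_comp (measurableEmbedding_pi_map φ)]
  exact integral_congr_ae (.of_forall fun u => weight_map φ w u)

end Weight

section WeightCoord

variable {d : ℕ}

theorem measurable_simplexInt : Measurable fun p : H d × (Fin d → H d) => simplexInt p.1 p.2 := by
  unfold simplexInt
  refine Measurable.mul (measurable_volume_parallelepiped.comp measurable_snd) ?_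
  have hs : MeasurableSet {q : (H d × (Fin d → H d)) × H d |
      q.2 ∈ PointedCone.hull ℝ (Set.range q.1.2)} := by
    have hf : Measurable fun q : (H d × (Fin d → H d)) × H d => (q.1.2, q.2) := by fun_prop
    exact hf (measurableSet_mem_hull (ι := Fin d) (V := H d))
  have hg : Measurable fun q : (H d × (Fin d → H d)) × H d =>
      {q : (H d × (Fin d → H d)) × H d |
        q.2 ∈ PointedCone.hull ℝ (Set.range q.1.2)}.indicator
        (fun q => ENNReal.ofReal (inner ℝ q.1.1 q.2)) q :=
    Measurable.indicator (by fun_prop) hs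
  have h := hg.lintegral_prod_right' (ν := sphMeasure (H d))
  convert! h using 2 with p
  rw [← lintegral_indicator (measurableSet_hull_range p.2)]
  rfl

theorem measurable_weight (w : H d) : Measurable (weight d w) := by
  unfold weight
  refine Measurable.mul (measurable_volume_parallelepiped.ennreal_toReal) ?_
  have hs : MeasurableSet {q : (Fin d → H d) × H d | q.2 ∈ PointedCone.hull ℝ (Set.range q.1)} :=
    measurableSet_mem_hull (ι := Fin d) (V := H d)
  have hg : StronglyMeasurable fun q : (Fin d → H d) × H d =>
      {q : (Fin d → H d) × H d | q.2 ∈ PointedCone.hull ℝ (Set.range q.1)}.indicator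
        (fun q => inner ℝ q.2 w) q :=
    (Measurable.indicator (by fun_prop) hs).stronglyMeasurable
  have h := (hg.integral_prod_right' (ν := sphMeasure (H d))).measurable
  convert! h using 2 with u
  rw [Measure.restrict_congr_set (convS_range_ae_eq _),
    ← integral_indicator (measurableSet_hull_range u)]
  rfl

theorem simplexInt_le {w : H d} (hw : ‖w‖ = 1) {u : Fin d → H d} (hu : ∀ i, ‖u i‖ = 1) :
    simplexInt w u ≤ ENNReal.ofReal d.factorial * sphMeasure (H d) Set.univ := by
  refine mul_le_mul' (volume_parallelepiped_le hu) ((setLIntegral_le_lintegral _ _).trans ?_)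
  rw [← lintegral_one]
  apply lintegral_mono_ae
  filter_upwards [ae_sphMeasure_norm (V := H d)] with v hv
  rw [ENNReal.ofReal_le_one]
  have := real_inner_le_norm w v
  simpa [hw, hv] using this

theorem ae_halfPow_norm (w : H d) : ∀ᵐ u ∂halfPow d w, ∀ i, ‖u i‖ = 1 := by
  rw [ae_all_iff]
  intro i
  exact (Measure.quasiMeasurePreserving_eval
    (fun _ : Fin d => (sphMeasure (H d)).restrict (halfSphere w)) i).ae
      (p := fun x => ‖x‖ = 1) (ae_restrict_of_ae ae_sphMeasure_norm)

/-- The weight is bounded on a finite measure space: the determinant of `d` unit vectors is at most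
`d!`, and the height at most `1`. -/
theorem integrable_weight_coord {w : H d} (hw : ‖w‖ = 1) :
    Integrable (weight d w) (halfPow d w) := by
  have : IsFiniteMeasure (halfPow d w) := by unfold halfPow; infer_instance
  refine Integrable.of_bound (C := (ENNReal.ofReal d.factorial *
    sphMeasure (H d) Set.univ).toReal) (measurable_weight w).aestronglyMeasurable ?_
  filter_upwards [ae_halfPow_nonneg w, ae_halfPow_norm w] with u hu hun
  rw [Real.norm_of_nonneg (weight_nonneg hu), ← ENNReal.ofReal_le_iff_le_toReal
    (ENNReal.mul_ne_top ENNReal.ofReal_ne_top (measure_ne_top _ _)), ofReal_weight hu]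
  exact simplexInt_le hw hun

theorem measurable_simplexInt_right (w : H d) : Measurable (simplexInt (d := d) w) :=
  Measurable.comp (g := fun p : H d × (Fin d → H d) => simplexInt p.1 p.2) (f := fun u => (w, u))
    measurable_simplexInt measurable_prodMk_left

theorem lintegral_ofReal_weight {w : H d} (hw : ‖w‖ = 1) :
    ∫⁻ u, simplexInt w u ∂halfPow d w = ENNReal.ofReal (∫ u, weight d w u ∂halfPow d w) := by
  rw [ofReal_integral_eq_lintegral_ofReal (integrable_weight_coord hw)
      ((ae_halfPow_nonneg w).mono fun u hu => weight_nonneg hu)]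
  exact lintegral_congr_ae ((ae_halfPow_nonneg w).mono fun u hu => (ofReal_weight hu).symm)

theorem lintegral_simplexInt {w : H d} (hw : ‖w‖ = 1) :
    ∫⁻ u, (∏ i, (Set.Ioi (0 : ℝ)).indicator 1 (inner ℝ w (u i))) * simplexInt w u
      ∂(Measure.pi fun _ : Fin d => sphMeasure (H d)) =
    ENNReal.ofReal (∫ u, weight d w u ∂halfPow d w) := by
  have hw0 : w ≠ 0 := by
    rintro rfl; simp at hw
  exact (lintegral_halfPow hw0 (measurable_simplexInt_right w)).symm.trans
    (lintegral_ofReal_weight hw)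

open Classical in
/-- The common value of the integrals of the weights. -/
noncomputable def weightConst (d : ℕ) : ℝ :=
  if h : ∃ w : H d, ‖w‖ = 1 then ∫ u, weight d h.choose u ∂halfPow d h.choose else 0

/-- An isometry onto `H d` carries `w` to the reference vector of `weightConst`, and weights and
measures are invariant under isometries. This gives the independence of `C(d)` from `e` and `ē`. -/
theorem integrable_weight_and_integral_eq {V : Type*} [NormedAddCommGroup V]
    [InnerProductSpace ℝ V] [FiniteDimensional ℝ V] [MeasurableSpace V] [BorelSpace V]
    (hd : 0 < d) (hV : Module.finrank ℝ V = d) {w : V} (hw : ‖w‖ = 1) :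
    Integrable (weight d w) (halfPow d w) ∧ ∫ u, weight d w u ∂halfPow d w = weightConst d := by
  have hn : Nontrivial (H d) := Module.nontrivial_of_finrank_pos (R := ℝ) (by simpa using hd)
  have hex : ∃ w : H d, ‖w‖ = 1 := exists_norm_eq (H d) zero_le_one
  obtain ⟨φ, hφ⟩ := exists_linearIsometryEquiv_map_eq (V := V) (W := H d) (by simp [hV]) hw
    hex.choose_spec
  constructor
  · rw [← integrable_weight_map_iff φ, hφ]
    exact integrable_weight_coord hex.choose_spec
  · rw [← integral_weight_map φ, hφ, weightConst, dif_pos hex]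

theorem weightConst_nonneg : 0 ≤ weightConst d := by
  unfold weightConst
  split_ifs with h
  · exact integral_nonneg_of_ae ((ae_halfPow_nonneg _).mono fun u hu => weight_nonneg hu)
  · exact le_rfl

theorem lintegral_lintegral_simplexInt (hd : 0 < d) :
    ∫⁻ w, (∫⁻ u, (∏ i, (Set.Ioi (0 : ℝ)).indicator 1 (inner ℝ w (u i))) * simplexInt w u
      ∂(Measure.pi fun _ : Fin d => sphMeasure (H d))) ∂sphMeasure (H d) =
    ENNReal.ofReal (omega d * weightConst d) := by
  have hn : Nontrivial (H d) := Module.nontrivial_of_finrank_pos (R := ℝ) (by simpa using hd)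
  have h : ∀ᵐ w ∂sphMeasure (H d),
      ∫⁻ u, (∏ i, (Set.Ioi (0 : ℝ)).indicator 1 (inner ℝ w (u i))) * simplexInt w u
        ∂(Measure.pi fun _ : Fin d => sphMeasure (H d)) = ENNReal.ofReal (weightConst d) := by
    filter_upwards [ae_sphMeasure_norm (V := H d)] with w hw
    rw [lintegral_simplexInt hw, (integrable_weight_and_integral_eq hd (by simp) hw).2]
  rw [lintegral_congr_ae h, lintegral_const, sphMeasure_univ, mul_comm,
    ENNReal.ofReal_mul (omega_pos hd).le]
  simp

end WeightCoord

end SphPoly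

namespace SphPoly

/-! ### The radial integrand near zero. -/

theorem lintegral_lintegral_const_mul {α β : Type*} [MeasurableSpace α] [MeasurableSpace β]
    {μ : Measure α} {ν : Measure β} [SFinite ν] {f : α → β → ℝ≥0∞}
    (hf : Measurable fun p : α × β => f p.1 p.2) (c : ℝ≥0∞) :
    ∫⁻ x, (∫⁻ y, c * f x y ∂ν) ∂μ = c * ∫⁻ x, (∫⁻ y, f x y ∂ν) ∂μ := by
  have h1 : ∀ x, ∫⁻ y, c * f x y ∂ν = c * ∫⁻ y, f x y ∂ν := fun x =>
    lintegral_const_mul _ (hf.comp (measurable_prodMk_left (x := x)))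
  rw [lintegral_congr h1, lintegral_const_mul _ hf.lintegral_prod_right']

section RadialBounds

variable {d : ℕ}

theorem kern_le_one (d : ℕ) (t : ℝ) : kern d t ≤ 1 := by
  unfold kern
  refine inv_le_one_of_one_le₀ (one_le_pow₀ ?_)
  rw [Real.one_le_sqrt]
  nlinarith [sq_nonneg t]

/-- `(1 + t²)^(-1/2) ≥ (1 + t²)⁻¹ ≥ 1 - t²`, and Bernoulli's inequality handles the power `d + 1`.
-/
theorem one_sub_le_kern (d : ℕ) {r t : ℝ} (ht : 0 ≤ t) (htr : t ≤ r) :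
    1 - (d + 1) * r ^ 2 ≤ kern d t := by
  have h0 : 0 < √(1 + t ^ 2) := by positivity
  have h1 : (1 + t ^ 2)⁻¹ ≤ (√(1 + t ^ 2))⁻¹ := by
    refine inv_anti₀ h0 ?_
    rw [Real.sqrt_le_left (by positivity)]
    nlinarith [sq_nonneg t]
  have h2 : 1 - t ^ 2 ≤ (1 + t ^ 2)⁻¹ := by
    rw [← one_div, le_div_iff₀ (by positivity)]
    nlinarith [sq_nonneg (t ^ 2)]
  have h3 := one_add_mul_le_pow (a := (√(1 + t ^ 2))⁻¹ - 1) (by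
    have := inv_pos.2 h0; linarith) (d + 1)
  have h4 : kern d t = (1 + ((√(1 + t ^ 2))⁻¹ - 1)) ^ (d + 1) := by
    rw [kern, ← inv_pow]; congr 1; ring
  rw [h4]
  refine le_trans ?_ h3
  push_cast
  have h5 : t ^ 2 ≤ r ^ 2 := pow_le_pow_left₀ ht htr 2
  have hd : (0 : ℝ) ≤ d := by positivity
  nlinarith

theorem posKern_le (t : ℝ) : posKern d t ≤ (Set.Ioi (0 : ℝ)).indicator 1 t := by
  unfold posKern
  refine Set.indicator_le_indicator ?_
  simpa using kern_le_one d t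

theorem mul_indicator_le_posKern {r t : ℝ} (htr : t ≤ r) :
    ENNReal.ofReal (1 - (d + 1) * r ^ 2) * (Set.Ioi (0 : ℝ)).indicator 1 t ≤ posKern d t := by
  unfold posKern
  by_cases h : 0 < t
  · rw [Set.indicator_of_mem (by simpa using h), Set.indicator_of_mem (by simpa using h)]
    simpa using ENNReal.ofReal_le_ofReal (one_sub_le_kern d h.le htr)
  · rw [Set.indicator_of_notMem (by simpa using h)]
    simp

theorem heights_Iio (s : ℝ) :
    heights d (Set.Iio s) = ∫⁻ t in Set.Ioo 0 s, ENNReal.ofReal (kern d t) := by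
  rw [heights, withDensity_apply _ measurableSet_Iio, Measure.restrict_restrict measurableSet_Iio]
  congr 2
  ext t
  simp [and_comm]

theorem heights_Iio_le (s : ℝ) : heights d (Set.Iio s) ≤ ENNReal.ofReal s := by
  rw [heights_Iio]
  calc ∫⁻ t in Set.Ioo 0 s, ENNReal.ofReal (kern d t) ≤ ∫⁻ t in Set.Ioo 0 s, 1 :=
        lintegral_mono fun t => by simpa using kern_le_one d t
    _ = ENNReal.ofReal s := by simp

theorem le_heights_Iio {r s : ℝ} (hsr : s ≤ r) :
    ENNReal.ofReal (1 - (d + 1) * r ^ 2) * ENNReal.ofReal s ≤ heights d (Set.Iio s) := by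
  rw [heights_Iio]
  calc _ = ∫⁻ t in Set.Ioo 0 s, ENNReal.ofReal (1 - (d + 1) * r ^ 2) := by simp
    _ ≤ _ := setLIntegral_mono (by fun_prop) fun t ht =>
        ENNReal.ofReal_le_ofReal (one_sub_le_kern d ht.1.le (ht.2.le.trans hsr))

theorem cyl_belowPlane (u : Fin d → H d) (h : H d) :
    cyl (H d) (belowPlane u h) = ∫⁻ v in {v : H d | v ∈ PointedCone.hull ℝ (Set.range u)},
      heights d (Set.Iio (inner ℝ h v)) ∂sphMeasure (H d) := by
  have hm : MeasurableSet (belowPlane u h) :=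
    measurable_prodMk_left (x := (u, h)) measurableSet_belowPlane_prod
  have hfin : Module.finrank ℝ (H d) = d := by simp
  rw [cyl, Measure.prod_apply hm, hfin, ← lintegral_indicator (measurableSet_hull_range u)]
  refine lintegral_congr fun v => ?_
  by_cases hv : v ∈ PointedCone.hull ℝ (Set.range u)
  · rw [Set.indicator_of_mem (by exact hv)]
    congr 1
    ext t
    exact ⟨fun ht => ht.2, fun ht => ⟨hv, ht⟩⟩
  · rw [Set.indicator_of_notMem (by exact hv)]
    have : Prod.mk v ⁻¹' belowPlane u h = ∅ := by
      ext t
      exact ⟨fun ht => (hv ht.1).elim, fun ht => ht.elim⟩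
    rw [this, measure_empty]

theorem indicator_Ioi_mul {r : ℝ} (hr : 0 < r) (t : ℝ) :
    (Set.Ioi (0 : ℝ)).indicator (1 : ℝ → ℝ≥0∞) (r * t) = (Set.Ioi (0 : ℝ)).indicator 1 t := by
  by_cases h : 0 < t
  · rw [Set.indicator_of_mem (by simpa using mul_pos hr h), Set.indicator_of_mem (by simpa using h)]
    simp
  · have h2 : r * t ≤ 0 := mul_nonpos_of_nonneg_of_nonpos hr.le (not_lt.1 h)
    rw [Set.indicator_of_notMem (by simpa only [Set.mem_Ioi, not_lt] using h2),
      Set.indicator_of_notMem (by simpa using h)]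

/-- Replacing `kern` by its bound `1` turns the region below the plane with normal `r w` into the
integral of `r ⟪w, v⟫` over the simplex, which is `r` times the inner integral of `C(d)`. -/
theorem planeDensity_smul_le {r : ℝ} (hr : 0 < r) (w : H d) (u : Fin d → H d) :
    planeDensity (u, r • w) ≤ ENNReal.ofReal r *
      ((∏ i, (Set.Ioi (0 : ℝ)).indicator 1 (inner ℝ w (u i))) * simplexInt w u) := by
  have h1 : ∏ i, posKern d (inner ℝ (r • w) (u i)) ≤
      ∏ i, (Set.Ioi (0 : ℝ)).indicator 1 (inner ℝ w (u i)) := by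
    refine Finset.prod_le_prod' fun i _ => ?_
    rw [real_inner_smul_left]
    exact (posKern_le _).trans (indicator_Ioi_mul hr _).le
  have h2 : cyl (H d) (belowPlane u (r • w)) ≤ ENNReal.ofReal r *
      ∫⁻ v in {v : H d | v ∈ PointedCone.hull ℝ (Set.range u)}, ENNReal.ofReal (inner ℝ w v)
        ∂sphMeasure (H d) := by
    rw [cyl_belowPlane, ← lintegral_const_mul _ (by fun_prop)]
    refine lintegral_mono fun v => ?_
    rw [real_inner_smul_left, ← ENNReal.ofReal_mul hr.le]
    exact heights_Iio_le _
  calc planeDensity (u, r • w) ≤ _ := mul_le_mul' le_rfl (mul_le_mul' h1 h2)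
    _ = _ := by unfold simplexInt; ring

/-- All heights involved are at most `r`, so each use of `kern` costs a factor `1 - (d + 1) r²`: `d`
times for the vertices of the facet and once for the region below it. -/
theorem le_planeDensity_smul {r : ℝ} (hr : 0 < r) {w : H d} (hw : ‖w‖ = 1) {u : Fin d → H d}
    (hu : ∀ i, ‖u i‖ = 1) :
    ENNReal.ofReal (1 - (d + 1) * r ^ 2) ^ (d + 1) * (ENNReal.ofReal r *
      ((∏ i, (Set.Ioi (0 : ℝ)).indicator 1 (inner ℝ w (u i))) * simplexInt w u)) ≤
      planeDensity (u, r • w) := by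
  have hle : ∀ v : H d, ‖v‖ = 1 → r * inner ℝ w v ≤ r := fun v hv => by
    have := real_inner_le_norm w v
    rw [hw, hv] at this
    nlinarith
  have h1 : ENNReal.ofReal (1 - (d + 1) * r ^ 2) ^ d *
      ∏ i, (Set.Ioi (0 : ℝ)).indicator 1 (inner ℝ w (u i)) ≤
      ∏ i, posKern d (inner ℝ (r • w) (u i)) := by
    have e : ENNReal.ofReal (1 - (d + 1) * r ^ 2) ^ d = ∏ _i : Fin d,
      ENNReal.ofReal (1 - (d + 1) * r ^ 2) := by simp
    rw [e, ← Finset.prod_mul_distrib]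
    refine Finset.prod_le_prod' fun i _ => ?_
    rw [real_inner_smul_left, ← indicator_Ioi_mul hr]
    exact mul_indicator_le_posKern (hle _ (hu i))
  have h2 : ENNReal.ofReal (1 - (d + 1) * r ^ 2) * (ENNReal.ofReal r *
      ∫⁻ v in {v : H d | v ∈ PointedCone.hull ℝ (Set.range u)}, ENNReal.ofReal (inner ℝ w v)
        ∂sphMeasure (H d)) ≤ cyl (H d) (belowPlane u (r • w)) := by
    rw [cyl_belowPlane, ← lintegral_const_mul _ (by fun_prop),
      ← lintegral_const_mul _ (by fun_prop)]
    apply lintegral_mono_ae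
    filter_upwards [ae_restrict_of_ae (ae_sphMeasure_norm (V := H d))] with v hv
    rw [real_inner_smul_left, ← ENNReal.ofReal_mul hr.le]
    exact le_heights_Iio (hle v hv)
  calc _ = volume (parallelepiped u) * ((ENNReal.ofReal (1 - (d + 1) * r ^ 2) ^ d *
        ∏ i, (Set.Ioi (0 : ℝ)).indicator 1 (inner ℝ w (u i))) *
        (ENNReal.ofReal (1 - (d + 1) * r ^ 2) * (ENNReal.ofReal r *
      ∫⁻ v in {v : H d | v ∈ PointedCone.hull ℝ (Set.range u)}, ENNReal.ofReal (inner ℝ w v)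
        ∂sphMeasure (H d)))) := by unfold simplexInt; ring
    _ ≤ planeDensity (u, r • w) := mul_le_mul' le_rfl (mul_le_mul' h1 h2)

theorem measurable_indicator_mul_simplexInt : Measurable fun p : H d × (Fin d → H d) =>
    (∏ i, (Set.Ioi (0 : ℝ)).indicator (1 : ℝ → ℝ≥0∞) (inner ℝ p.1 (p.2 i))) *
      simplexInt p.1 p.2 := by
  refine Measurable.mul (Finset.measurable_prod _ fun i _ => ?_) measurable_simplexInt
  have h : Measurable fun p : H d × (Fin d → H d) => (inner ℝ p.1 (p.2 i) : ℝ) := by fun_prop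
  exact (measurable_one.indicator measurableSet_Ioi).comp h

theorem lintegral_mul_const_simplexInt (hd : 0 < d) (c : ℝ≥0∞) :
    ∫⁻ w, (∫⁻ u, c * ((∏ i, (Set.Ioi (0 : ℝ)).indicator 1 (inner ℝ w (u i))) * simplexInt w u)
      ∂(Measure.pi fun _ : Fin d => sphMeasure (H d))) ∂sphMeasure (H d) =
    c * ENNReal.ofReal (omega d * weightConst d) := by
  exact (lintegral_lintegral_const_mul measurable_indicator_mul_simplexInt c).trans
    (congrArg (c * ·) (lintegral_lintegral_simplexInt hd))

/-- Together with `le_radialInt` this says that `radialInt d r` is `r ω_d C(d)` up to a relative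
error `O(r²)`. -/
theorem radialInt_le (hd : 0 < d) {r : ℝ} (hr : 0 < r) :
    radialInt d r ≤ ENNReal.ofReal r * ENNReal.ofReal (omega d * weightConst d) := by
  rw [radialInt_eq, ← lintegral_mul_const_simplexInt hd]
  exact lintegral_mono fun w => lintegral_mono fun u => planeDensity_smul_le hr w u

theorem le_radialInt (hd : 0 < d) {r : ℝ} (hr : 0 < r) :
    ENNReal.ofReal (1 - (d + 1) * r ^ 2) ^ (d + 1) * ENNReal.ofReal r *
      ENNReal.ofReal (omega d * weightConst d) ≤ radialInt d r := by
  rw [radialInt_eq, ← lintegral_mul_const_simplexInt hd]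
  apply lintegral_mono_ae
  filter_upwards [ae_sphMeasure_norm (V := H d)] with w hw
  apply lintegral_mono_ae
  have hu : ∀ᵐ u ∂(Measure.pi fun _ : Fin d => sphMeasure (H d)), ∀ i, ‖u i‖ = 1 := by
    rw [ae_all_iff]
    intro i
    exact (Measure.quasiMeasurePreserving_eval (fun _ : Fin d => sphMeasure (H d)) i).ae
      (p := fun x => ‖x‖ = 1) ae_sphMeasure_norm
  filter_upwards [hu] with u hu
  rw [mul_assoc]
  exact le_planeDensity_smul hr hw hu

end RadialBounds

end SphPoly

namespace SphPoly

/-! ### The Beta integral and the substitution `x = arctan r`. -/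

section Beta

/-- Integration by parts, as induction on `k` with `m` free: the derivative of `x ^ (m + 1) * (1 - x
/ π) ^ (k + 1)` has integral zero, because the function vanishes at both ends. -/
theorem integral_pow_mul_one_sub_div_pi_pow (m k : ℕ) :
    ∫ x in (0 : ℝ)..Real.pi, x ^ m * (1 - x / Real.pi) ^ k =
      Real.pi ^ (m + 1) * m.factorial * k.factorial / (m + k + 1).factorial := by
  have hpi := Real.pi_pos.ne'
  induction k generalizing m with
  | zero =>
    simp only [pow_zero, mul_one, integral_pow, add_zero, Nat.factorial_zero, Nat.cast_one]
    rw [Nat.factorial_succ]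
    have : (m.factorial : ℝ) ≠ 0 := by positivity
    push_cast
    field_simp
    simp
  | succ k ih =>
    have hI : ∀ m k : ℕ, IntervalIntegrable (fun x : ℝ => x ^ m * (1 - x / Real.pi) ^ k) volume 0
        Real.pi := fun m k => (by fun_prop : Continuous _).intervalIntegrable _ _
    have hderiv : ∀ x ∈ Set.uIcc 0 Real.pi, HasDerivAt
        (fun x : ℝ => x ^ (m + 1) * (1 - x / Real.pi) ^ (k + 1))
        ((m + 1 : ℝ) * (x ^ m * (1 - x / Real.pi) ^ (k + 1)) -
          (k + 1 : ℝ) / Real.pi * (x ^ (m + 1) * (1 - x / Real.pi) ^ k)) x := by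
      intro x _
      have h1 := (hasDerivAt_pow (m + 1) x).mul
        ((((hasDerivAt_id x).div_const Real.pi).const_sub 1).pow (k + 1))
      refine h1.congr_deriv ?_
      simp only [Pi.pow_apply, id_eq, Nat.add_sub_cancel]
      push_cast
      ring
    have h := intervalIntegral.integral_eq_sub_of_hasDerivAt hderiv
      (((hI m (k + 1)).const_mul _).sub ((hI (m + 1) k).const_mul _))
    rw [intervalIntegral.integral_sub ((hI m (k + 1)).const_mul _) ((hI (m + 1) k).const_mul _),
      intervalIntegral.integral_const_mul, intervalIntegral.integral_const_mul, ih (m + 1),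
      div_self hpi] at h
    simp only [sub_self, ne_eq, Nat.add_eq_zero_iff, one_ne_zero, and_false, not_false_eq_true,
      zero_pow, mul_zero, zero_mul] at h
    have e : m + 1 + k + 1 = m + (k + 1) + 1 := by ring
    rw [e, Nat.factorial_succ m] at h
    rw [Nat.factorial_succ k]
    have hm : (m + 1 : ℝ) ≠ 0 := by positivity
    have hf : ((m + (k + 1) + 1).factorial : ℝ) ≠ 0 := by positivity
    apply mul_left_cancel₀ hm
    rw [sub_eq_zero.1 h]
    push_cast
    field_simp
    ring

theorem integral_pow_mul_one_sub_div_pi_pow_le (m k : ℕ) :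
    ∫ x in (0 : ℝ)..(Real.pi / 4), x ^ m * (1 - x / Real.pi) ^ k ≤
      ∫ x in (0 : ℝ)..Real.pi, x ^ m * (1 - x / Real.pi) ^ k := by
  have hpi := Real.pi_pos
  refine intervalIntegral.integral_mono_interval le_rfl (by positivity) (by linarith) ?_
    ((by fun_prop : Continuous _).intervalIntegrable _ _)
  filter_upwards [ae_restrict_mem measurableSet_Ioc] with x hx
  have h1 : x / Real.pi ≤ 1 := (div_le_one hpi).2 hx.2
  exact mul_nonneg (pow_nonneg hx.1.le _) (pow_nonneg (by linarith) _)

/-- Beyond `π / 4` the factor `1 - x / π` is at most `3 / 4`, so cutting there costs only an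
exponentially small amount. -/
theorem le_integral_pow_mul_one_sub_div_pi_pow (m k : ℕ) :
    (∫ x in (0 : ℝ)..Real.pi, x ^ m * (1 - x / Real.pi) ^ k) -
      Real.pi ^ (m + 1) * (3 / 4) ^ k ≤
    ∫ x in (0 : ℝ)..(Real.pi / 4), x ^ m * (1 - x / Real.pi) ^ k := by
  have hpi := Real.pi_pos
  have hI : ∀ a b : ℝ, IntervalIntegrable (fun x : ℝ => x ^ m * (1 - x / Real.pi) ^ k) volume a b :=
    fun a b => (by fun_prop : Continuous _).intervalIntegrable _ _
  rw [← intervalIntegral.integral_add_adjacent_intervals (hI 0 (Real.pi / 4))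
    (hI (Real.pi / 4) Real.pi)]
  have h : ∫ x in (Real.pi / 4)..Real.pi, x ^ m * (1 - x / Real.pi) ^ k ≤
      ∫ x in (Real.pi / 4)..Real.pi, Real.pi ^ m * (3 / 4) ^ k := by
    refine intervalIntegral.integral_mono_on (by linarith) (hI _ _)
      (by simp) fun x hx => ?_
    have h1 : x / Real.pi ≤ 1 := (div_le_one hpi).2 hx.2
    have h2 : 1 / 4 ≤ x / Real.pi := by rw [le_div_iff₀ hpi]; linarith [hx.1]
    have h3 : 0 ≤ x := by linarith [hx.1]
    exact mul_le_mul (pow_le_pow_left₀ h3 hx.2 _) (pow_le_pow_left₀ (by linarith) (by linarith) _)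
      (pow_nonneg (by linarith) _) (by positivity)
  rw [intervalIntegral.integral_const, smul_eq_mul] at h
  have h2 : (Real.pi - Real.pi / 4) * (Real.pi ^ m * (3 / 4) ^ k) ≤
      Real.pi ^ (m + 1) * (3 / 4) ^ k := by
    have : 0 ≤ Real.pi ^ m * (3 / 4) ^ k := by positivity
    rw [pow_succ]
    nlinarith
  linarith

/-- The radial integral is cut at `r = 1`, which corresponds to the angle `π / 4`. -/
theorem integral_comp_arctan (m k : ℕ) :
    ∫ r in (0 : ℝ)..1, Real.arctan r ^ m * (1 - Real.arctan r / Real.pi) ^ k * (1 / (1 + r ^ 2)) =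
      ∫ x in (0 : ℝ)..(Real.pi / 4), x ^ m * (1 - x / Real.pi) ^ k := by
  have h := intervalIntegral.integral_comp_mul_deriv (a := 0) (b := 1) (f := Real.arctan)
    (f' := fun r => 1 / (1 + r ^ 2)) (g := fun x => x ^ m * (1 - x / Real.pi) ^ k)
    (fun r _ => Real.hasDerivAt_arctan r)
    (continuous_const.div (by fun_prop) fun r => by positivity).continuousOn (by fun_prop)
  rw [Real.arctan_zero, Real.arctan_one] at h
  exact h

end Beta

section Pointwise

variable {r : ℝ}

/-- This is `sin x ≤ x` at `x = arctan r`, with `√(1 + r²) ≤ 1 + r²`. -/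
theorem le_arctan_mul (hr : 0 ≤ r) : r ≤ Real.arctan r * (1 + r ^ 2) := by
  have h0 : 0 < √(1 + r ^ 2) := by positivity
  have ha : 0 ≤ Real.arctan r := Real.arctan_nonneg.2 hr
  have h1 := Real.sin_le ha
  rw [Real.sin_arctan, div_le_iff₀ h0] at h1
  refine h1.trans (mul_le_mul_of_nonneg_left ?_ ha)
  rw [Real.sqrt_le_left (by positivity)]
  nlinarith [sq_nonneg r]

theorem arctan_le_self (hr : 0 ≤ r) : Real.arctan r ≤ r := by
  have h := Real.le_tan (Real.arctan_nonneg.2 hr) (Real.arctan_lt_pi_div_two r)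
  rwa [Real.tan_arctan] at h

theorem le_two_mul_arctan (hr : 0 ≤ r) (hr1 : r ≤ 1) : r ≤ 2 * Real.arctan r := by
  have h := le_arctan_mul hr
  have ha : 0 ≤ Real.arctan r := Real.arctan_nonneg.2 hr
  nlinarith

/-- By convexity the power lies below its chord over `[0, 1]`. -/
theorem one_add_pow_le {x : ℝ} (hx : 0 ≤ x) (hx1 : x ≤ 1) (N : ℕ) :
    (1 + x) ^ N ≤ 1 + (2 ^ N - 1) * x := by
  induction N with
  | zero => simp
  | succ N ih =>
    have h2 : (1 : ℝ) ≤ 2 ^ N := one_le_pow₀ (by norm_num)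
    rw [pow_succ, pow_succ]
    nlinarith [mul_le_mul_of_nonneg_right ih (by linarith : 0 ≤ 1 + x),
      mul_nonneg (sub_nonneg.2 h2) (mul_nonneg hx (sub_nonneg.2 hx1))]

/-- As `1 / (1 + r²)` is the derivative of `arctan`, this compares `r^d dr` with `x^d dx` up to
order `x^(d+2)`. The constant is `2 ^ (d + 1)` from `one_add_pow_le` times `4` from `r ≤ 2 arctan
r`, squared. -/
theorem pow_le_arctan (d : ℕ) (hr : 0 ≤ r) (hr1 : r ≤ 1) :
    r ^ d ≤ (Real.arctan r ^ d + 2 ^ (d + 3) * Real.arctan r ^ (d + 2)) * (1 / (1 + r ^ 2)) := by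
  have ha : 0 ≤ Real.arctan r := Real.arctan_nonneg.2 hr
  have h0 : 0 < 1 + r ^ 2 := by positivity
  rw [mul_one_div, le_div_iff₀ h0]
  have hr2 : r ^ 2 ≤ 1 := pow_le_one₀ hr hr1
  have h1 : r ^ 2 ≤ 4 * Real.arctan r ^ 2 := by
    have := pow_le_pow_left₀ hr (le_two_mul_arctan hr hr1) 2
    linarith [mul_pow 2 (Real.arctan r) 2]
  calc r ^ d * (1 + r ^ 2) ≤ (Real.arctan r * (1 + r ^ 2)) ^ d * (1 + r ^ 2) :=
        mul_le_mul_of_nonneg_right (pow_le_pow_left₀ hr (le_arctan_mul hr) d) h0.le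
    _ = Real.arctan r ^ d * (1 + r ^ 2) ^ (d + 1) := by rw [mul_pow]; ring
    _ ≤ Real.arctan r ^ d * (1 + 2 ^ (d + 1) * (4 * Real.arctan r ^ 2)) := by
        refine mul_le_mul_of_nonneg_left ?_ (pow_nonneg ha d)
        have h2 := one_add_pow_le (sq_nonneg r) hr2 (d + 1)
        have h3 : (2 : ℝ) ^ (d + 1) * r ^ 2 ≤ 2 ^ (d + 1) * (4 * Real.arctan r ^ 2) :=
          mul_le_mul_of_nonneg_left h1 (by positivity)
        nlinarith [sq_nonneg r]
    _ = _ := by ring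

/-- The factor `1 - (d + 1)² r²` is the loss in `le_radialInt` after Bernoulli's inequality. The
constant `2 ^ (d + 3)` is `2 ^ (d + 2)` from `r ≤ 2 arctan r` times `2` from `1 + r² ≤ 2`. -/
theorem arctan_le_pow (d : ℕ) (hr : 0 ≤ r) (hr1 : r ≤ 1) :
    (Real.arctan r ^ d - (d + 1) ^ 2 * 2 ^ (d + 3) * Real.arctan r ^ (d + 2)) * (1 / (1 + r ^ 2)) ≤
      r ^ d * (1 - (d + 1) ^ 2 * r ^ 2) := by
  have ha : 0 ≤ Real.arctan r := Real.arctan_nonneg.2 hr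
  have h0 : 0 < 1 + r ^ 2 := by positivity
  have hr2 : r ^ 2 ≤ 1 := pow_le_one₀ hr hr1
  rw [mul_one_div, div_le_iff₀ h0]
  have h1 : Real.arctan r ^ d ≤ r ^ d := pow_le_pow_left₀ ha (arctan_le_self hr) d
  have h2 : r ^ (d + 2) * (1 + r ^ 2) ≤ 2 ^ (d + 3) * Real.arctan r ^ (d + 2) := by
    have h3 := pow_le_pow_left₀ hr (le_two_mul_arctan hr hr1) (d + 2)
    rw [mul_pow] at h3
    have h4 : 0 ≤ r ^ (d + 2) := by positivity
    calc r ^ (d + 2) * (1 + r ^ 2) ≤ r ^ (d + 2) * 2 :=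
          mul_le_mul_of_nonneg_left (by linarith) h4
      _ ≤ 2 ^ (d + 2) * Real.arctan r ^ (d + 2) * 2 := by linarith
      _ = _ := by ring
  have h5 : 0 ≤ r ^ d * r ^ 2 := by positivity
  have h6 := mul_le_mul_of_nonneg_left h2 (by positivity : (0 : ℝ) ≤ (d + 1) ^ 2)
  have h7 : r ^ d * (1 - (d + 1) ^ 2 * r ^ 2) * (1 + r ^ 2) =
      r ^ d + r ^ d * r ^ 2 - (d + 1) ^ 2 * (r ^ (d + 2) * (1 + r ^ 2)) := by ring
  rw [h7]
  linarith

end Pointwise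

section RadialIntegral

theorem integral_pow_mul_arctan_le (d k : ℕ) :
    ∫ r in (0 : ℝ)..1, r ^ d * (1 - Real.arctan r / Real.pi) ^ k ≤
      (∫ x in (0 : ℝ)..Real.pi, x ^ d * (1 - x / Real.pi) ^ k) +
        2 ^ (d + 3) * ∫ x in (0 : ℝ)..Real.pi, x ^ (d + 2) * (1 - x / Real.pi) ^ k := by
  have hpi := Real.pi_pos
  have hc := Real.continuous_arctan
  have hq : Continuous fun r : ℝ => 1 / (1 + r ^ 2) :=
    continuous_const.div (by fun_prop) fun r => by positivity
  have hI : ∀ m : ℕ, IntervalIntegrable (fun r : ℝ =>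
      Real.arctan r ^ m * (1 - Real.arctan r / Real.pi) ^ k * (1 / (1 + r ^ 2))) volume 0 1 :=
    fun m => (((hc.pow m).mul ((continuous_const.sub (hc.div_const _)).pow k)).mul
      hq).intervalIntegrable _ _
  calc ∫ r in (0 : ℝ)..1, r ^ d * (1 - Real.arctan r / Real.pi) ^ k
      ≤ ∫ r in (0 : ℝ)..1,
        (Real.arctan r ^ d * (1 - Real.arctan r / Real.pi) ^ k * (1 / (1 + r ^ 2)) +
        2 ^ (d + 3) * (Real.arctan r ^ (d + 2) * (1 - Real.arctan r / Real.pi) ^ k *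
          (1 / (1 + r ^ 2)))) := by
        refine intervalIntegral.integral_mono_on zero_le_one
          (((continuous_pow d).mul ((continuous_const.sub (hc.div_const _)).pow
            k)).intervalIntegrable _ _) ((hI d).add ((hI (d + 2)).const_mul _)) fun r hr => ?_
        have h1 := pow_le_arctan d hr.1 hr.2
        have h2 : 0 ≤ 1 - Real.arctan r / Real.pi := by
          rw [sub_nonneg, div_le_one hpi]
          linarith [Real.arctan_lt_pi_div_two r]
        calc _ ≤ _ := mul_le_mul_of_nonneg_right h1 (pow_nonneg h2 k)
          _ = _ := by ring
    _ = _ := by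
        rw [intervalIntegral.integral_add (hI d) ((hI (d + 2)).const_mul _),
          intervalIntegral.integral_const_mul, integral_comp_arctan, integral_comp_arctan]
    _ ≤ _ := by
        gcongr
        · exact integral_pow_mul_one_sub_div_pi_pow_le d k
        · exact integral_pow_mul_one_sub_div_pi_pow_le (d + 2) k

theorem le_integral_pow_mul_arctan (d k : ℕ) :
    (∫ x in (0 : ℝ)..Real.pi, x ^ d * (1 - x / Real.pi) ^ k) - Real.pi ^ (d + 1) * (3 / 4) ^ k -
      (d + 1) ^ 2 * 2 ^ (d + 3) *
        (∫ x in (0 : ℝ)..Real.pi, x ^ (d + 2) * (1 - x / Real.pi) ^ k) ≤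
    ∫ r in (0 : ℝ)..1, r ^ d * (1 - (d + 1) ^ 2 * r ^ 2) * (1 - Real.arctan r / Real.pi) ^ k := by
  have hpi := Real.pi_pos
  have hc := Real.continuous_arctan
  have hq : Continuous fun r : ℝ => 1 / (1 + r ^ 2) :=
    continuous_const.div (by fun_prop) fun r => by positivity
  have hI : ∀ m : ℕ, IntervalIntegrable (fun r : ℝ =>
      Real.arctan r ^ m * (1 - Real.arctan r / Real.pi) ^ k * (1 / (1 + r ^ 2))) volume 0 1 :=
    fun m => (((hc.pow m).mul ((continuous_const.sub (hc.div_const _)).pow k)).mul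
      hq).intervalIntegrable _ _
  calc _ ≤ (∫ x in (0 : ℝ)..(Real.pi / 4), x ^ d * (1 - x / Real.pi) ^ k) -
      (d + 1) ^ 2 * 2 ^ (d + 3) *
        (∫ x in (0 : ℝ)..(Real.pi / 4), x ^ (d + 2) * (1 - x / Real.pi) ^ k) := by
        gcongr
        · exact le_integral_pow_mul_one_sub_div_pi_pow d k
        · exact integral_pow_mul_one_sub_div_pi_pow_le (d + 2) k
    _ = ∫ r in (0 : ℝ)..1,
        (Real.arctan r ^ d * (1 - Real.arctan r / Real.pi) ^ k * (1 / (1 + r ^ 2)) -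
        (d + 1) ^ 2 * 2 ^ (d + 3) * (Real.arctan r ^ (d + 2) *
          (1 - Real.arctan r / Real.pi) ^ k * (1 / (1 + r ^ 2)))) := by
        rw [intervalIntegral.integral_sub (hI d) ((hI (d + 2)).const_mul _),
          intervalIntegral.integral_const_mul, integral_comp_arctan, integral_comp_arctan]
    _ ≤ _ := by
        refine intervalIntegral.integral_mono_on zero_le_one
          ((hI d).sub ((hI (d + 2)).const_mul _))
          ((((continuous_pow d).mul (by fun_prop)).mul ((continuous_const.sub
            (hc.div_const _)).pow k)).intervalIntegrable _ _) fun r hr => ?_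
        have h1 := arctan_le_pow d hr.1 hr.2
        have h2 : 0 ≤ 1 - Real.arctan r / Real.pi := by
          rw [sub_nonneg, div_le_one hpi]
          linarith [Real.arctan_lt_pi_div_two r]
        calc _ = _ := by ring
          _ ≤ _ := mul_le_mul_of_nonneg_right h1 (pow_nonneg h2 k)

end RadialIntegral

end SphPoly

namespace SphPoly

variable {d : ℕ}

/-! ### Two-sided bounds for the contribution of a facet. -/

section FacetBounds

/-- Through `facetInt_eq` at `k = 0` this bounds the full radial integral, which controls its part
over `r > 1` for all `k`. -/
theorem facetInt_zero_le (hd : 2 ≤ d) : facetInt d 0 ≤ cyl (H d) Set.univ := by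
  have hn : Nontrivial (H d) := Module.nontrivial_of_finrank_pos (R := ℝ) (by simp; omega)
  unfold facetInt
  calc _ ≤ ∫⁻ _y, cyl (H d) Set.univ ∂(Measure.pi fun _ : Fin d => cylProb (H d)) :=
        lintegral_mono fun y => by
          rw [pow_zero, mul_one]
          exact measure_mono (Set.subset_univ _)
    _ = _ := by simp

theorem one_sub_arctan_div_nonneg (r : ℝ) : 0 ≤ 1 - Real.arctan r / Real.pi := by
  rw [sub_nonneg, div_le_one Real.pi_pos]
  linarith [Real.arctan_lt_pi_div_two r, Real.pi_pos]

theorem ofReal_intervalIntegral {f : ℝ → ℝ} (hf : Continuous f) (h0 : ∀ r, 0 ≤ r → 0 ≤ f r) :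
    ENNReal.ofReal (∫ r in (0 : ℝ)..1, f r) = ∫⁻ r in Set.Ioc 0 1, ENNReal.ofReal (f r) := by
  rw [intervalIntegral.integral_of_le zero_le_one,
    ofReal_integral_eq_lintegral_ofReal hf.integrableOn_Ioc]
  filter_upwards [ae_restrict_mem measurableSet_Ioc] with r hr using h0 r hr.1.le

theorem continuous_one_sub_arctan_pow (k : ℕ) :
    Continuous fun r : ℝ => (1 - Real.arctan r / Real.pi) ^ k :=
  (continuous_const.sub (Real.continuous_arctan.div_const _)).pow k

/-- Split at `r = 1`. Up to `1` the bound `radialInt_le` gives the main term; beyond it `arctan r ≥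
π / 4`, so the power is at most `(3 / 4) ^ k` and the rest is controlled by `facetInt d 0`. -/
theorem facetInt_le (hd : 2 ≤ d) (k : ℕ) :
    facetInt d k ≤ ENNReal.ofReal ((2 / omega (d + 1)) ^ d * (omega d * weightConst d) *
      ∫ r in (0 : ℝ)..1, r ^ d * (1 - Real.arctan r / Real.pi) ^ k) +
        ENNReal.ofReal ((3 / 4) ^ k * (omega (d + 1) / 2)) := by
  have hn : Nontrivial (H d) := Module.nontrivial_of_finrank_pos (R := ℝ) (by simp; omega)
  have hpi := Real.pi_pos
  have hω := omega_pos (Nat.succ_pos d)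
  have hω' := omega_pos (show 0 < d by omega)
  have hC := weightConst_nonneg (d := d)
  have hdisj : Disjoint (Set.Ioc (0 : ℝ) 1) (Set.Ioi 1) :=
    Set.Ioc_disjoint_Ioi le_rfl
  have hc : 0 ≤ 2 / omega (d + 1) := by positivity
  rw [facetInt_eq hd, ← Set.Ioc_union_Ioi_eq_Ioi (zero_le_one (α := ℝ)),
    lintegral_union measurableSet_Ioi hdisj, mul_add]
  refine add_le_add ?_ ?_
  · rw [ENNReal.ofReal_mul (by positivity), ENNReal.ofReal_mul (by positivity), mul_assoc,
      ENNReal.ofReal_pow hc]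
    refine mul_le_mul' le_rfl ?_
    have hcont : Continuous fun r : ℝ => r ^ d * (1 - Real.arctan r / Real.pi) ^ k :=
      (continuous_pow d).mul (continuous_one_sub_arctan_pow k)
    rw [ofReal_intervalIntegral hcont fun r hr =>
      mul_nonneg (pow_nonneg hr d) (pow_nonneg (one_sub_arctan_div_nonneg r) k),
      ← lintegral_const_mul _ hcont.measurable.ennreal_ofReal]
    refine setLIntegral_mono' measurableSet_Ioc fun r hr => ?_
    have e : r ^ d = r ^ (d - 1) * r := by rw [← pow_succ]; congr 1; omega
    rw [e, ENNReal.ofReal_mul (mul_nonneg (pow_nonneg hr.1.le _) hr.1.le),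
      ENNReal.ofReal_mul (pow_nonneg hr.1.le _), ENNReal.ofReal_pow (one_sub_arctan_div_nonneg r)]
    calc _ ≤ ENNReal.ofReal (r ^ (d - 1)) * ENNReal.ofReal (1 - Real.arctan r / Real.pi) ^ k *
          (ENNReal.ofReal r * ENNReal.ofReal (omega d * weightConst d)) :=
          mul_le_mul' le_rfl (radialInt_le (by omega) hr.1)
      _ = _ := by ring
  · have h0 := facetInt_zero_le hd
    rw [cyl_univ, facetInt_eq hd] at h0
    simp only [pow_zero, mul_one, finrank_euclideanSpace, Fintype.card_fin] at h0
    rw [ENNReal.ofReal_mul (by positivity)]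
    refine le_trans ?_ (mul_le_mul' le_rfl h0)
    rw [mul_left_comm]
    refine mul_le_mul' le_rfl ?_
    rw [← lintegral_const_mul' _ _ ENNReal.ofReal_ne_top]
    refine (setLIntegral_mono' measurableSet_Ioi fun r hr => ?_).trans
      (lintegral_mono_set (Set.Ioi_subset_Ioi zero_le_one))
    have hr1 : Real.arctan 1 ≤ Real.arctan r := Real.arctan_strictMono.monotone (le_of_lt hr)
    rw [Real.arctan_one] at hr1
    have h34 : 1 - Real.arctan r / Real.pi ≤ 3 / 4 := by
      have : 1 / 4 ≤ Real.arctan r / Real.pi := by rw [le_div_iff₀ hpi]; linarith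
      linarith
    have h1 : ENNReal.ofReal (1 - Real.arctan r / Real.pi) ^ k ≤ ENNReal.ofReal ((3 / 4) ^ k) := by
      rw [ENNReal.ofReal_pow (by norm_num)]
      exact pow_le_pow_left' (ENNReal.ofReal_le_ofReal h34) k
    calc _ ≤ ENNReal.ofReal (r ^ (d - 1)) * ENNReal.ofReal ((3 / 4) ^ k) * radialInt d r :=
          mul_le_mul' (mul_le_mul' le_rfl h1) le_rfl
      _ = _ := by ring

/-- Bernoulli's inequality, unless the base on the right is negative; in that case the left side is
truncated to zero as well. -/
theorem one_sub_le_pow (d : ℕ) (r : ℝ) :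
    ENNReal.ofReal (1 - (d + 1) ^ 2 * r ^ 2) ≤
      ENNReal.ofReal (1 - (d + 1) * r ^ 2) ^ (d + 1) := by
  by_cases h : 0 ≤ 1 - (d + 1) * r ^ 2
  · rw [← ENNReal.ofReal_pow h]
    refine ENNReal.ofReal_le_ofReal ?_
    have h3 := one_add_mul_le_pow (a := -((d + 1) * r ^ 2)) (by linarith) (d + 1)
    calc _ = 1 + ((d + 1 : ℕ) : ℝ) * -((d + 1) * r ^ 2) := by push_cast; ring
      _ ≤ _ := h3
      _ = _ := by ring
  · rw [ENNReal.ofReal_of_nonpos]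
    · exact zero_le
    · have hd : (0 : ℝ) ≤ d := by positivity
      nlinarith [mul_nonneg hd (mul_nonneg (by linarith : (0 : ℝ) ≤ d + 1) (sq_nonneg r))]

theorem le_facetInt (hd : 2 ≤ d) (k : ℕ) :
    ENNReal.ofReal ((2 / omega (d + 1)) ^ d * (omega d * weightConst d) *
      ∫ r in (0 : ℝ)..1, r ^ d * (1 - (d + 1) ^ 2 * r ^ 2) *
        (1 - Real.arctan r / Real.pi) ^ k) ≤ facetInt d k := by
  have hω := omega_pos (Nat.succ_pos d)
  have hω' := omega_pos (show 0 < d by omega)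
  have hC := weightConst_nonneg (d := d)
  have hc : 0 ≤ 2 / omega (d + 1) := by positivity
  have hcont : Continuous fun r : ℝ => r ^ d * (1 - (d + 1) ^ 2 * r ^ 2) *
      (1 - Real.arctan r / Real.pi) ^ k :=
    ((continuous_pow d).mul (by fun_prop)).mul (continuous_one_sub_arctan_pow k)
  have h1 : ENNReal.ofReal (∫ r in (0 : ℝ)..1, r ^ d * (1 - (d + 1) ^ 2 * r ^ 2) *
        (1 - Real.arctan r / Real.pi) ^ k) ≤ ∫⁻ r in Set.Ioc 0 1, ENNReal.ofReal
          (r ^ d * (1 - (d + 1) ^ 2 * r ^ 2) * (1 - Real.arctan r / Real.pi) ^ k) := by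
    rw [intervalIntegral.integral_of_le zero_le_one]
    -- The factor `1 - (d + 1)² r²` is negative for `r` near `1`, so the integral is estimated by
    -- its positive part.
    rw [integral_eq_lintegral_pos_part_sub_lintegral_neg_part hcont.integrableOn_Ioc]
    exact (ENNReal.ofReal_le_ofReal (sub_le_self _ ENNReal.toReal_nonneg)).trans
      ENNReal.ofReal_toReal_le
  rw [facetInt_eq hd, ENNReal.ofReal_mul (by positivity), ENNReal.ofReal_mul (by positivity),
    mul_assoc, ENNReal.ofReal_pow hc]
  refine mul_le_mul' le_rfl ((mul_le_mul' le_rfl h1).trans ?_)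
  rw [← lintegral_const_mul _ hcont.measurable.ennreal_ofReal]
  refine (setLIntegral_mono' measurableSet_Ioc fun r hr => ?_).trans
    (lintegral_mono_set Set.Ioc_subset_Ioi_self)
  have e : r ^ d * (1 - (d + 1) ^ 2 * r ^ 2) * (1 - Real.arctan r / Real.pi) ^ k =
      r ^ (d - 1) * r * (1 - Real.arctan r / Real.pi) ^ k * (1 - (d + 1) ^ 2 * r ^ 2) := by
    have : r ^ d = r ^ (d - 1) * r := by rw [← pow_succ]; congr 1; omega
    rw [this]; ring
  have hr0 := hr.1.le
  have hw := one_sub_arctan_div_nonneg r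
  have e2 : ENNReal.ofReal (r ^ (d - 1) * r * (1 - Real.arctan r / Real.pi) ^ k *
      (1 - (d + 1) ^ 2 * r ^ 2)) = ENNReal.ofReal (r ^ (d - 1)) * ENNReal.ofReal r *
        ENNReal.ofReal (1 - Real.arctan r / Real.pi) ^ k *
          ENNReal.ofReal (1 - (d + 1) ^ 2 * r ^ 2) := by
    rw [ENNReal.ofReal_mul (by positivity), ENNReal.ofReal_mul (by positivity),
      ENNReal.ofReal_mul (by positivity), ENNReal.ofReal_pow hw]
  rw [e, e2]
  calc _ ≤ ENNReal.ofReal (omega d * weightConst d) * (ENNReal.ofReal (r ^ (d - 1)) *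
        ENNReal.ofReal r * ENNReal.ofReal (1 - Real.arctan r / Real.pi) ^ k *
          ENNReal.ofReal (1 - (d + 1) * r ^ 2) ^ (d + 1)) :=
        mul_le_mul' le_rfl (mul_le_mul' le_rfl (one_sub_le_pow d r))
    _ = ENNReal.ofReal (r ^ (d - 1)) * ENNReal.ofReal (1 - Real.arctan r / Real.pi) ^ k *
        (ENNReal.ofReal (1 - (d + 1) * r ^ 2) ^ (d + 1) * ENNReal.ofReal r *
          ENNReal.ofReal (omega d * weightConst d)) := by ring
    _ ≤ _ := mul_le_mul' le_rfl (le_radialInt (by omega) hr.1)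

theorem facetInt_ne_top (hd : 2 ≤ d) (k : ℕ) : facetInt d k ≠ ⊤ :=
  ((facetInt_le hd k).trans_lt (ENNReal.add_lt_top.2
    ⟨ENNReal.ofReal_lt_top, ENNReal.ofReal_lt_top⟩)).ne

theorem toReal_facetInt_le (hd : 2 ≤ d) (k : ℕ) :
    (facetInt d k).toReal ≤ (2 / omega (d + 1)) ^ d * (omega d * weightConst d) *
      ((∫ x in (0 : ℝ)..Real.pi, x ^ d * (1 - x / Real.pi) ^ k) +
        2 ^ (d + 3) * ∫ x in (0 : ℝ)..Real.pi, x ^ (d + 2) * (1 - x / Real.pi) ^ k) +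
      (3 / 4) ^ k * (omega (d + 1) / 2) := by
  have hω := omega_pos (Nat.succ_pos d)
  have hω' := omega_pos (show 0 < d by omega)
  have hC := weightConst_nonneg (d := d)
  have hc : 0 ≤ 2 / omega (d + 1) := by positivity
  have h0 : 0 ≤ ∫ r in (0 : ℝ)..1, r ^ d * (1 - Real.arctan r / Real.pi) ^ k :=
    intervalIntegral.integral_nonneg zero_le_one fun r hr =>
      mul_nonneg (pow_nonneg hr.1 d) (pow_nonneg (one_sub_arctan_div_nonneg r) k)
  have h := facetInt_le hd k
  rw [← ENNReal.ofReal_add (by positivity) (by positivity)] at h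
  refine (ENNReal.toReal_le_of_le_ofReal (by positivity) h).trans ?_
  gcongr
  exact integral_pow_mul_arctan_le d k

theorem le_toReal_facetInt (hd : 2 ≤ d) (k : ℕ) :
    (2 / omega (d + 1)) ^ d * (omega d * weightConst d) *
      ((∫ x in (0 : ℝ)..Real.pi, x ^ d * (1 - x / Real.pi) ^ k) - Real.pi ^ (d + 1) * (3 / 4) ^ k -
      (d + 1) ^ 2 * 2 ^ (d + 3) *
        (∫ x in (0 : ℝ)..Real.pi, x ^ (d + 2) * (1 - x / Real.pi) ^ k)) ≤
    (facetInt d k).toReal := by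
  have hω := omega_pos (Nat.succ_pos d)
  have hω' := omega_pos (show 0 < d by omega)
  have hC := weightConst_nonneg (d := d)
  have hc : 0 ≤ 2 / omega (d + 1) := by positivity
  refine le_trans (mul_le_mul_of_nonneg_left (le_integral_pow_mul_arctan d k) (by positivity)) ?_
  exact (ENNReal.ofReal_le_iff_le_toReal (facetInt_ne_top hd k)).1 (le_facetInt hd k)

end FacetBounds

/-! ### Asymptotics of the expected missed measure. -/

section Asymptotics

theorem missInt_ne_top (hd : 2 ≤ d) (n : ℕ) : missInt d n ≠ ⊤ := by
  have hn : Nontrivial (H d) := Module.nontrivial_of_finrank_pos (R := ℝ) (by simp; omega)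
  refine ne_top_of_le_ne_top (b := cyl (H d) Set.univ) (by rw [cyl_univ]; simp) ?_
  unfold missInt
  calc _ ≤ ∫⁻ _y, cyl (H d) Set.univ ∂(Measure.pi fun _ : Fin n => cylProb (H d)) :=
        lintegral_mono fun y => measure_mono (Set.subset_univ _)
    _ = _ := by simp

theorem exists_abs_missInt_sub_le (hd : 2 ≤ d) : ∃ ρ A : ℝ, 0 ≤ ρ ∧ ρ < 1 ∧ ∀ n : ℕ,
    |(missInt d n).toReal - n.choose d * (facetInt d (n - d)).toReal| ≤ A * ρ ^ n := by
  have hn : Nontrivial (H d) := Module.nontrivial_of_finrank_pos (R := ℝ) (by simp; omega)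
  have hω := omega_pos (Nat.succ_pos d)
  obtain ⟨ρ, h0, h1, hρ⟩ := exists_missesOrthant_le (d := d) (by omega)
  refine ⟨ρ, omega (d + 1) / 2 * 2 ^ d, h0, h1, fun n => ?_⟩
  have hU : cyl (H d) Set.univ *
      (Measure.pi fun _ : Fin n => cylProb (H d)) (missesOrthant d n) ≤
      ENNReal.ofReal (omega (d + 1) / 2 * 2 ^ d * ρ ^ n) := by
    rw [cyl_univ, mul_assoc, ENNReal.ofReal_mul (by positivity)]
    simp only [finrank_euclideanSpace, Fintype.card_fin]
    exact mul_le_mul' le_rfl (hρ n)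
  have hF := facetInt_ne_top hd (n - d)
  have hM := missInt_ne_top hd n
  have hR : 0 ≤ omega (d + 1) / 2 * 2 ^ d * ρ ^ n := by positivity
  have hprod : ((n.choose d : ℝ≥0∞) * facetInt d (n - d)).toReal =
      n.choose d * (facetInt d (n - d)).toReal := by simp
  have hne : (n.choose d : ℝ≥0∞) * facetInt d (n - d) ≠ ⊤ :=
    ENNReal.mul_ne_top (ENNReal.natCast_ne_top _) hF
  have e1 := ENNReal.toReal_mono (ENNReal.add_ne_top.2 ⟨hne, ENNReal.ofReal_ne_top⟩)
    ((missInt_le (n := n) hd).trans (add_le_add_right hU _))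
  have e2 := ENNReal.toReal_mono (ENNReal.add_ne_top.2 ⟨hM, ENNReal.ofReal_ne_top⟩)
    ((le_missInt (n := n) hd).trans (add_le_add_right hU _))
  rw [ENNReal.toReal_add hne ENNReal.ofReal_ne_top, hprod, ENNReal.toReal_ofReal hR] at e1
  rw [ENNReal.toReal_add hM ENNReal.ofReal_ne_top, hprod, ENNReal.toReal_ofReal hR] at e2
  rw [abs_le]
  constructor <;> linarith

/-- The binomial coefficient cancels the factorials of the Beta integral. The leading term is thus
exact, with `1 / (n + 1)` instead of `1 / n`. -/
theorem choose_mul_integral {n : ℕ} (hn : d ≤ n) :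
    n.choose d * ∫ x in (0 : ℝ)..Real.pi, x ^ d * (1 - x / Real.pi) ^ (n - d) =
      Real.pi ^ (d + 1) * ((n : ℝ) + 1)⁻¹ := by
  have h := Nat.choose_mul_factorial_mul_factorial hn
  have h' : (n.choose d : ℝ) * d.factorial * (n - d).factorial = n.factorial := by exact_mod_cast h
  rw [integral_pow_mul_one_sub_div_pi_pow, show d + (n - d) + 1 = n + 1 by omega,
    Nat.factorial_succ]
  have hf : (n.factorial : ℝ) ≠ 0 := by positivity
  have hn1 : (n : ℝ) + 1 ≠ 0 := by positivity
  calc _ = Real.pi ^ (d + 1) * ((n.choose d : ℝ) * d.factorial * (n - d).factorial) /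
        ((n + 1 : ℕ) * n.factorial : ℕ) := by ring
    _ = _ := by
      rw [h']
      push_cast
      field_simp

theorem choose_mul_integral_le {n : ℕ} (hn : d ≤ n) (hn0 : 0 < n) :
    n.choose d * ∫ x in (0 : ℝ)..Real.pi, x ^ (d + 2) * (1 - x / Real.pi) ^ (n - d) ≤
      Real.pi ^ (d + 3) * ((d + 1) * (d + 2)) * ((n : ℝ) ^ 2)⁻¹ := by
  have h := Nat.choose_mul_factorial_mul_factorial hn
  have h' : (n.choose d : ℝ) * d.factorial * (n - d).factorial = n.factorial := by exact_mod_cast h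
  rw [integral_pow_mul_one_sub_div_pi_pow, show d + 2 + (n - d) + 1 = n + 2 + 1 by omega,
    Nat.factorial_succ (n + 2), Nat.factorial_succ (n + 1), Nat.factorial_succ n,
    Nat.factorial_succ (d + 1), Nat.factorial_succ d]
  have hf : (n.factorial : ℝ) ≠ 0 := by positivity
  have hn1 : (0 : ℝ) < n := by exact_mod_cast hn0
  calc _ = Real.pi ^ (d + 3) * ((d + 1) * (d + 2)) *
        ((n.choose d : ℝ) * d.factorial * (n - d).factorial) /
        ((n + 3) * ((n + 2) * ((n + 1) * n.factorial))) := by push_cast; ring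
    _ = Real.pi ^ (d + 3) * ((d + 1) * (d + 2)) * ((n + 3) * ((n + 2) * (n + 1)) : ℝ)⁻¹ := by
      rw [h']
      field_simp
    _ ≤ _ := by
      gcongr
      nlinarith [mul_pos hn1 hn1]

theorem exists_pow_mul_pow_le (m : ℕ) {ρ : ℝ} (h0 : 0 ≤ ρ) (h1 : ρ < 1) :
    ∃ K, 0 ≤ K ∧ ∀ n : ℕ, 0 < n → (n : ℝ) ^ m * ρ ^ n ≤ K * ((n : ℝ) ^ 2)⁻¹ := by
  have h := tendsto_pow_const_mul_const_pow_of_abs_lt_one (m + 2) (by rwa [abs_of_nonneg h0])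
  obtain ⟨K, hK⟩ := h.bddAbove_range
  have hK' : ∀ n : ℕ, (n : ℝ) ^ (m + 2) * ρ ^ n ≤ K := fun n => hK ⟨n, rfl⟩
  refine ⟨K, by simpa using hK' 0, fun n hn => ?_⟩
  have hn0 : (0 : ℝ) < n := by exact_mod_cast hn
  rw [← div_eq_mul_inv, le_div_iff₀ (by positivity)]
  calc _ = (n : ℝ) ^ (m + 2) * ρ ^ n := by ring
    _ ≤ K := hK' n

/-- Bookkeeping for `exists_missInt_asymptotics`: `M` is the missed measure, `c` the sum over
facets, `P` the limiting constant, `i = 1/n`, `j = 1/(n+1)`, `ν = 1/n²`. The tail `s * ν` bounds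
`n.choose d * (3/4)^(n-d)`, and `g`, `g'` are the second-order constants of the lower and upper
bound. -/
theorem abs_sub_mul_inv_le {M c P i j ν a s w g g' : ℝ} (h1 : |M - c| ≤ a * ν)
    (h2 : c ≤ P * j + g' * ν + w * (s * ν)) (h3 : P * j - P * (s * ν) - g * ν ≤ c)
    (hji : j ≤ i) (hij : i - j ≤ ν) (hg : g' ≤ g) (hg' : 0 ≤ g') (hP : 0 ≤ P) (hs : 0 ≤ s)
    (hw : 0 ≤ w) (hν : 0 ≤ ν) : |M - P * i| ≤ (a + s * (P + w) + g + P) * ν := by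
  have h4 := abs_le.1 h1
  have g1 := mul_le_mul_of_nonneg_left hji hP
  have g2 := mul_le_mul_of_nonneg_left hij hP
  have g3 := mul_le_mul_of_nonneg_right hg hν
  have g4 : 0 ≤ P * (s * ν) := by positivity
  have g5 : 0 ≤ w * (s * ν) := by positivity
  have g6 : 0 ≤ P * ν := by positivity
  have g7 : 0 ≤ g' * ν := by positivity
  rw [abs_le]
  constructor <;> linarith [h4.1, h4.2]

theorem choose_mul_three_quarters_pow_le {n : ℕ} (hn : d ≤ n) {K : ℝ}
    (hK : (n : ℝ) ^ d * (3 / 4) ^ n ≤ K * ((n : ℝ) ^ 2)⁻¹) :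
    n.choose d * (3 / 4 : ℝ) ^ (n - d) ≤ (4 / 3) ^ d * K * ((n : ℝ) ^ 2)⁻¹ := by
  have e1 : (3 / 4 : ℝ) ^ (n - d) = (4 / 3) ^ d * (3 / 4) ^ n := by
    have : (3 / 4 : ℝ) ^ n = (3 / 4) ^ d * (3 / 4) ^ (n - d) := by
      rw [← pow_add]; congr 1; omega
    rw [this, ← mul_assoc, ← mul_pow]
    norm_num
  have e2 : (n.choose d : ℝ) ≤ (n : ℝ) ^ d := by exact_mod_cast Nat.choose_le_pow n d
  calc _ = (4 / 3) ^ d * (n.choose d * (3 / 4 : ℝ) ^ n) := by rw [e1]; ring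
    _ ≤ (4 / 3) ^ d * ((n : ℝ) ^ d * (3 / 4 : ℝ) ^ n) := by gcongr
    _ ≤ (4 / 3) ^ d * (K * ((n : ℝ) ^ 2)⁻¹) := mul_le_mul_of_nonneg_left hK (by positivity)
    _ = _ := by ring

theorem choose_mul_facetInt_le (hd : 2 ≤ d) {n : ℕ} (hn : d ≤ n) {K : ℝ}
    (hK : (n : ℝ) ^ d * (3 / 4) ^ n ≤ K * ((n : ℝ) ^ 2)⁻¹) :
    n.choose d * (facetInt d (n - d)).toReal ≤
      (2 / omega (d + 1)) ^ d * (omega d * weightConst d) * Real.pi ^ (d + 1) * ((n : ℝ) + 1)⁻¹ +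
      (2 / omega (d + 1)) ^ d * (omega d * weightConst d) * 2 ^ (d + 3) *
        (Real.pi ^ (d + 3) * ((d + 1) * (d + 2))) * ((n : ℝ) ^ 2)⁻¹ +
      omega (d + 1) / 2 * ((4 / 3) ^ d * K * ((n : ℝ) ^ 2)⁻¹) := by
  have hω := omega_pos (Nat.succ_pos d)
  have hω' := omega_pos (show 0 < d by omega)
  have hC := weightConst_nonneg (d := d)
  have hup := mul_le_mul_of_nonneg_left (toReal_facetInt_le hd (n - d))
    (by positivity : (0 : ℝ) ≤ n.choose d)
  have hB0 : 0 ≤ (2 / omega (d + 1)) ^ d * (omega d * weightConst d) := by positivity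
  set B := (2 / omega (d + 1)) ^ d * (omega d * weightConst d)
  have hI1 := mul_le_mul_of_nonneg_left (choose_mul_integral (d := d) (n := n) (by omega)).le hB0
  have hI2 := mul_le_mul_of_nonneg_left (choose_mul_integral_le (d := d) (n := n) (by omega)
    (by omega)) (by positivity : 0 ≤ B * 2 ^ (d + 3))
  have hq := mul_le_mul_of_nonneg_left (choose_mul_three_quarters_pow_le hn hK)
    (by positivity : 0 ≤ omega (d + 1) / 2)
  set I₁ := ∫ x in (0 : ℝ)..Real.pi, x ^ d * (1 - x / Real.pi) ^ (n - d)
  set I₂ := ∫ x in (0 : ℝ)..Real.pi, x ^ (d + 2) * (1 - x / Real.pi) ^ (n - d)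
  calc _ ≤ _ := hup
    _ = B * (n.choose d * I₁) + B * 2 ^ (d + 3) * (n.choose d * I₂) +
        omega (d + 1) / 2 * (n.choose d * (3 / 4 : ℝ) ^ (n - d)) := by ring
    _ ≤ _ := add_le_add (add_le_add hI1 hI2) hq
    _ = _ := by ring

theorem le_choose_mul_facetInt (hd : 2 ≤ d) {n : ℕ} (hn : d ≤ n) {K : ℝ}
    (hK : (n : ℝ) ^ d * (3 / 4) ^ n ≤ K * ((n : ℝ) ^ 2)⁻¹) :
    (2 / omega (d + 1)) ^ d * (omega d * weightConst d) * Real.pi ^ (d + 1) * ((n : ℝ) + 1)⁻¹ -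
      (2 / omega (d + 1)) ^ d * (omega d * weightConst d) * Real.pi ^ (d + 1) *
        ((4 / 3) ^ d * K * ((n : ℝ) ^ 2)⁻¹) -
      (2 / omega (d + 1)) ^ d * (omega d * weightConst d) * ((d + 1) ^ 2 * 2 ^ (d + 3)) *
        (Real.pi ^ (d + 3) * ((d + 1) * (d + 2))) * ((n : ℝ) ^ 2)⁻¹ ≤
    n.choose d * (facetInt d (n - d)).toReal := by
  have hω := omega_pos (Nat.succ_pos d)
  have hω' := omega_pos (show 0 < d by omega)
  have hC := weightConst_nonneg (d := d)
  have hpi := Real.pi_pos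
  have hlo := mul_le_mul_of_nonneg_left (le_toReal_facetInt hd (n - d))
    (by positivity : (0 : ℝ) ≤ n.choose d)
  have hB0 : 0 ≤ (2 / omega (d + 1)) ^ d * (omega d * weightConst d) := by positivity
  set B := (2 / omega (d + 1)) ^ d * (omega d * weightConst d)
  have hI1 := mul_le_mul_of_nonneg_left (choose_mul_integral (d := d) (n := n) (by omega)).ge hB0
  have hI2 := mul_le_mul_of_nonneg_left (choose_mul_integral_le (d := d) (n := n) (by omega)
    (by omega)) (by positivity : 0 ≤ B * ((d + 1) ^ 2 * 2 ^ (d + 3)))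
  have hq := mul_le_mul_of_nonneg_left (choose_mul_three_quarters_pow_le hn hK)
    (by positivity : 0 ≤ B * Real.pi ^ (d + 1))
  set I₁ := ∫ x in (0 : ℝ)..Real.pi, x ^ d * (1 - x / Real.pi) ^ (n - d)
  set I₂ := ∫ x in (0 : ℝ)..Real.pi, x ^ (d + 2) * (1 - x / Real.pi) ^ (n - d)
  calc _ = B * (Real.pi ^ (d + 1) * ((n : ℝ) + 1)⁻¹) -
        B * Real.pi ^ (d + 1) * ((4 / 3) ^ d * K * ((n : ℝ) ^ 2)⁻¹) -
        B * ((d + 1) ^ 2 * 2 ^ (d + 3)) *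
          (Real.pi ^ (d + 3) * ((d + 1) * (d + 2)) * ((n : ℝ) ^ 2)⁻¹) := by ring
    _ ≤ B * (n.choose d * I₁) - B * Real.pi ^ (d + 1) * (n.choose d * (3 / 4 : ℝ) ^ (n - d)) -
        B * ((d + 1) ^ 2 * 2 ^ (d + 3)) * (n.choose d * I₂) :=
        sub_le_sub (sub_le_sub hI1 hq) hI2
    _ = _ := by ring
    _ ≤ _ := hlo

theorem exists_missInt_asymptotics (hd : 2 ≤ d) : ∃ K : ℝ, ∀ n : ℕ, d + 1 ≤ n →
    |(missInt d n).toReal - weightConst d * Real.pi ^ (d + 1) * (2 / omega (d + 1)) ^ d * omega d *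
      (n : ℝ)⁻¹| ≤ K * ((n : ℝ) ^ 2)⁻¹ := by
  obtain ⟨ρ, A, h0, h1, hA⟩ := exists_abs_missInt_sub_le hd
  obtain ⟨K₁, hK₁0, hK₁⟩ := exists_pow_mul_pow_le 0 h0 h1
  obtain ⟨K₂, hK₂0, hK₂⟩ := exists_pow_mul_pow_le d (ρ := 3 / 4) (by norm_num) (by norm_num)
  have hω := omega_pos (Nat.succ_pos d)
  have hω' := omega_pos (show 0 < d by omega)
  have hC := weightConst_nonneg (d := d)
  have hpi := Real.pi_pos
  refine ⟨|A| * K₁ + (4 / 3) ^ d * K₂ * ((2 / omega (d + 1)) ^ d * (omega d * weightConst d) *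
    Real.pi ^ (d + 1) + omega (d + 1) / 2) + (2 / omega (d + 1)) ^ d * (omega d * weightConst d) *
      ((d + 1) ^ 2 * 2 ^ (d + 3)) * (Real.pi ^ (d + 3) * ((d + 1) * (d + 2))) +
    (2 / omega (d + 1)) ^ d * (omega d * weightConst d) * Real.pi ^ (d + 1), fun n hn => ?_⟩
  have hn0 : (0 : ℝ) < n := by exact_mod_cast (by omega : 0 < n)
  have hT : weightConst d * Real.pi ^ (d + 1) * (2 / omega (d + 1)) ^ d * omega d * (n : ℝ)⁻¹ =
      (2 / omega (d + 1)) ^ d * (omega d * weightConst d) * Real.pi ^ (d + 1) * (n : ℝ)⁻¹ := by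
    ring
  have hrho : |(missInt d n).toReal - n.choose d * (facetInt d (n - d)).toReal| ≤
      |A| * K₁ * ((n : ℝ) ^ 2)⁻¹ := by
    have := hK₁ n (by omega)
    rw [pow_zero, one_mul] at this
    calc _ ≤ A * ρ ^ n := hA n
      _ ≤ |A| * ρ ^ n := mul_le_mul_of_nonneg_right (le_abs_self A) (pow_nonneg h0 n)
      _ ≤ |A| * (K₁ * ((n : ℝ) ^ 2)⁻¹) := mul_le_mul_of_nonneg_left this (abs_nonneg A)
      _ = _ := (mul_assoc _ _ _).symm
  have hij : (n : ℝ)⁻¹ - ((n : ℝ) + 1)⁻¹ ≤ ((n : ℝ) ^ 2)⁻¹ := by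
    rw [inv_sub_inv hn0.ne' (by positivity), inv_eq_one_div, add_sub_cancel_left]
    gcongr
    nlinarith
  have hd1 : (1 : ℝ) ≤ (d + 1) ^ 2 := one_le_pow₀ (by linarith [(Nat.cast_nonneg d : (0 : ℝ) ≤ d)])
  rw [hT]
  refine abs_sub_mul_inv_le hrho (choose_mul_facetInt_le hd (by omega) (hK₂ n (by omega)))
    (le_choose_mul_facetInt hd (by omega) (hK₂ n (by omega))) ?_ hij ?_ ?_ ?_ ?_ ?_ ?_
  · gcongr; linarith
  -- The second-order constant of the upper bound lacks the factor `(d + 1) ^ 2` of the lower one,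
  -- hence is the smaller.
  · refine mul_le_mul_of_nonneg_right (mul_le_mul_of_nonneg_left ?_ (by positivity))
      (by positivity)
    exact le_mul_of_one_le_left (by positivity) hd1
  all_goals positivity

end Asymptotics

end SphPoly

namespace SphPoly

variable {d : ℕ}

/-! ### Transfer to random points on the sphere. -/

section Lift

variable {F E' : Type*} [NormedAddCommGroup F] [InnerProductSpace ℝ F] [NormedAddCommGroup E']
  [InnerProductSpace ℝ E'] (J : WithLp 2 (F × ℝ) ≃ₗᵢ[ℝ] E')

theorem norm_map_toLp_pos {z : F × ℝ} (hz : z ≠ 0) : 0 < ‖J (WithLp.toLp 2 z)‖ := by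
  rw [norm_pos_iff, ne_eq, map_eq_zero_iff J J.injective]
  exact fun h => hz (by simpa using congrArg WithLp.ofLp h)

theorem norm_lift {z : F × ℝ} (hz : z ≠ 0) : ‖lift J z‖ = 1 := by
  rw [lift, norm_smul, norm_inv, norm_norm, inv_mul_cancel₀ (norm_map_toLp_pos J hz).ne']

theorem inner_lift_pos {z : F × ℝ} (hz : 0 < z.2) :
    0 < inner ℝ (lift J z) (J (WithLp.toLp 2 (0, 1))) := by
  have hz0 : z ≠ 0 := by rintro rfl; simp at hz
  rw [lift, real_inner_smul_left, J.inner_map_map]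
  have : inner ℝ (WithLp.toLp 2 z) (WithLp.toLp 2 ((0, 1) : F × ℝ)) = z.2 := by
    simp [WithLp.prod_inner_apply]
  rw [this]
  exact mul_pos (inv_pos.2 (norm_map_toLp_pos J hz0)) hz

theorem mem_span_of_lift_eq {z z' : F × ℝ} (hz : z ≠ 0) (h : lift J z = lift J z') :
    z ∈ Submodule.span ℝ {z'} := by
  have h0 := norm_map_toLp_pos J hz
  refine Submodule.mem_span_singleton.2
    ⟨‖J (WithLp.toLp 2 z)‖ * ‖J (WithLp.toLp 2 z')‖⁻¹, ?_⟩
  have h1 : J (WithLp.toLp 2 z) = J (WithLp.toLp 2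
      ((‖J (WithLp.toLp 2 z)‖ * ‖J (WithLp.toLp 2 z')‖⁻¹) • z')) := by
    rw [WithLp.toLp_smul, map_smul, mul_smul]
    change _ = ‖J (WithLp.toLp 2 z)‖ • lift J z'
    rw [← h, lift, smul_smul, mul_inv_cancel₀ h0.ne', one_smul]
  have h2 := congrArg WithLp.ofLp (J.injective h1)
  simpa using h2.symm

end Lift

section Transfer

variable {E' : Type*} [NormedAddCommGroup E'] [InnerProductSpace ℝ E'] [FiniteDimensional ℝ E']
  [MeasurableSpace E'] [BorelSpace E'] (J : WithLp 2 (H d × ℝ) ≃ₗᵢ[ℝ] E') {n : ℕ}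

theorem GenericTuple.ne_zero {x : Fin n → H d × ℝ} (hx : GenericTuple x) (i : Fin n) :
    x i ≠ 0 := fun h => by
  have := hx.pos i
  rw [h] at this
  exact lt_irrefl _ this

theorem GenericTuple.lift_ne (hd : 0 < d) {x : Fin n → H d × ℝ} (hx : GenericTuple x)
    {i j : Fin n} (hij : i ≠ j) : SphPoly.lift J (x i) ≠ SphPoly.lift J (x j) := fun h =>
  hx.lift i {j} (by simpa using hij) (by simpa using hd)
    (by simpa using mem_span_of_lift_eq J (hx.ne_zero i) h)

theorem measurableSet_mem_convS : MeasurableSet {p : (Fin n → E') × E' |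
    p.2 ∈ convS (Set.range p.1)} := by
  have h1 : MeasurableSet {p : (Fin n → E') × E' | p.2 ∈ Metric.sphere (0 : E') 1} :=
    measurable_snd Metric.isClosed_sphere.measurableSet
  exact h1.inter (measurableSet_mem_hull (ι := Fin n) (V := E'))

theorem measurable_missed (e : E') : Measurable fun x : Fin n → E' =>
    sphMeasure E' (halfSphere e \ convS (Set.range x)) := by
  have h1 : MeasurableSet {p : (Fin n → E') × E' | p.2 ∈ halfSphere e} :=
    measurable_snd (measurableSet_halfSphere e)
  exact measurable_measure_prodMk_left (h1.diff measurableSet_mem_convS)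

theorem sphMeasure_missed (hd : 2 ≤ d) {x : Fin n → H d × ℝ} (hx : ∀ i, x i ≠ 0) :
    sphMeasure E' (halfSphere (J (WithLp.toLp 2 (0, 1))) \
      convS (Set.range fun i => lift J (x i))) =
    cyl (H d) {z | z ∉ PointedCone.hull ℝ (Set.range x)} := by
  have hn : Nontrivial (H d) := Module.nontrivial_of_finrank_pos (R := ℝ) (by simp; omega)
  have hm : MeasurableSet (convS (Set.range fun i => lift J (x i)))ᶜ :=
    (measurable_prodMk_left (x := fun i => lift J (x i)) measurableSet_mem_convS).compl
  have e1 : halfSphere (J (WithLp.toLp 2 (0, 1))) \ convS (Set.range fun i => lift J (x i)) =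
      (convS (Set.range fun i => lift J (x i)))ᶜ ∩ halfSphere (J (WithLp.toLp 2 (0, 1))) := by
    rw [Set.sdiff_eq, Set.inter_comm]
  rw [e1, ← Measure.restrict_apply hm, ← map_lift_cyl, Measure.map_apply (measurable_lift J) hm]
  refine measure_congr ?_
  filter_upwards [ae_cyl (F := H d)] with z hz
  have hz0 : z ≠ 0 := by
    rintro rfl
    exact lt_irrefl _ hz.2
  refine propext ⟨fun h h' => h ⟨by simpa using norm_lift J hz0, ?_⟩, fun h h' => h ?_⟩
  · exact (lift_mem_hull_range_iff J hx hz0).2 h'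
  · exact (lift_mem_hull_range_iff J hx hz0).1 h'.2

variable {Ω : Type*} [MeasurableSpace Ω] {P : Measure Ω} [IsProbabilityMeasure P]
  {X : Fin n → Ω → E'}

/-- Independence makes the joint law a product, and each factor is the image of `cylProb`. Hence
expectations over the unspecified spaces `Ω` become integrals over tuples on the cylinder. -/
theorem map_eq_map_lift (hd : 2 ≤ d)
    (hX : ∀ i, HasLaw (X i) (uniformHalf (J (WithLp.toLp 2 (0, 1)))) P) (hind : iIndepFun X P) :
    P.map (fun w i => X i w) =
      (Measure.pi fun _ : Fin n => cylProb (H d)).map fun x i => lift J (x i) := by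
  have hn : Nontrivial (H d) := Module.nontrivial_of_finrank_pos (R := ℝ) (by simp; omega)
  have hfin : IsProbabilityMeasure ((cylProb (H d)).map (lift J)) :=
    Measure.isProbabilityMeasure_map (measurable_lift J).aemeasurable
  rw [hind.map_fun_eq_pi_map fun i => (hX i).aemeasurable,
    Measure.pi_map_pi fun _ => (measurable_lift J).aemeasurable]
  simp only [(hX _).map_eq, map_lift_cylProb]

theorem measurable_pi_lift : Measurable fun (x : Fin n → H d × ℝ) i => lift J (x i) :=
  measurable_pi_lambda _ fun i => (measurable_lift J).comp (measurable_pi_apply i)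

theorem lintegral_comp_points (hd : 2 ≤ d)
    (hX : ∀ i, HasLaw (X i) (uniformHalf (J (WithLp.toLp 2 (0, 1)))) P) (hind : iIndepFun X P)
    {G : (Fin n → E') → ℝ≥0∞} (hG : Measurable G) :
    ∫⁻ w, G (fun i => X i w) ∂P = ∫⁻ x, G (fun i => lift J (x i))
      ∂(Measure.pi fun _ : Fin n => cylProb (H d)) := by
  rw [← lintegral_map hG (measurable_pi_lift J), ← map_eq_map_lift J hd hX hind,
    lintegral_map' hG.aemeasurable (aemeasurable_pi_lambda _ fun i => (hX i).aemeasurable)]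

theorem ae_points (hd : 2 ≤ d)
    (hX : ∀ i, HasLaw (X i) (uniformHalf (J (WithLp.toLp 2 (0, 1)))) P) (hind : iIndepFun X P)
    {p : (Fin n → E') → Prop} (hp : MeasurableSet {x | p x})
    (h : ∀ x : Fin n → H d × ℝ, GenericTuple x → p fun i => lift J (x i)) :
    ∀ᵐ w ∂P, p fun i => X i w := by
  refine ae_of_ae_map (f := fun w i => X i w)
    (aemeasurable_pi_lambda _ fun i => (hX i).aemeasurable) ?_
  rw [map_eq_map_lift J hd hX hind, ae_map_iff (measurable_pi_lift J).aemeasurable hp]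
  filter_upwards [ae_genericTuple (d := d) (n := n) (by omega)] with x hx using h x hx

theorem missed_integrable_and_integral (hd : 2 ≤ d)
    (hX : ∀ i, HasLaw (X i) (uniformHalf (J (WithLp.toLp 2 (0, 1)))) P) (hind : iIndepFun X P) :
    Integrable (fun w => (sphMeasure E').real (halfSphere (J (WithLp.toLp 2 (0, 1))) \
      convS (Set.range fun i => X i w))) P ∧
    ∫ w, (sphMeasure E').real (halfSphere (J (WithLp.toLp 2 (0, 1))) \
      convS (Set.range fun i => X i w)) ∂P = (missInt d n).toReal := by
  have hm := measurable_missed (n := n) (J (WithLp.toLp 2 (0, 1)))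
  have hXm : AEMeasurable (fun w i => X i w) P :=
    aemeasurable_pi_lambda _ fun i => (hX i).aemeasurable
  have hL : ∫⁻ w, sphMeasure E' (halfSphere (J (WithLp.toLp 2 (0, 1))) \
      convS (Set.range fun i => X i w)) ∂P = missInt d n := by
    rw [lintegral_comp_points J hd hX hind hm, missInt]
    apply lintegral_congr_ae
    filter_upwards [ae_genericTuple (d := d) (n := n) (by omega)] with x hx
    exact sphMeasure_missed J hd hx.ne_zero
  have hmX := hm.comp_aemeasurable hXm
  constructor
  · exact integrable_toReal_of_lintegral_ne_top hmX (by
      rw [show ∫⁻ w, _ ∂P = missInt d n from hL]; exact missInt_ne_top hd n)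
  · rw [← hL]
    exact integral_toReal hmX (.of_forall fun w => measure_lt_top _ _)

end Transfer

/-! ### Efron's argument for the number of vertices. -/

section Efron

variable {m : ℕ}

/-- The tuples whose `i`-th point is not in the positive hull of the others. -/
def extremeAt (V : Type*) [AddCommGroup V] [Module ℝ V] (i : Fin (m + 1)) :
    Set (Fin (m + 1) → V) :=
  {x | x i ∉ PointedCone.hull ℝ (Set.range fun k => x (i.succAbove k))}

theorem measurableSet_extremeAt {V : Type*} [NormedAddCommGroup V] [NormedSpace ℝ V]
    [FiniteDimensional ℝ V] [MeasurableSpace V] [BorelSpace V] (i : Fin (m + 1)) :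
    MeasurableSet (extremeAt V i) := by
  have hf : Measurable fun x : Fin (m + 1) → V => ((fun k => x (i.succAbove k)), x i) := by fun_prop
  exact (hf (measurableSet_mem_hull (ι := Fin m) (V := V))).compl

theorem faceCount_convS_range_eq_sum {V : Type*} [NormedAddCommGroup V] [InnerProductSpace ℝ V]
    {e : V} {x : Fin (m + 1) → V} (hx : ∀ i, ‖x i‖ = 1) (hinj : Function.Injective x)
    (he : ∀ i, 0 < inner ℝ (x i) e) :
    (faceCount 0 (convS (Set.range x)) : ℝ≥0∞) =
      ∑ i, (extremeAt V i).indicator (1 : (Fin (m + 1) → V) → ℝ≥0∞) x := by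
  classical
  have h1 : ∀ i : Fin (m + 1), x '' {i}ᶜ = Set.range fun k => x (i.succAbove k) := fun i => by
    rw [← Fin.range_succAbove, ← Set.range_comp]
    rfl
  rw [faceCount_zero_convS_range hx hinj he]
  simp only [h1]
  have h2 : {i | x i ∉ PointedCone.hull ℝ (Set.range fun k => x (i.succAbove k))} =
      (Finset.univ.filter fun i => x ∈ extremeAt V i : Finset (Fin (m + 1))) := by
    rw [Finset.coe_filter]
    simp only [Finset.mem_univ, true_and]
    rfl
  rw [h2, Set.ncard_coe_finset, Finset.card_filter]
  push_cast
  refine Finset.sum_congr rfl fun i _ => ?_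
  by_cases h : x ∈ extremeAt V i <;> simp [h]

/-- Conditionally on the other `m` points, the `i`-th is still uniform, so it avoids their hull with
probability `2 / ω_{d+1}` times the measure they miss. -/
theorem measure_extremeAt (hd : 2 ≤ d) (i : Fin (m + 1)) :
    (Measure.pi fun _ : Fin (m + 1) => cylProb (H d)) (extremeAt (H d × ℝ) i) =
      ENNReal.ofReal (2 / omega (d + 1)) * missInt d m := by
  have hn : Nontrivial (H d) := Module.nontrivial_of_finrank_pos (R := ℝ) (by simp; omega)
  have hmp := (measurePreserving_piFinSuccAbove (fun _ : Fin (m + 1) => cylProb (H d)) i).symm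
  have hms := measurableSet_extremeAt (V := H d × ℝ) i
  rw [← hmp.measure_preimage hms.nullMeasurableSet]
  refine (Measure.prod_apply_symm (hmp.measurable hms)).trans ?_
  rw [missInt, ← lintegral_const_mul _ measurable_measure_notMem_hull]
  refine lintegral_congr fun y => ?_
  have hset : (fun z => (z, y)) ⁻¹' ((MeasurableEquiv.piFinSuccAbove
      (fun _ : Fin (m + 1) => H d × ℝ) i).symm ⁻¹' extremeAt (H d × ℝ) i) =
      {z | z ∉ PointedCone.hull ℝ (Set.range y)} := by
    ext z
    change _ ∉ _ ↔ _ ∉ _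
    simp only [piFinSuccAbove_symm_succAbove, piFinSuccAbove_symm_self]
  rw [hset, cylProb, Measure.smul_apply, smul_eq_mul]
  simp

variable {E' : Type*} [NormedAddCommGroup E'] [InnerProductSpace ℝ E'] [FiniteDimensional ℝ E']
  [MeasurableSpace E'] [BorelSpace E'] (J : WithLp 2 (H d × ℝ) ≃ₗᵢ[ℝ] E')
  {Ω : Type*} [MeasurableSpace Ω] {P : Measure Ω} [IsProbabilityMeasure P]
  {X : Fin (m + 1) → Ω → E'}

theorem ae_faceCount_eq (hd : 2 ≤ d)
    (hX : ∀ i, HasLaw (X i) (uniformHalf (J (WithLp.toLp 2 (0, 1)))) P) (hind : iIndepFun X P) :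
    ∀ᵐ w ∂P, (faceCount 0 (convS (Set.range fun i => X i w)) : ℝ≥0∞) =
      ∑ i, (extremeAt E' i).indicator (1 : (Fin (m + 1) → E') → ℝ≥0∞) fun i => X i w := by
  have h1 : ∀ᵐ w ∂P, ∀ i, ‖X i w‖ = 1 := by
    rw [ae_all_iff]
    exact fun i => ae_points J hd hX hind (p := fun x => ‖x i‖ = 1)
      (measurableSet_eq_fun (by fun_prop) measurable_const)
      fun x hx => norm_lift J (hx.ne_zero i)
  have h2 : ∀ᵐ w ∂P, ∀ i, 0 < inner ℝ (X i w) (J (WithLp.toLp 2 (0, 1))) := by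
    rw [ae_all_iff]
    exact fun i => ae_points J hd hX hind
      (p := fun x => 0 < inner ℝ (x i) (J (WithLp.toLp 2 (0, 1))))
      (measurableSet_lt measurable_const (by fun_prop))
      fun x hx => inner_lift_pos J (hx.pos i)
  have h3 : ∀ᵐ w ∂P, ∀ i j, i ≠ j → X i w ≠ X j w := by
    rw [ae_all_iff]; intro i
    rw [ae_all_iff]; intro j
    rw [ae_all_iff]; intro hij
    exact ae_points J hd hX hind (p := fun x => x i ≠ x j)
      (measurableSet_eq_fun (by fun_prop) (by fun_prop)).compl
      fun x hx => hx.lift_ne J (by omega) hij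
  filter_upwards [h1, h2, h3] with w h1 h2 h3
  exact faceCount_convS_range_eq_sum h1 (fun i j h => by_contra fun hij => h3 i j hij h) h2

theorem lintegral_faceCount (hd : 2 ≤ d)
    (hX : ∀ i, HasLaw (X i) (uniformHalf (J (WithLp.toLp 2 (0, 1)))) P) (hind : iIndepFun X P) :
    ∫⁻ w, (faceCount 0 (convS (Set.range fun i => X i w)) : ℝ≥0∞) ∂P =
      (m + 1 : ℕ) * (ENNReal.ofReal (2 / omega (d + 1)) * missInt d m) := by
  have hms : ∀ i : Fin (m + 1), Measurable
      ((extremeAt E' i).indicator (1 : (Fin (m + 1) → E') → ℝ≥0∞)) := fun i =>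
    measurable_one.indicator (measurableSet_extremeAt i)
  have hmG : Measurable fun x : Fin (m + 1) → E' =>
      ∑ i, (extremeAt E' i).indicator (1 : (Fin (m + 1) → E') → ℝ≥0∞) x :=
    Finset.measurable_sum _ fun i _ => hms i
  have hmc : ∀ i : Fin (m + 1), Measurable fun x : Fin (m + 1) → H d × ℝ =>
      (extremeAt E' i).indicator (1 : (Fin (m + 1) → E') → ℝ≥0∞) fun i => lift J (x i) := fun i =>
    (hms i).comp (measurable_pi_lift J)
  rw [lintegral_congr_ae (ae_faceCount_eq J hd hX hind), lintegral_comp_points J hd hX hind hmG,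
    lintegral_finsetSum _ fun i _ => hmc i]
  have h : ∀ i : Fin (m + 1), ∫⁻ x, (extremeAt E' i).indicator
      (1 : (Fin (m + 1) → E') → ℝ≥0∞) (fun i => lift J (x i))
        ∂(Measure.pi fun _ : Fin (m + 1) => cylProb (H d)) =
      ENNReal.ofReal (2 / omega (d + 1)) * missInt d m := by
    intro i
    rw [← measure_extremeAt hd i, ← lintegral_indicator_one (measurableSet_extremeAt i)]
    apply lintegral_congr_ae
    filter_upwards [ae_genericTuple (d := d) (n := m + 1) (by omega)] with x hx
    have hiff : (fun i => lift J (x i)) ∈ extremeAt E' i ↔ x ∈ extremeAt (H d × ℝ) i :=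
      not_congr (lift_mem_hull_range_iff J (fun k => hx.ne_zero (i.succAbove k)) (hx.ne_zero i))
    by_cases hmem : x ∈ extremeAt (H d × ℝ) i
    · rw [Set.indicator_of_mem hmem, Set.indicator_of_mem (hiff.2 hmem)]
      rfl
    · rw [Set.indicator_of_notMem hmem, Set.indicator_of_notMem fun h => hmem (hiff.1 h)]
  simp only [h, Finset.sum_const, Finset.card_univ, Fintype.card_fin, nsmul_eq_mul]

theorem faceCount_integrable_and_integral (hd : 2 ≤ d)
    (hX : ∀ i, HasLaw (X i) (uniformHalf (J (WithLp.toLp 2 (0, 1)))) P) (hind : iIndepFun X P) :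
    Integrable (fun w => (faceCount 0 (convS (Set.range fun i => X i w)) : ℝ)) P ∧
    ∫ w, (faceCount 0 (convS (Set.range fun i => X i w)) : ℝ) ∂P =
      (m + 1) * (2 / omega (d + 1) * (missInt d m).toReal) := by
  have hω := omega_pos (Nat.succ_pos d)
  have hXm : AEMeasurable (fun w i => X i w) P :=
    aemeasurable_pi_lambda _ fun i => (hX i).aemeasurable
  have hmG : Measurable fun x : Fin (m + 1) → E' =>
      ∑ i, (extremeAt E' i).indicator (1 : (Fin (m + 1) → E') → ℝ≥0∞) x :=
    Finset.measurable_sum _ fun i _ => measurable_one.indicator (measurableSet_extremeAt i)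
  have hm : AEMeasurable (fun w => (faceCount 0 (convS (Set.range fun i => X i w)) : ℝ≥0∞)) P :=
    (hmG.comp_aemeasurable hXm).congr ((ae_faceCount_eq J hd hX hind).mono fun w hw => hw.symm)
  have hL := lintegral_faceCount J hd hX hind
  have hne : (m + 1 : ℕ) * (ENNReal.ofReal (2 / omega (d + 1)) * missInt d m) ≠ ⊤ :=
    ENNReal.mul_ne_top (ENNReal.natCast_ne_top _)
      (ENNReal.mul_ne_top ENNReal.ofReal_ne_top (missInt_ne_top hd m))
  have h1 := integrable_toReal_of_lintegral_ne_top hm (by rw [hL]; exact hne)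
  have h2 := integral_toReal hm (.of_forall fun w => ENNReal.natCast_lt_top _)
  simp only [ENNReal.toReal_natCast] at h1 h2
  refine ⟨h1, h2.trans ?_⟩
  rw [hL, ENNReal.toReal_mul, ENNReal.toReal_mul, ENNReal.toReal_natCast,
    ENNReal.toReal_ofReal (by positivity)]
  push_cast
  rfl

end Efron

theorem tendsto_succ_mul_of_abs_sub_le {M : ℕ → ℝ} {T K : ℝ} {N : ℕ}
    (h : ∀ n, N ≤ n → |M n - T * (n : ℝ)⁻¹| ≤ K * ((n : ℝ) ^ 2)⁻¹) :
    Tendsto (fun m : ℕ => ((m : ℝ) + 1) * M m) atTop (𝓝 T) := by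
  have hinv : Tendsto (fun m : ℕ => (m : ℝ)⁻¹) atTop (𝓝 0) := tendsto_inv_atTop_nhds_zero_nat
  have h1 : Tendsto (fun m : ℕ => (m : ℝ)⁻¹ ^ 2) atTop (𝓝 (0 ^ 2)) := hinv.pow 2
  have hb : Tendsto (fun m : ℕ => K * (m : ℝ)⁻¹ + K * (m : ℝ)⁻¹ ^ 2) atTop (𝓝 0) := by
    simpa using (hinv.const_mul K).add (h1.const_mul K)
  have hc : Tendsto (fun m : ℕ => T + T * (m : ℝ)⁻¹) atTop (𝓝 T) := by
    simpa using (hinv.const_mul T).const_add T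
  have hdiff : Tendsto (fun m : ℕ => ((m : ℝ) + 1) * M m - (T + T * (m : ℝ)⁻¹)) atTop (𝓝 0) := by
    refine squeeze_zero_norm' ?_ hb
    filter_upwards [eventually_ge_atTop (max N 1)] with m hm
    have hm0 : (0 : ℝ) < m := by exact_mod_cast (le_max_right N 1).trans hm
    have e : ((m : ℝ) + 1) * M m - (T + T * (m : ℝ)⁻¹) = (m + 1) * (M m - T * (m : ℝ)⁻¹) := by
      field_simp
    rw [e, Real.norm_eq_abs, abs_mul, abs_of_pos (by positivity)]
    calc _ ≤ ((m : ℝ) + 1) * (K * ((m : ℝ) ^ 2)⁻¹) :=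
          mul_le_mul_of_nonneg_left (h m ((le_max_left N 1).trans hm)) (by positivity)
      _ = _ := by field_simp
  simpa using hdiff.add hc

end SphPoly

/-! ### The theorem. -/

theorem theoremT7p1 (d : ℕ) (hd : 2 ≤ d) :
    ∃ C : ℝ,
      -- the constant `C(d)`: the integral converges and does not depend on the choice of `e`, `ē`
      (∀ (e : SphPoly.E d) (ebar : SphPoly.perp e), ‖e‖ = 1 → ‖ebar‖ = 1 →
        Integrable (SphPoly.weight d ebar) (SphPoly.halfPow d ebar) ∧
          SphPoly.constInt e ebar = C) ∧
      ∃ K : ℝ, ∀ (e : SphPoly.E d), ‖e‖ = 1 →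
        -- for every `n`, independent uniform random points `X n 0, …, X n (n-1)` in `𝕊_e^+`
        ∀ (Ω : ℕ → Type*) (mΩ : ∀ n, MeasurableSpace (Ω n)) (P : ∀ n, Measure (Ω n))
          (_ : ∀ n, IsProbabilityMeasure (P n))
          (X : ∀ n, Fin n → Ω n → SphPoly.E d),
          (∀ n i, HasLaw (X n i) (SphPoly.uniformHalf e) (P n)) →
          (∀ n, iIndepFun (X n) (P n)) →
          -- the expected missed volume
          (∀ n : ℕ, d + 1 ≤ n →
            Integrable (fun w => (SphPoly.sphMeasure (SphPoly.E d)).real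
              (SphPoly.halfSphere e \ SphPoly.randPoly (X n) w)) (P n) ∧
            |(∫ w, (SphPoly.sphMeasure (SphPoly.E d)).real
                (SphPoly.halfSphere e \ SphPoly.randPoly (X n) w) ∂(P n))
              - C * Real.pi ^ (d + 1) * (2 / SphPoly.omega (d + 1)) ^ d * SphPoly.omega d
                * (n : ℝ)⁻¹| ≤ K * ((n : ℝ) ^ 2)⁻¹) ∧
          -- the expected number of vertices
          (∀ n : ℕ, d + 1 ≤ n →
            Integrable (fun w => (SphPoly.faceCount 0 (SphPoly.randPoly (X n) w) : ℝ)) (P n)) ∧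
          Tendsto
            (fun n : ℕ => ∫ w, (SphPoly.faceCount 0 (SphPoly.randPoly (X n) w) : ℝ) ∂(P n))
            atTop
            (𝓝 (C * Real.pi ^ (d + 1) * (2 / SphPoly.omega (d + 1)) ^ (d + 1)
              * SphPoly.omega d)) := by
  obtain ⟨K, hK⟩ := SphPoly.exists_missInt_asymptotics hd
  refine ⟨SphPoly.weightConst d, fun e ebar he hebar => ?_, K, ?_⟩
  · have hfact : Fact (Module.finrank ℝ (SphPoly.E d) = d + 1) := ⟨by simp⟩
    have he0 : e ≠ 0 := by rintro rfl; simp at he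
    have hfin : Module.finrank ℝ (SphPoly.perp e) = d :=
      Submodule.finrank_orthogonal_span_singleton he0
    exact SphPoly.integrable_weight_and_integral_eq (by omega) hfin hebar
  · intro e he Ω mΩ P hP X hX hind
    -- Coordinates in which `e` is the pole. The constant `K` was fixed before `e`, since `missInt`
    -- does not depend on it.
    obtain ⟨J, hJ⟩ := SphPoly.exists_linearIsometryEquiv_map_eq
      (V := WithLp 2 (SphPoly.H d × ℝ)) (W := SphPoly.E d)
      (by rw [SphPoly.finrank_withLp_prod_real]; simp)
      (SphPoly.norm_pole (LinearIsometryEquiv.refl ℝ (WithLp 2 (SphPoly.H d × ℝ)))) he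
    subst hJ
    refine ⟨fun n hn => ?_, fun n hn => ?_, ?_⟩
    · obtain ⟨h1, h2⟩ := SphPoly.missed_integrable_and_integral J hd (hX n) (hind n)
      refine ⟨h1, ?_⟩
      exact (congrArg (fun t => |t - _|) h2).trans_le (hK n hn)
    · obtain ⟨m, rfl⟩ : ∃ m, n = m + 1 := ⟨n - 1, by omega⟩
      exact (SphPoly.faceCount_integrable_and_integral J hd (hX _) (hind _)).1
    -- Shift to `n = m + 1`: the vertices of `m + 1` points are counted by the measure that `m`
    -- points miss.
    · refine (tendsto_add_atTop_iff_nat 1).1 ?_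
      have h := (SphPoly.tendsto_succ_mul_of_abs_sub_le hK).const_mul (2 / SphPoly.omega (d + 1))
      convert! h using 2 with m
      · refine (SphPoly.faceCount_integrable_and_integral J hd (hX _) (hind _)).2.trans ?_
        ring
      · ring
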